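/- Fix a field $k$; all categories and functors are $k$-linear. Let $\mathcal C$ be an abelian monoidal category whose tensor product is bilinear. **Definitions.** A left $\mathcal C$-module category is an abelian category $\mathcal M$ with a bilinear functor $\triangleright:\mathcal C\times\mathcal M\to\mathcal M$ and coherent unit and associativity isomorphisms; an equivalence of $\mathcal C$-module categories is a strong $\mathcal C$-module functor which is an equivalence of categories. An object $X\in\mathcal M$ is *closed* (*coclosed*) if $-\triangleright X:\mathcal C\to\mathcal M$ has a right (left) adjoint, denoted $[X,-]$. It is *$\mathcal C$-projective* if $P\triangleright X$ is projective for every projective $P\in\mathcal C$, and a *$\mathcal C$-generator* if every projective object of $\mathcal M$ is a direct summand of $P\triangleright X$ for some projective $P\in\mathcal C$. Dually, $X$ is *$\mathcal C$-injective* if $I\triangleright X$ is injective for every injective $I\in\mathcal C$, and a *$\mathcal C$-cogenerator* if every injective object of $\mathcal M$ is a direct summand of $I\triangleright X$ for some injective $I\in\mathcal C$. A *lax $\mathcal C$-module monad* on $\mathcal C$ is a monad $(T,\mu,\eta)$ with a lax $\mathcal C$-module functor structure $T_{a;V,X}:V\otimes T(X)\to T(V\otimes X)$ on $T$ for which $\mu$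 and $\eta$ are $\mathcal C$-module transformations; an *oplax $\mathcal C$-module comonad* is defined dually. Let $\mathbf{EM}(T)$ be the Eilenberg–Moore category. A *Linton module structure* on $\mathbf{EM}(T)$ is a left $\mathcal C$-module category structure $\blacktriangleright$ in which, naturally in $V\in\mathcal C$ and $(A,\nabla)\in\mathbf{EM}(T)$, the object $V\blacktriangleright A$ is the coequalizer in $\mathbf{EM}(T)$ of $$T(V\otimes\nabla),\ \ \mu_{V\otimes A}\circ T(T_{a;V,A})\ :\ T(V\otimes T(A))\rightrightarrows T(V\otimes A),$$ with coequalizer map $\pi_{V,A}:T(V\otimes A)\to V\blacktriangleright A$, and whose unit isomorphism $\mathbb 1\blacktriangleright A\cong A$ and associativity isomorphism $(V\otimes W)\blacktriangleright A\cong V\blacktriangleright(W\blacktriangleright A)$ are induced on the coequalizers by the unitor and the associator of $\mathcal C$: they are the maps through which, respectively, $$T(\mathbb 1\otimes A)\cong T(A)\xrightarrow{\nabla}A\qquad\text{and}\qquad T((V\otimes W)\otimes A)\cong T(V\otimes(W\otimes A))\xrightarrow{T(V\otimes(\pi_{W,A}\circ\eta))}T(V\otimes(W\blacktriangleright A))\xrightarrow{\pi_{V,W\blacktriangleright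 A}}V\blacktriangleright(W\blacktriangleright A)$$ factor over $\pi_{\mathbb 1,A}$ and $\pi_{V\otimes W,A}$. Linton module structures on the Eilenberg–Moore category of an oplax $\mathcal C$-module comonad are defined dually, by equalizers. **Theorem.** (1) Suppose that $\mathcal C$ has enough projectives and that $\otimes$ is right exact in both variables. Let $T$ be a right exact lax $\mathcal C$-module monad on $\mathcal C$. Then $\mathbf{EM}(T)$ has a Linton module structure, any two of them give equivalent $\mathcal C$-module categories, the action is right exact in both variables, $\mathbf{EM}(T)$ has enough projectives, and the free module $T(\mathbb 1)$ is a closed $\mathcal C$-projective $\mathcal C$-generator of $\mathbf{EM}(T)$. Let $\mathcal P$ be the class of pairs $(\mathcal M,X)$ where $\mathcal M$ is an abelian $\mathcal C$-module category with enough projectives whose action is right exact in both variables and $X\in\mathcal M$ is a closed $\mathcal C$-projective $\mathcal C$-generator. Then $[X,-\triangleright X]$, with the lax structure induced by the adjunction $-\triangleright X\dashv[X,-]$, is a right exact lax $\mathcal C$-module monad on $\mathcal C$ for each $(\mathcal M,X)\in\mathcal P$, and there are mutually inverse bijections $$\mathcal P/(\mathcal M\simeq\mathcal N)\ \longleftrightarrow\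 \{\text{right exact lax }\mathcal C\text{-module monads on }\mathcal C\}/(\mathbf{EM}(T)\simeq\mathbf{EM}(S)),$$ $$(\mathcal M,X)\mapsto[X,-\triangleright X],\qquad (\mathbf{EM}(T),T(\mathbb 1))\leftarrow\!\shortmid T.$$ Here pairs $(\mathcal M,X)$, $(\mathcal N,Y)$ are identified when $\mathcal M\simeq\mathcal N$ as $\mathcal C$-module categories, and monads $T,S$ when $\mathbf{EM}(T)\simeq\mathbf{EM}(S)$ as $\mathcal C$-module categories with the Linton module structures; both are equivalence relations. (2) Dually, suppose that $\mathcal C$ has enough injectives and that $\otimes$ is left exact in both variables. Let $G$ be a left exact oplax $\mathcal C$-module comonad on $\mathcal C$. Then $\mathbf{EM}(G)$ has a Linton module structure, any two of them give equivalent $\mathcal C$-module categories, the action is left exact in both variables, $\mathbf{EM}(G)$ has enough injectives, and the cofree comodule $G(\mathbb 1)$ is a coclosed $\mathcal C$-injective $\mathcal C$-cogenerator of $\mathbf{EM}(G)$. Let $\mathcal I$ be the class of pairs $(\mathcal M,X)$ where $\mathcal M$ is an abelian $\mathcal C$-module category with enough injectives whose action is left exact in both variables and $X\in\mathcal M$ is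 a coclosed $\mathcal C$-injective $\mathcal C$-cogenerator. Then $[X,-\triangleright X]$, with the oplax structure induced by the adjunction $[X,-]\dashv-\triangleright X$, is a left exact oplax $\mathcal C$-module comonad on $\mathcal C$ for each $(\mathcal M,X)\in\mathcal I$, and $(\mathcal M,X)\mapsto[X,-\triangleright X]$ and $G\mapsto(\mathbf{EM}(G),G(\mathbb 1))$ induce mutually inverse bijections between $\mathcal I$ up to equivalence $\mathcal M\simeq\mathcal N$ of $\mathcal C$-module categories and left exact oplax $\mathcal C$-module comonads on $\mathcal C$ up to equivalence $\mathbf{EM}(G)\simeq\mathbf{EM}(H)$ of $\mathcal C$-module categories; both are equivalence relations. -/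

import Mathlib

open CategoryTheory Category Limits MonoidalCategory MonoidalLeftAction
open CategoryTheory.Functor.LaxLeftLinear CategoryTheory.Functor.OplaxLeftLinear
universe w' v' u' w v u

noncomputable section
namespace ModuleReconstruction

section Abelian

/-- A preadditive category with finite products, kernels and cokernels and an exact
isomorphism-reflecting functor to an abelian category is abelian. -/
abbrev abelianOfExactReflects {A : Type*} [Category* A] [Preadditive A] {B : Type*} [Category* B]
    [Abelian B] [HasFiniteProducts A] [HasKernels A] [HasCokernels A] (F : A ⥤ B) [F.Additive]
    [PreservesFiniteLimits F] [PreservesFiniteColimits F] [F.ReflectsIsomorphisms] : Abelian A :=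
  have : ∀ {X Y : A} (f : X ⟶ Y), IsIso (Abelian.coimageImageComparison f) := fun f => by
    have : IsIso (F.map (Abelian.coimageImageComparison f)) := by
      rw [Arrow.isIso_iff_isIso_of_isIso (Abelian.PreservesCoimageImageComparison.iso F f).hom]
      infer_instance
    exact isIso_of_reflects_iso _ F
  Abelian.ofCoimageImageComparisonIsIso

variable {M : Type u} [Category.{v} M] [Abelian M]

instance algebraAbelian (T : Monad M) [T.toFunctor.Additive]
    [PreservesFiniteColimits T.toFunctor] : Abelian T.Algebra :=
  have : HasFiniteProducts T.Algebra := ⟨fun _ => ⟨fun D => T.hasLimit_of_comp_forget_hasLimit D⟩⟩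
  have : HasKernels T.Algebra := ⟨fun _ => T.hasLimit_of_comp_forget_hasLimit _⟩
  have : HasCokernels T.Algebra := ⟨fun _ => T.forget_creates_colimits_of_monad_preserves _⟩
  have : PreservesFiniteColimits T.forget := ⟨fun _ _ _ => inferInstance⟩
  abelianOfExactReflects T.forget

instance coalgebraAbelian (G : Comonad M) [G.toFunctor.Additive]
    [PreservesFiniteLimits G.toFunctor] : Abelian G.Coalgebra :=
  have : HasFiniteProducts G.Coalgebra :=
    ⟨fun _ => ⟨fun D => G.forget_creates_limits_of_comonad_preserves D⟩⟩
  have : HasKernels G.Coalgebra := ⟨fun _ => G.forget_creates_limits_of_comonad_preserves _⟩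
  have : HasCokernels G.Coalgebra := ⟨fun _ => G.hasColimit_of_comp_forget_hasColimit _⟩
  have : PreservesFiniteLimits G.forget := ⟨fun _ _ _ => inferInstance⟩
  abelianOfExactReflects G.forget

variable {k : Type w} [Field k] [Linear k M]

instance algebraLinear (T : Monad M) [T.toFunctor.Additive] [T.toFunctor.Linear k] :
    Linear k T.Algebra where
  homModule A B :=
    { smul r f := ⟨r • f.f, by simp⟩
      one_smul f := Monad.Algebra.Hom.ext (one_smul k f.f)
      mul_smul r s f := Monad.Algebra.Hom.ext (mul_smul r s f.f)
      smul_zero r := Monad.Algebra.Hom.ext (smul_zero r)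
      smul_add r f g := Monad.Algebra.Hom.ext (smul_add r f.f g.f)
      add_smul r s f := Monad.Algebra.Hom.ext (add_smul r s f.f)
      zero_smul f := Monad.Algebra.Hom.ext (zero_smul k f.f) }
  smul_comp _ _ _ r f g := Monad.Algebra.Hom.ext (Linear.smul_comp _ _ _ r f.f g.f)
  comp_smul _ _ _ f r g := Monad.Algebra.Hom.ext (Linear.comp_smul _ _ _ f.f r g.f)

instance coalgebraLinear (G : Comonad M) [G.toFunctor.Additive] [G.toFunctor.Linear k] :
    Linear k G.Coalgebra where
  homModule A B :=
    { smul r f := ⟨r • f.f, by simp⟩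
      one_smul f := Comonad.Coalgebra.Hom.ext (one_smul k f.f)
      mul_smul r s f := Comonad.Coalgebra.Hom.ext (mul_smul r s f.f)
      smul_zero r := Comonad.Coalgebra.Hom.ext (smul_zero r)
      smul_add r f g := Comonad.Coalgebra.Hom.ext (smul_add r f.f g.f)
      add_smul r s f := Comonad.Coalgebra.Hom.ext (add_smul r s f.f)
      zero_smul f := Comonad.Coalgebra.Hom.ext (zero_smul k f.f) }
  smul_comp _ _ _ r f g := Comonad.Coalgebra.Hom.ext (Linear.smul_comp _ _ _ r f.f g.f)
  comp_smul _ _ _ f r g := Comonad.Coalgebra.Hom.ext (Linear.comp_smul _ _ _ f.f r g.f)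

end Abelian

section Actions

variable (k : Type w) [Field k] (C : Type u) [Category.{v} C] [MonoidalCategory C]
variable (M : Type u') [Category.{v'} M] [MonoidalLeftAction C M]

/-- The action bifunctor is `k`-bilinear. -/
class LinearAction [Preadditive C] [Linear k C] [Preadditive M] [Linear k M] : Prop where
  actionHomRight_add (V : C) {X Y : M} (f g : X ⟶ Y) : V ⊴ₗ (f + g) = V ⊴ₗ f + V ⊴ₗ g
  actionHomRight_smul (V : C) {X Y : M} (r : k) (f : X ⟶ Y) : V ⊴ₗ (r • f) = r • V ⊴ₗ f
  add_actionHomLeft {V W : C} (f g : V ⟶ W) (X : M) : (f + g) ⊵ₗ X = f ⊵ₗ X + g ⊵ₗ X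
  smul_actionHomLeft {V W : C} (r : k) (f : V ⟶ W) (X : M) : (r • f) ⊵ₗ X = r • f ⊵ₗ X

/-- The action bifunctor is right exact in both variables. For the regular action of `C` on itself
this says that the tensor product is right exact in both variables. -/
class RightExactAction : Prop where
  actionLeft (V : C) : PreservesFiniteColimits (actionLeft M V)
  actionRight (X : M) : PreservesFiniteColimits (actionRight C X)

/-- The action bifunctor is left exact in both variables. -/
class LeftExactAction : Prop where
  actionLeft (V : C) : PreservesFiniteLimits (actionLeft M V)
  actionRight (X : M) : PreservesFiniteLimits (actionRight C X)

end Actions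

section ModuleFunctors

variable {C : Type u} [Category.{v} C] [MonoidalCategory C]
variable {M : Type*} [Category* M] [MonoidalLeftAction C M]
variable {N : Type*} [Category* N] [MonoidalLeftAction C N]
variable {L : Type*} [Category* L] [MonoidalLeftAction C L]

/-- The functor `- ▷ X : C ⥤ M` is a strong `C`-module functor. -/
instance actionRightLeftLinear (X : M) : (actionRight C X).LeftLinear C where
  μₗ V W := (αₗ V W X).inv
  δₗ V W := (αₗ V W X).hom
  μₗ_naturality_left f V := by
    change f ⊵ₗ (V ⊙ₗ X) ≫ _ = _ ≫ (f ▷ V) ⊵ₗ X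
    simp
  μₗ_naturality_right V _ _ f := by
    change V ⊴ₗ f ⊵ₗ X ≫ _ = _ ≫ (V ◁ f) ⊵ₗ X
    simp
  μₗ_associativity V W U := by
    change (αₗ (V ⊗ W) U X).inv ≫ (α_ V W U).hom ⊵ₗ X =
      (αₗ V W (U ⊙ₗ X)).hom ≫ V ⊴ₗ (αₗ W U X).inv ≫ (αₗ V (W ⊗ U) X).inv
    rw [Iso.inv_comp_eq, ← associator_actionHom_assoc]
    simp
  μₗ_unitality V := by
    change (λₗ (V ⊙ₗ X)).hom = (αₗ (𝟙_ C) V X).inv ≫ (λ_ V).hom ⊵ₗ X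
    simp
  δₗ_naturality_left f V := by
    change (f ▷ V) ⊵ₗ X ≫ _ = _ ≫ f ⊵ₗ (V ⊙ₗ X)
    simp
  δₗ_naturality_right V _ _ f := by
    change (V ◁ f) ⊵ₗ X ≫ _ = _ ≫ V ⊴ₗ f ⊵ₗ X
    simp
  δₗ_associativity V W U := (associator_actionHom V W U X).symm
  δₗ_unitality_inv V := by
    change (λₗ (V ⊙ₗ X)).inv = (λ_ V).inv ⊵ₗ X ≫ (αₗ (𝟙_ C) V X).hom
    rw [← cancel_mono (λₗ (V ⊙ₗ X)).hom, Iso.inv_hom_id, assoc, ← leftUnitor_actionHom,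
      inv_hom_actionHomLeft]
  μₗ_comp_δₗ V W := (αₗ V W X).inv_hom_id
  δₗ_comp_μₗ V W := (αₗ V W X).hom_inv_id

section Mates

variable {F : M ⥤ N} {G : N ⥤ M}

/-- The mate of the structure of an oplax `C`-module functor under an adjunction. -/
def laxMate (adj : F ⊣ G) [F.OplaxLeftLinear C] (V : C) (X : N) :
    V ⊙ₗ G.obj X ⟶ G.obj (V ⊙ₗ X) :=
  adj.homEquiv _ _ (δₗ F V (G.obj X) ≫ V ⊴ₗ adj.counit.app X)

/-- The mate of the structure of a lax `C`-module functor under an adjunction. -/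
def oplaxMate (adj : F ⊣ G) [G.LaxLeftLinear C] (V : C) (X : M) :
    F.obj (V ⊙ₗ X) ⟶ V ⊙ₗ F.obj X :=
  (adj.homEquiv _ _).symm (V ⊴ₗ adj.unit.app X ≫ μₗ G V (F.obj X))

theorem symm_laxMate (adj : F ⊣ G) [F.OplaxLeftLinear C] (V : C) (X : N) :
    (adj.homEquiv _ _).symm (laxMate adj V X) = δₗ F V (G.obj X) ≫ V ⊴ₗ adj.counit.app X :=
  Equiv.symm_apply_apply _ _

theorem homEquiv_oplaxMate (adj : F ⊣ G) [G.LaxLeftLinear C] (V : C) (X : M) :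
    adj.homEquiv _ _ (oplaxMate adj V X) = V ⊴ₗ adj.unit.app X ≫ μₗ G V (F.obj X) :=
  Equiv.apply_symm_apply _ _

theorem map_comp_counit (adj : F ⊣ G) {A : M} {B : N} (f : A ⟶ G.obj B) :
    F.map f ≫ adj.counit.app B = (adj.homEquiv _ _).symm f :=
  (adj.homEquiv_counit ..).symm

theorem unit_comp_map (adj : F ⊣ G) {A : M} {B : N} (f : F.obj A ⟶ B) :
    adj.unit.app A ≫ G.map f = adj.homEquiv _ _ f :=
  (adj.homEquiv_unit ..).symm

/-- The right adjoint of an oplax `C`-module functor is a lax `C`-module functor. -/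
abbrev rightAdjointLax (adj : F ⊣ G) [F.OplaxLeftLinear C] : G.LaxLeftLinear C where
  μₗ V X := laxMate adj V X
  μₗ_naturality_left f X := (adj.homEquiv _ _).symm.injective (by
    rw [adj.homEquiv_naturality_left_symm, adj.homEquiv_naturality_right_symm, symm_laxMate,
      symm_laxMate, δₗ_naturality_left_assoc, assoc]
    exact congrArg _ (action_exchange f (adj.counit.app X)).symm)
  μₗ_naturality_right V _ _ f := (adj.homEquiv _ _).symm.injective (by
    rw [adj.homEquiv_naturality_left_symm, adj.homEquiv_naturality_right_symm, symm_laxMate,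
      symm_laxMate, δₗ_naturality_right_assoc, assoc]
    refine congrArg _ ?_
    rw [← actionHomRight_comp]
    exact (congrArg (V ⊴ₗ ·) (adj.counit_naturality f)).trans (actionHomRight_comp ..))
  μₗ_associativity V W U := (adj.homEquiv _ _).symm.injective (by
    rw [adj.homEquiv_naturality_right_symm, adj.homEquiv_naturality_left_symm,
      adj.homEquiv_naturality_left_symm, symm_laxMate, symm_laxMate, δₗ_naturality_right_assoc,
      ← actionHomRight_comp, map_comp_counit, symm_laxMate]
    simp)
  μₗ_unitality X := (adj.homEquiv _ _).symm.injective (by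
    rw [adj.homEquiv_naturality_right_symm, symm_laxMate, adj.homEquiv_counit, assoc,
      ← actionUnitIso_hom_naturality, δₗ_unitality_hom_assoc])

/-- The left adjoint of a lax `C`-module functor is an oplax `C`-module functor. -/
abbrev leftAdjointOplax (adj : F ⊣ G) [G.LaxLeftLinear C] : F.OplaxLeftLinear C where
  δₗ V X := oplaxMate adj V X
  δₗ_naturality_left f X := (adj.homEquiv _ _).injective (by
    rw [adj.homEquiv_naturality_left, adj.homEquiv_naturality_right, homEquiv_oplaxMate,
      homEquiv_oplaxMate, assoc, ← μₗ_naturality_left]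
    exact action_exchange_assoc f (adj.unit.app X) _ |>.symm)
  δₗ_naturality_right V _ _ f := (adj.homEquiv _ _).injective (by
    rw [adj.homEquiv_naturality_left, adj.homEquiv_naturality_right, homEquiv_oplaxMate,
      homEquiv_oplaxMate, assoc, ← μₗ_naturality_right]
    rw [← assoc, ← assoc, ← actionHomRight_comp]
    exact congrArg (· ≫ _) ((congrArg (V ⊴ₗ ·) (adj.unit_naturality f)).symm.trans
      (actionHomRight_comp ..)))
  δₗ_associativity V W U := (adj.homEquiv _ _).injective (by
    rw [adj.homEquiv_naturality_left, adj.homEquiv_naturality_right,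
      adj.homEquiv_naturality_right, homEquiv_oplaxMate,
      homEquiv_oplaxMate, assoc, assoc, ← μₗ_naturality_right, ← actionHomRight_comp_assoc,
      unit_comp_map, homEquiv_oplaxMate, μₗ_associativity]
    simp)
  δₗ_unitality_inv X := (adj.homEquiv _ _).injective (by
    rw [adj.homEquiv_naturality_left, homEquiv_oplaxMate, adj.homEquiv_unit,
      ← μₗ_unitality_inv]
    exact (actionUnitIso_inv_naturality_assoc (adj.unit.app X) _).symm)

theorem symm_laxMate_comp (adj : F ⊣ G) [F.LeftLinear C] (V : C) {A X : M}
    (f : A ⟶ G.obj (F.obj X)) :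
    (adj.homEquiv _ _).symm (V ⊴ₗ f ≫ laxMate adj V (F.obj X) ≫ G.map (μₗ F V X)) =
      δₗ F V A ≫ V ⊴ₗ (adj.homEquiv _ _).symm f ≫ μₗ F V X := by
  rw [adj.homEquiv_naturality_left_symm, adj.homEquiv_naturality_right_symm, symm_laxMate, assoc,
    δₗ_naturality_right_assoc, ← actionHomRight_comp_assoc, map_comp_counit]

theorem homEquiv_comp_oplaxMate (adj : F ⊣ G) [G.LeftLinear C] (V : C) {X B : N}
    (f : F.obj (G.obj X) ⟶ B) :
    adj.homEquiv _ _ ((F.map (δₗ G V X) ≫ oplaxMate adj V (G.obj X)) ≫ V ⊴ₗ f) =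
      δₗ G V X ≫ V ⊴ₗ adj.homEquiv _ _ f ≫ μₗ G V B := by
  rw [adj.homEquiv_naturality_right, adj.homEquiv_naturality_left, homEquiv_oplaxMate, assoc,
    assoc, ← μₗ_naturality_right, ← actionHomRight_comp_assoc, unit_comp_map]

theorem unit_laxMate (adj : F ⊣ G) [F.LeftLinear C] (V : C) (X : M) :
    V ⊴ₗ adj.unit.app X ≫ laxMate adj V (F.obj X) ≫ G.map (μₗ F V X) =
      adj.unit.app (V ⊙ₗ X) := by
  have e (Y : M) : (adj.homEquiv Y (F.obj Y)).symm (adj.unit.app Y) = 𝟙 (F.obj Y) :=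
    (adj.homEquiv_counit ..).trans (adj.left_triangle_components Y)
  refine (adj.homEquiv (V ⊙ₗ X) (F.obj (V ⊙ₗ X))).symm.injective
    ((symm_laxMate_comp adj V (adj.unit.app X)).trans (.trans ?_ (e _).symm))
  refine (congrArg (fun t => δₗ F V X ≫ V ⊴ₗ t ≫ μₗ F V X) (e X)).trans ?_
  simp

theorem counit_laxMate (adj : F ⊣ G) [F.LeftLinear C] (V : C) (X : M) :
    V ⊴ₗ G.map (adj.counit.app (F.obj X)) ≫ laxMate adj V (F.obj X) ≫ G.map (μₗ F V X) =
      (laxMate adj V (F.obj (G.obj (F.obj X))) ≫ G.map (μₗ F V (G.obj (F.obj X)))) ≫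
        G.map (F.map (laxMate adj V (F.obj X) ≫ G.map (μₗ F V X))) ≫
          G.map (adj.counit.app (F.obj (V ⊙ₗ X))) := by
  have e (Y : M) : (adj.homEquiv (G.obj (F.obj Y)) (F.obj Y)).symm (𝟙 _) =
      adj.counit.app (F.obj Y) := (adj.homEquiv_counit ..).trans (by simp)
  have e' : (adj.homEquiv (G.obj (F.obj (G.obj (F.obj X)))) (F.obj X)).symm
      (G.map (adj.counit.app (F.obj X))) =
      adj.counit.app (F.obj (G.obj (F.obj X))) ≫ adj.counit.app (F.obj X) :=
    (adj.homEquiv_counit ..).trans (adj.counit_naturality _)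
  have h (Y : M) : (adj.homEquiv _ _).symm (laxMate adj V (F.obj Y) ≫ G.map (μₗ F V Y)) =
      δₗ F V (G.obj (F.obj Y)) ≫ V ⊴ₗ adj.counit.app (F.obj Y) ≫ μₗ F V Y := by
    rw [← e Y, ← symm_laxMate_comp, actionHomRight_id, id_comp]
  refine (adj.homEquiv _ _).symm.injective
    ((symm_laxMate_comp adj V (G.map (adj.counit.app (F.obj X)))).trans ?_)
  rw [← Functor.map_comp]
  refine .trans ?_ (adj.homEquiv_naturality_right_symm _ _).symm
  refine (congrArg (fun t => δₗ F V _ ≫ V ⊴ₗ t ≫ μₗ F V X) e').trans ?_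
  refine .trans ?_ (congrArg₂ (· ≫ ·) (h (G.obj (F.obj X))) (map_comp_counit adj _)).symm
  rw [h X]
  simp

theorem oplaxMate_counit (adj : F ⊣ G) [G.LeftLinear C] (V : C) (X : N) :
    (F.map (δₗ G V X) ≫ oplaxMate adj V (G.obj X)) ≫ V ⊴ₗ adj.counit.app X =
      adj.counit.app (V ⊙ₗ X) := by
  have e (Y : N) : adj.homEquiv (G.obj Y) Y (adj.counit.app Y) = 𝟙 (G.obj Y) :=
    (adj.homEquiv_unit ..).trans (adj.right_triangle_components Y)
  refine (adj.homEquiv (G.obj (V ⊙ₗ X)) (V ⊙ₗ X)).injective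
    ((homEquiv_comp_oplaxMate adj V (adj.counit.app X)).trans (.trans ?_ (e _).symm))
  refine (congrArg (fun t => δₗ G V X ≫ V ⊴ₗ t ≫ μₗ G V X) (e X)).trans ?_
  simp

theorem oplaxMate_unit (adj : F ⊣ G) [G.LeftLinear C] (V : C) (X : N) :
    (F.map (δₗ G V X) ≫ oplaxMate adj V (G.obj X)) ≫ V ⊴ₗ F.map (adj.unit.app (G.obj X)) =
      F.map (adj.unit.app (G.obj (V ⊙ₗ X))) ≫
        F.map (G.map (F.map (δₗ G V X) ≫ oplaxMate adj V (G.obj X))) ≫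
          F.map (δₗ G V (F.obj (G.obj X))) ≫ oplaxMate adj V (G.obj (F.obj (G.obj X))) := by
  have e (Y : N) : adj.homEquiv (G.obj Y) (F.obj (G.obj Y)) (𝟙 _) =
      adj.unit.app (G.obj Y) := (adj.homEquiv_unit ..).trans (by simp)
  have e' : adj.homEquiv (G.obj X) (F.obj (G.obj (F.obj (G.obj X))))
      (F.map (adj.unit.app (G.obj X))) =
      adj.unit.app (G.obj X) ≫ adj.unit.app (G.obj (F.obj (G.obj X))) :=
    (adj.homEquiv_unit ..).trans (adj.unit_naturality _)
  have h (Y : N) : adj.homEquiv _ _ (F.map (δₗ G V Y) ≫ oplaxMate adj V (G.obj Y)) =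
      δₗ G V Y ≫ V ⊴ₗ adj.unit.app (G.obj Y) ≫ μₗ G V (F.obj (G.obj Y)) := by
    rw [← e Y, ← homEquiv_comp_oplaxMate, actionHomRight_id, comp_id]
  refine (adj.homEquiv _ _).injective
    ((homEquiv_comp_oplaxMate adj V (F.map (adj.unit.app (G.obj X)))).trans ?_)
  rw [← Functor.map_comp_assoc]
  refine .trans ?_ (adj.homEquiv_naturality_left _ _).symm
  refine (congrArg (fun t => δₗ G V X ≫ V ⊴ₗ t ≫ μₗ G V _) e').trans ?_
  refine .trans ?_ (congrArg₂ (· ≫ ·) (unit_comp_map adj _) (h (F.obj (G.obj X)))).symm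
  rw [h X]
  simp

end Mates

abbrev compLax (F : M ⥤ N) (G : N ⥤ L) [F.LaxLeftLinear C] [G.LaxLeftLinear C] :
    (F ⋙ G).LaxLeftLinear C where
  μₗ V X := μₗ G V (F.obj X) ≫ G.map (μₗ F V X)
  μₗ_naturality_left f V := by simp [← Functor.map_comp]
  μₗ_naturality_right V _ _ f := by simp [← Functor.map_comp]
  μₗ_associativity V W U := by
    simp only [Functor.comp_obj, Functor.comp_map, assoc, ← Functor.map_comp, μₗ_associativity F]
    simp
  μₗ_unitality V := by simp [← Functor.map_comp]

abbrev compOplax (F : M ⥤ N) (G : N ⥤ L) [F.OplaxLeftLinear C] [G.OplaxLeftLinear C] :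
    (F ⋙ G).OplaxLeftLinear C where
  δₗ V X := G.map (δₗ F V X) ≫ δₗ G V (F.obj X)
  δₗ_naturality_left f V := by simp [← Functor.map_comp_assoc]
  δₗ_naturality_right V _ _ f := by simp [← Functor.map_comp_assoc]
  δₗ_associativity V W U := by
    have h := congrArg G.map (δₗ_associativity F V W U)
    simp only [Functor.map_comp] at h
    simp only [Functor.comp_obj, Functor.comp_map, assoc, actionHomRight_comp,
      δₗ_associativity G]
    rw [reassoc_of% h, δₗ_naturality_right_assoc]
  δₗ_unitality_inv V := by simp

end ModuleFunctors

section Categories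

variable (k : Type w) [Field k] (C : Type u) [Category.{v} C] [Preadditive C] [Linear k C]
  [MonoidalCategory C]

/-- A `k`-linear abelian left module category over the `k`-linear monoidal category `C`. -/
structure AbelianModuleCategory where
  carrier : Type u'
  [category : Category.{v'} carrier]
  [abelian : Abelian carrier]
  [linear : Linear k carrier]
  [action : MonoidalLeftAction C carrier]
  [linearAction : LinearAction k C carrier]

instance : CoeSort (AbelianModuleCategory.{v', u'} k C) (Type u') :=
  ⟨AbelianModuleCategory.carrier⟩

attribute [instance] AbelianModuleCategory.category AbelianModuleCategory.abelian
  AbelianModuleCategory.linear AbelianModuleCategory.action AbelianModuleCategory.linearAction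

variable {k C}

/-- Equivalence of `k`-linear `C`-module categories: there is a `k`-linear strong `C`-module functor
which is an equivalence of categories. -/
def AbelianModuleCategory.Equivalent (M : AbelianModuleCategory.{v', u'} k C)
    (N : AbelianModuleCategory.{v', u'} k C) : Prop :=
  ∃ F : M ⥤ N, F.IsEquivalence ∧ F.Additive ∧ F.Linear k ∧ Nonempty (F.LeftLinear C)

namespace AbelianModuleCategory

variable (M : AbelianModuleCategory.{v', u'} k C)

/-- `X` is closed: the functor `- ▷ X : C ⥤ M` has a right adjoint. -/
def IsClosedObject (X : M) : Prop := (actionRight C X).IsLeftAdjoint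

/-- `X` is coclosed: the functor `- ▷ X : C ⥤ M` has a left adjoint. -/
def IsCoclosedObject (X : M) : Prop := (actionRight C X).IsRightAdjoint

/-- `X` is `C`-projective: `P ▷ X` is projective for every projective object `P` of `C`. -/
def IsCProjective (X : M) : Prop := ∀ P : C, Projective P → Projective (P ⊙ₗ X)

/-- `X` is `C`-injective: `I ▷ X` is injective for every injective object `I` of `C`. -/
def IsCInjective (X : M) : Prop := ∀ I : C, Injective I → Injective (I ⊙ₗ X)

/-- `X` is a `C`-generator: every projective object of `M` is a direct summand of `P ▷ X` for some
projective object `P` of `C`. -/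
def IsCGenerator (X : M) : Prop :=
  ∀ Q : M, Projective Q → ∃ P : C, Projective P ∧ Nonempty (Retract Q (P ⊙ₗ X))

/-- `X` is a `C`-cogenerator: every injective object of `M` is a direct summand of `I ▷ X` for some
injective object `I` of `C`. -/
def IsCCogenerator (X : M) : Prop :=
  ∀ J : M, Injective J → ∃ I : C, Injective I ∧ Nonempty (Retract J (I ⊙ₗ X))

/-- The action on `M` is right exact in both variables, `M` has enough projectives, and `X` is a
closed `C`-projective `C`-generator of `M`. -/
structure IsProjectiveReconstruction (X : M) : Prop where
  rightExact : RightExactAction C M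
  enoughProjectives : EnoughProjectives M
  closed : M.IsClosedObject X
  projective : M.IsCProjective X
  generator : M.IsCGenerator X

/-- The action on `M` is left exact in both variables, `M` has enough injectives, and `X` is a
coclosed `C`-injective `C`-cogenerator of `M`. -/
structure IsInjectiveReconstruction (X : M) : Prop where
  leftExact : LeftExactAction C M
  enoughInjectives : EnoughInjectives M
  coclosed : M.IsCoclosedObject X
  injective : M.IsCInjective X
  cogenerator : M.IsCCogenerator X

end AbelianModuleCategory

variable (k C)

/-- The pairs `(M, X)` with `X` a closed `C`-projective `C`-generator of `M`. -/
structure ProjectivePair where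
  M : AbelianModuleCategory.{v', u'} k C
  X : M
  prop : M.IsProjectiveReconstruction X

/-- The pairs `(M, X)` with `X` a coclosed `C`-injective `C`-cogenerator of `M`. -/
structure InjectivePair where
  M : AbelianModuleCategory.{v', u'} k C
  X : M
  prop : M.IsInjectiveReconstruction X

variable {k C}

/-- Pairs are identified when their module categories are equivalent. -/
def ProjectivePair.Equivalent (p q : ProjectivePair.{v', u'} k C) : Prop := p.M.Equivalent q.M

/-- Pairs are identified when their module categories are equivalent. -/
def InjectivePair.Equivalent (p q : InjectivePair.{v', u'} k C) : Prop := p.M.Equivalent q.M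

end Categories

section Extensions

variable {C : Type u} [Category.{v} C]

theorem freeExtension_h (T : Monad C) {Y Z : C} (f : Y ⟶ T.obj Z) :
    T.map (T.map f ≫ T.μ.app Z) ≫ T.μ.app Z = T.μ.app Y ≫ T.map f ≫ T.μ.app Z := by
  have h := T.μ.naturality f
  simp only [Functor.comp_map] at h
  rw [Functor.map_comp, assoc, T.assoc, ← assoc, h, assoc]

theorem cofreeExtension_h (G : Comonad C) {Y Z : C} (f : G.obj Y ⟶ Z) :
    G.δ.app Y ≫ G.map (G.δ.app Y ≫ G.map f) = (G.δ.app Y ≫ G.map f) ≫ G.δ.app Z := by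
  have h := G.δ.naturality f
  simp only [Functor.comp_map] at h
  rw [Functor.map_comp, assoc, h, ← assoc, ← assoc, G.coassoc]

end Extensions

section Monads

variable (k : Type w) [Field k] (C : Type u) [Category.{v} C] [Abelian C] [Linear k C]
  [MonoidalCategory C]

/-- A right exact lax `C`-module monad on `C`: a `k`-linear right exact monad `T` with a lax
`C`-module structure `V ⊗ T X ⟶ T (V ⊗ X)` for which the unit and the multiplication are
`C`-module transformations. -/
structure RightExactLaxModuleMonad extends Monad C where
  lax : toFunctor.LaxLeftLinear C
  lax_η (V X : C) : V ◁ η.app X ≫ lax.μₗ V X = η.app (V ⊗ X)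
  lax_μ (V X : C) : V ◁ μ.app X ≫ lax.μₗ V X =
    lax.μₗ V (toFunctor.obj X) ≫ toFunctor.map (lax.μₗ V X) ≫ μ.app (V ⊗ X)
  additive : toFunctor.Additive
  linear : toFunctor.Linear k
  rightExact : PreservesFiniteColimits toFunctor

/-- A left exact oplax `C`-module comonad on `C`: a `k`-linear left exact comonad `G` with an oplax
`C`-module structure `G (V ⊗ X) ⟶ V ⊗ G X` for which the counit and the comultiplication are
`C`-module transformations. -/
structure LeftExactOplaxModuleComonad extends Comonad C where
  oplax : toFunctor.OplaxLeftLinear C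
  oplax_ε (V X : C) : oplax.δₗ V X ≫ V ◁ ε.app X = ε.app (V ⊗ X)
  oplax_δ (V X : C) : oplax.δₗ V X ≫ V ◁ δ.app X =
    δ.app (V ⊗ X) ≫ toFunctor.map (oplax.δₗ V X) ≫ oplax.δₗ V (toFunctor.obj X)
  additive : toFunctor.Additive
  linear : toFunctor.Linear k
  leftExact : PreservesFiniteLimits toFunctor

attribute [instance] RightExactLaxModuleMonad.additive RightExactLaxModuleMonad.linear
  RightExactLaxModuleMonad.rightExact LeftExactOplaxModuleComonad.additive
  LeftExactOplaxModuleComonad.linear LeftExactOplaxModuleComonad.leftExact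

variable {k C}

namespace RightExactLaxModuleMonad

variable (T : RightExactLaxModuleMonad k C)

/-- The Eilenberg-Moore category of `T`. -/
abbrev EM : Type (max u v) := T.toMonad.Algebra

/-- The morphism `T (V ⊗ T A) ⟶ T (V ⊗ A)` of free modules given by `T (T_a) ≫ μ`. -/
def lintonMap (V : C) (A : T.EM) :
    T.toMonad.free.obj (V ⊗ T.toMonad.obj A.A) ⟶ T.toMonad.free.obj (V ⊗ A.A) where
  f := T.toMonad.map (T.lax.μₗ V A.A) ≫ T.toMonad.μ.app (V ⊗ A.A)
  h := freeExtension_h T.toMonad (T.lax.μₗ V A.A)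

/-- A left `C`-module category structure `▶` on `EM(T)` given by Linton coequalizers: `V ▶ A` is the
coequalizer in `EM(T)` of `T (V ⊗ ∇_A)` and `T (T_a) ≫ μ : T (V ⊗ T A) ⟶ T (V ⊗ A)`, as a functor of
`V` and `A`, and the unit and associativity isomorphisms are those induced on coequalizers by the
unitor and the associator of `C`. -/
structure LintonAction where
  action : MonoidalLeftAction C T.EM
  /-- The coequalizer projection. -/
  proj (V : C) (A : T.EM) : T.toMonad.free.obj (V ⊗ A.A) ⟶ V ⊙ₗ A
  condition (V : C) (A : T.EM) :
    T.toMonad.free.map (V ◁ A.a) ≫ proj V A = T.lintonMap V A ≫ proj V A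
  isColimit (V : C) (A : T.EM) : Nonempty (IsColimit (Cofork.ofπ (proj V A) (condition V A)))
  naturality_left {V W : C} (f : V ⟶ W) (A : T.EM) :
    T.toMonad.free.map (f ▷ A.A) ≫ proj W A = proj V A ≫ f ⊵ₗ A
  naturality_right (V : C) {A B : T.EM} (g : A ⟶ B) :
    T.toMonad.free.map (V ◁ g.f) ≫ proj V B = proj V A ≫ V ⊴ₗ g
  unitality (A : T.EM) :
    proj (𝟙_ C) A ≫ (λₗ A).hom =
      T.toMonad.free.map (λ_ A.A).hom ≫ T.toMonad.adj.counit.app A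
  associativity (V W : C) (A : T.EM) :
    proj (V ⊗ W) A ≫ (αₗ V W A).hom =
      T.toMonad.free.map ((α_ V W A.A).hom ≫ V ◁ (T.toMonad.η.app (W ⊗ A.A) ≫ (proj W A).f)) ≫
        proj V (W ⊙ₗ A)

theorem free_map_add {Y Z : C} (f g : Y ⟶ Z) :
    T.toMonad.free.map (f + g) = T.toMonad.free.map f + T.toMonad.free.map g :=
  Monad.Algebra.Hom.ext T.toFunctor.map_add

theorem free_map_smul {Y Z : C} (r : k) (f : Y ⟶ Z) :
    T.toMonad.free.map (r • f) = r • T.toMonad.free.map f :=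
  Monad.Algebra.Hom.ext (T.toFunctor.map_smul r f)

variable [MonoidalPreadditive C] [MonoidalLinear k C]

/-- The Eilenberg-Moore category with a Linton module structure. -/
def LintonAction.toModuleCategory {T : RightExactLaxModuleMonad k C} (L : T.LintonAction) :
    AbelianModuleCategory.{v, max u v} k C :=
  letI := L.action
  have (V : C) (A : T.EM) : Epi (L.proj V A) := Cofork.IsColimit.epi (L.isColimit V A).some
  { carrier := T.EM
    linearAction :=
      { actionHomRight_add V X Y f g := by
          rw [← cancel_epi (L.proj V X), Preadditive.comp_add, ← L.naturality_right,
            ← L.naturality_right, ← L.naturality_right, ← Preadditive.add_comp,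
            ← free_map_add, ← MonoidalPreadditive.whiskerLeft_add]
          rfl
        actionHomRight_smul V X Y r f := by
          rw [← cancel_epi (L.proj V X), Linear.comp_smul, ← L.naturality_right,
            ← L.naturality_right, ← Linear.smul_comp, ← free_map_smul,
            ← MonoidalLinear.whiskerLeft_smul]
          rfl
        add_actionHomLeft {V W} f g X := by
          rw [← cancel_epi (L.proj V X), Preadditive.comp_add, ← L.naturality_left,
            ← L.naturality_left, ← L.naturality_left, ← Preadditive.add_comp,
            ← free_map_add, ← MonoidalPreadditive.add_whiskerRight]
        smul_actionHomLeft {V W} r f X := by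
          rw [← cancel_epi (L.proj V X), Linear.comp_smul, ← L.naturality_left,
            ← L.naturality_left, ← Linear.smul_comp, ← free_map_smul,
            ← MonoidalLinear.smul_whiskerRight] } }

/-- Monads are identified when their Eilenberg-Moore categories, with the Linton module structures,
are equivalent as module categories. -/
def Equivalent (T S : RightExactLaxModuleMonad k C) : Prop :=
  ∃ (L : T.LintonAction) (L' : S.LintonAction),
    L.toModuleCategory.Equivalent L'.toModuleCategory

/-- The object `T(𝟙)` of `EM(T)`. -/
def LintonAction.freeUnit {T : RightExactLaxModuleMonad k C} (L : T.LintonAction) :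
    L.toModuleCategory :=
  T.toMonad.free.obj (𝟙_ C)

end RightExactLaxModuleMonad

namespace LeftExactOplaxModuleComonad

variable (G : LeftExactOplaxModuleComonad k C)

/-- The Eilenberg-Moore category of `G`. -/
abbrev EM : Type (max u v) := G.toComonad.Coalgebra

/-- The morphism `G (V ⊗ A) ⟶ G (V ⊗ G A)` of cofree comodules given by `δ ≫ G (G_a)`. -/
def lintonMap (V : C) (A : G.EM) :
    G.toComonad.cofree.obj (V ⊗ A.A) ⟶ G.toComonad.cofree.obj (V ⊗ G.toComonad.obj A.A) where
  f := G.toComonad.δ.app (V ⊗ A.A) ≫ G.toComonad.map (G.oplax.δₗ V A.A)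
  h := cofreeExtension_h G.toComonad (G.oplax.δₗ V A.A)

/-- A left `C`-module category structure `▶` on `EM(G)` given by Linton equalizers: `V ▶ A` is the
equalizer in `EM(G)` of `G (V ⊗ Δ_A)` and `δ ≫ G (G_a) : G (V ⊗ A) ⟶ G (V ⊗ G A)`, as a functor of
`V` and `A`, and the unit and associativity isomorphisms are those induced on equalizers by the
unitor and the associator of `C`. -/
structure LintonAction where
  action : MonoidalLeftAction C G.EM
  /-- The equalizer inclusion. -/
  incl (V : C) (A : G.EM) : V ⊙ₗ A ⟶ G.toComonad.cofree.obj (V ⊗ A.A)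
  condition (V : C) (A : G.EM) :
    incl V A ≫ G.toComonad.cofree.map (V ◁ A.a) = incl V A ≫ G.lintonMap V A
  isLimit (V : C) (A : G.EM) : Nonempty (IsLimit (Fork.ofι (incl V A) (condition V A)))
  naturality_left {V W : C} (f : V ⟶ W) (A : G.EM) :
    f ⊵ₗ A ≫ incl W A = incl V A ≫ G.toComonad.cofree.map (f ▷ A.A)
  naturality_right (V : C) {A B : G.EM} (g : A ⟶ B) :
    V ⊴ₗ g ≫ incl V B = incl V A ≫ G.toComonad.cofree.map (V ◁ g.f)
  unitality (A : G.EM) :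
    (λₗ A).inv ≫ incl (𝟙_ C) A =
      G.toComonad.adj.unit.app A ≫ G.toComonad.cofree.map (λ_ A.A).inv
  associativity (V W : C) (A : G.EM) :
    (αₗ V W A).inv ≫ incl (V ⊗ W) A =
      incl V (W ⊙ₗ A) ≫
        G.toComonad.cofree.map
          (V ◁ ((incl W A).f ≫ G.toComonad.ε.app (W ⊗ A.A)) ≫ (α_ V W A.A).inv)

theorem cofree_map_add {Y Z : C} (f g : Y ⟶ Z) :
    G.toComonad.cofree.map (f + g) = G.toComonad.cofree.map f + G.toComonad.cofree.map g :=
  Comonad.Coalgebra.Hom.ext G.toFunctor.map_add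

theorem cofree_map_smul {Y Z : C} (r : k) (f : Y ⟶ Z) :
    G.toComonad.cofree.map (r • f) = r • G.toComonad.cofree.map f :=
  Comonad.Coalgebra.Hom.ext (G.toFunctor.map_smul r f)

variable [MonoidalPreadditive C] [MonoidalLinear k C]

/-- The Eilenberg-Moore category with a Linton module structure. -/
def LintonAction.toModuleCategory {G : LeftExactOplaxModuleComonad k C} (L : G.LintonAction) :
    AbelianModuleCategory.{v, max u v} k C :=
  letI := L.action
  have (V : C) (A : G.EM) : Mono (L.incl V A) := Fork.IsLimit.mono (L.isLimit V A).some
  { carrier := G.EM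
    linearAction :=
      { actionHomRight_add V X Y f g := by
          rw [← cancel_mono (L.incl V Y), Preadditive.add_comp, L.naturality_right,
            L.naturality_right, L.naturality_right, ← Preadditive.comp_add,
            ← cofree_map_add, ← MonoidalPreadditive.whiskerLeft_add]
          rfl
        actionHomRight_smul V X Y r f := by
          rw [← cancel_mono (L.incl V Y), Linear.smul_comp, L.naturality_right,
            L.naturality_right, ← Linear.comp_smul, ← cofree_map_smul,
            ← MonoidalLinear.whiskerLeft_smul]
          rfl
        add_actionHomLeft {V W} f g X := by
          rw [← cancel_mono (L.incl W X), Preadditive.add_comp, L.naturality_left,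
            L.naturality_left, L.naturality_left, ← Preadditive.comp_add,
            ← cofree_map_add, ← MonoidalPreadditive.add_whiskerRight]
        smul_actionHomLeft {V W} r f X := by
          rw [← cancel_mono (L.incl W X), Linear.smul_comp, L.naturality_left,
            L.naturality_left, ← Linear.comp_smul, ← cofree_map_smul,
            ← MonoidalLinear.smul_whiskerRight] } }

/-- Comonads are identified when their Eilenberg-Moore categories, with the Linton module
structures, are equivalent as module categories. -/
def Equivalent (G H : LeftExactOplaxModuleComonad k C) : Prop :=
  ∃ (L : G.LintonAction) (L' : H.LintonAction),
    L.toModuleCategory.Equivalent L'.toModuleCategory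

/-- The object `G(𝟙)` of `EM(G)`. -/
def LintonAction.cofreeUnit {G : LeftExactOplaxModuleComonad k C} (L : G.LintonAction) :
    L.toModuleCategory :=
  G.toComonad.cofree.obj (𝟙_ C)

end LeftExactOplaxModuleComonad

section Adjunctions

variable {M : AbelianModuleCategory.{v', u'} k C} {X : M} {H : M ⥤ C}

instance (X : M) : (actionRight C X).Additive where
  map_add := LinearAction.add_actionHomLeft k _ _ X

instance (X : M) : (actionRight C X).Linear k where
  map_smul f r := LinearAction.smul_actionHomLeft r f X

theorem linear_rightAdjoint (adj : actionRight C X ⊣ H) : H.Linear k where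
  map_smul f r := (adj.homEquiv _ _).symm.injective (by
    have e := adj.homEquiv_naturality_right_symm (𝟙 (H.obj _)) f
    have e' := adj.homEquiv_naturality_right_symm (𝟙 (H.obj _)) (r • f)
    rw [id_comp] at e e'
    rw [e', Linear.comp_smul, ← e, ← map_comp_counit, ← map_comp_counit, Functor.map_smul,
      Linear.smul_comp])

theorem linear_leftAdjoint (adj : H ⊣ actionRight C X) : H.Linear k where
  map_smul f r := (adj.homEquiv _ _).injective (by
    have e := adj.homEquiv_naturality_left f (𝟙 (H.obj _))
    have e' := adj.homEquiv_naturality_left (r • f) (𝟙 (H.obj _))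
    rw [comp_id] at e e'
    rw [e', Linear.smul_comp, ← e, ← unit_comp_map, ← unit_comp_map, Functor.map_smul,
      Linear.comp_smul])

theorem rightExact_rightAdjoint [EnoughProjectives C] (adj : actionRight C X ⊣ H)
    (hX : M.IsCProjective X) : PreservesFiniteColimits H := by
  have := adj.isRightAdjoint
  have := adj.rightAdjoint_preservesLimits
  have : PreservesFiniteLimits H := inferInstance
  have : H.Additive := adj.right_adjoint_additive
  have : H.PreservesEpimorphisms := ⟨fun {A B} f _ => by
    have : Projective ((actionRight C X).obj (Projective.over (H.obj B))) :=
      hX _ (Projective.projective_over (H.obj B))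
    have h : adj.homEquiv _ _ (Projective.factorThru
        ((adj.homEquiv _ _).symm (Projective.π (H.obj B))) f) ≫ H.map f =
        Projective.π (H.obj B) := by
      rw [← adj.homEquiv_naturality_right, Projective.factorThru_comp, Equiv.apply_symm_apply]
    exact epi_of_epi_fac h⟩
  have hex := ((H.preservesFiniteLimits_tfae).out 3 0).mp ‹_›
  refine ((H.preservesFiniteColimits_tfae).out 0 3).mp fun S hS => ?_
  have := hS.epi_g
  exact ⟨(hex S hS).1,
    (inferInstance : Epi (H.map S.g))⟩

theorem leftExact_leftAdjoint [EnoughInjectives C] (adj : H ⊣ actionRight C X)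
    (hX : M.IsCInjective X) : PreservesFiniteLimits H := by
  have := adj.isLeftAdjoint
  have := adj.leftAdjoint_preservesColimits
  have : PreservesFiniteColimits H := inferInstance
  have : H.Additive := adj.left_adjoint_additive
  have : H.PreservesMonomorphisms := ⟨fun {A B} f _ => by
    have : Injective ((actionRight C X).obj (Injective.under (H.obj A))) :=
      hX _ (Injective.injective_under (H.obj A))
    have h : H.map f ≫ (adj.homEquiv _ _).symm (Injective.factorThru
        (adj.homEquiv _ _ (Injective.ι (H.obj A))) f) =
        Injective.ι (H.obj A) := by
      rw [← adj.homEquiv_naturality_left_symm, Injective.comp_factorThru,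
        Equiv.symm_apply_apply]
    exact mono_of_mono_fac h⟩
  have hex := ((H.preservesFiniteColimits_tfae).out 3 0).mp ‹_›
  refine ((H.preservesFiniteLimits_tfae).out 0 3).mp fun S hS => ?_
  have := hS.mono_f
  exact ⟨(hex S hS).1,
    (inferInstance : Mono (H.map S.f))⟩

end Adjunctions

/-- The right exact lax `C`-module monad `[X, - ▷ X]` of a pair `(M, X)`, where `[X, -] = H` is right
adjoint to `- ▷ X`; the lax structure of `H` is the mate of the strong structure of `- ▷ X`. -/
def ProjectivePair.internalHomMonad [EnoughProjectives C] (p : ProjectivePair.{v', u'} k C)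
    (H : p.M ⥤ C) (adj : actionRight C p.X ⊣ H) : RightExactLaxModuleMonad k C where
  toMonad := adj.toMonad
  lax := letI := rightAdjointLax (C := C) adj; compLax (actionRight C p.X) H
  lax_η V X := unit_laxMate adj V X
  lax_μ V X := counit_laxMate adj V X
  additive :=
    have := adj.right_adjoint_additive
    inferInstanceAs (actionRight C p.X ⋙ H).Additive
  linear :=
    have := adj.right_adjoint_additive
    have := linear_rightAdjoint adj
    inferInstanceAs ((actionRight C p.X ⋙ H).Linear k)
  rightExact :=
    have := rightExact_rightAdjoint adj p.prop.projective
    have := p.prop.rightExact.actionRight p.X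
    inferInstanceAs (PreservesFiniteColimits (actionRight C p.X ⋙ H))

/-- The left exact oplax `C`-module comonad `[X, - ▷ X]` of a pair `(M, X)`, where `[X, -] = H` is
left adjoint to `- ▷ X`; the oplax structure of `H` is the mate of the strong structure of
`- ▷ X`. -/
def InjectivePair.internalCohomComonad [EnoughInjectives C] (p : InjectivePair.{v', u'} k C)
    (H : p.M ⥤ C) (adj : H ⊣ actionRight C p.X) : LeftExactOplaxModuleComonad k C where
  toComonad := adj.toComonad
  oplax := letI := leftAdjointOplax (C := C) adj; compOplax (actionRight C p.X) H
  oplax_ε V X := oplaxMate_counit adj V X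
  oplax_δ V X := oplaxMate_unit adj V X
  additive :=
    have := adj.left_adjoint_additive
    inferInstanceAs (actionRight C p.X ⋙ H).Additive
  linear :=
    have := adj.left_adjoint_additive
    have := linear_leftAdjoint adj
    inferInstanceAs ((actionRight C p.X ⋙ H).Linear k)
  leftExact :=
    have := leftExact_leftAdjoint adj p.prop.injective
    have := p.prop.leftExact.actionRight p.X
    inferInstanceAs (PreservesFiniteLimits (actionRight C p.X ⋙ H))

end Monads

end ModuleReconstruction
end

open ModuleReconstruction

/-! The coequalizer defining `V ▶ A` corepresents a functor. By the free-forgetful adjunction,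
module morphisms `V ▶ A ⟶ B` are the morphisms `V ⊗ A ⟶ B` of `C` that are linear in `A`
(`IsLinear`, `isLinear_iff`). A Linton structure therefore supplies universal linear morphisms `V ⊗
A ⟶ V ▶ A` (`IsUniversal`), and questions about `▶` become questions about linear morphisms in `C`.

Existence: the coherence of `C` passes to `▶` once composites of universal morphisms are known to be
universal (`IsUniversal.comp`); this is where `V ⊗ -` has to be right exact. Uniqueness: the
comparison of two universal morphisms makes the identity functor strong. Right exactness: a
compatible family of linear morphisms glues along a colimit, because `T` and `⊗` preserve that
colimit. Finally, the strength `V ⊗ T W ⟶ T (V ⊗ W)` is itself universal (`isUniversal_str`), so `-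
▶ T(𝟙)` is the free functor. This makes `T(𝟙)` closed, `C`-projective and a `C`-generator.

Conversely let `H = [X, -]` for a pair `(M, X)`. `C`-projectivity makes `H` right exact, the
generator property makes it faithful, and the crude monadicity theorem gives `M ≃ EM([X, - ▷ X])`.
This comparison functor is strong because the mate `V ⊗ H Y ⟶ H (V ▷ Y)` is universal
(`isUniversal_laxMate`): a linear morphism `V ⊗ H Y ⟶ H Z` transposes to one that coequalizes `V ▷
-` of the canonical presentation of `Y`, and hence descends to `V ▷ Y ⟶ Z`.

Pairs are compared only through their module categories and monads only through their
Eilenberg-Moore categories. So this one equivalence shows that both composites are the identity on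
classes, and `T` never has to be compared with `[T(𝟙), - ▶ T(𝟙)]` as a monad. The comonad half is
the same argument with all arrows reversed, written out directly. -/

noncomputable section
namespace ModuleReconstruction

variable {k : Type w} [Field k] {C : Type u} [Category.{v} C] [Abelian C] [Linear k C]
  [MonoidalCategory C]

/-! ### Linear morphisms over a lax module monad and their universal property. -/

namespace RightExactLaxModuleMonad

variable (T : RightExactLaxModuleMonad k C)

/-- The strength `V ⊗ T X ⟶ T (V ⊗ X)` of a lax module monad. -/
def str (V X : C) : V ⊗ T.obj X ⟶ T.obj (V ⊗ X) := T.lax.μₗ V X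

theorem str_naturality_left {V W : C} (f : V ⟶ W) (X : C) :
    f ▷ T.obj X ≫ T.str W X = T.str V X ≫ T.map (f ▷ X) :=
  T.lax.μₗ_naturality_left f X

theorem str_naturality_right (V : C) {X Y : C} (f : X ⟶ Y) :
    V ◁ T.map f ≫ T.str V Y = T.str V X ≫ T.map (V ◁ f) :=
  T.lax.μₗ_naturality_right V f

theorem str_associativity (V W X : C) :
    T.str (V ⊗ W) X ≫ T.map (α_ V W X).hom =
      (α_ V W (T.obj X)).hom ≫ V ◁ T.str W X ≫ T.str V (W ⊗ X) :=
  T.lax.μₗ_associativity V W X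

theorem str_unitality (X : C) :
    T.str (𝟙_ C) X ≫ T.map (λ_ X).hom = (λ_ (T.obj X)).hom :=
  (T.lax.μₗ_unitality X).symm

theorem str_η (V X : C) : V ◁ T.η.app X ≫ T.str V X = T.η.app (V ⊗ X) :=
  T.lax_η V X

theorem str_μ (V X : C) : V ◁ T.μ.app X ≫ T.str V X =
    T.str V (T.obj X) ≫ T.map (T.str V X) ≫ T.μ.app (V ⊗ X) :=
  T.lax_μ V X

theorem η_naturality {X Y : C} (f : X ⟶ Y) :
    T.η.app X ≫ T.map f = f ≫ T.η.app Y :=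
  (T.η.naturality f).symm

theorem η_naturality_assoc {X Y Z : C} (f : X ⟶ Y) (g : T.obj Y ⟶ Z) :
    T.η.app X ≫ T.map f ≫ g = f ≫ T.η.app Y ≫ g := by
  rw [← assoc, T.η_naturality, assoc]

theorem μ_naturality {X Y : C} (f : X ⟶ Y) :
    T.μ.app X ≫ T.map f = T.map (T.map f) ≫ T.μ.app Y :=
  (T.μ.naturality f).symm

theorem μ_naturality_assoc {X Y Z : C} (f : X ⟶ Y) (g : T.obj Y ⟶ Z) :
    T.μ.app X ≫ T.map f ≫ g = T.map (T.map f) ≫ T.μ.app Y ≫ g := by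
  rw [← assoc, T.μ_naturality, assoc]

variable {T}

/-- The underlying morphism of a morphism out of a free module. -/
def under {X : C} {B : T.EM} (f : T.toMonad.free.obj X ⟶ B) : T.obj X ⟶ B.A := f.f

/-- The restriction of a morphism out of a free module along the unit. -/
def res {X : C} {B : T.EM} (f : T.toMonad.free.obj X ⟶ B) : X ⟶ B.A := T.η.app X ≫ under f

/-- The morphism of `T`-modules `T X ⟶ B` extending `f : X ⟶ B`. -/
def ext {X : C} {B : T.EM} (f : X ⟶ B.A) : T.toMonad.free.obj X ⟶ B where
  f := T.map f ≫ B.a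
  h := by
    change T.map (T.map f ≫ B.a) ≫ B.a = T.μ.app X ≫ T.map f ≫ B.a
    rw [Functor.map_comp, assoc, ← B.assoc, T.μ_naturality_assoc]

theorem map_under {X : C} {B : T.EM} (f : T.toMonad.free.obj X ⟶ B) :
    T.map (under f) ≫ B.a = T.μ.app X ≫ under f := f.h

theorem under_ext {X : C} {B : T.EM} (f : X ⟶ B.A) : under (ext f) = T.map f ≫ B.a := rfl

@[simp]
theorem res_comp {X : C} {B B' : T.EM} (f : T.toMonad.free.obj X ⟶ B) (g : B ⟶ B') :
    res (f ≫ g) = res f ≫ g.f :=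
  (assoc _ _ _).symm

@[simp]
theorem res_ext {X : C} {B : T.EM} (f : X ⟶ B.A) : res (ext f) = f := by
  rw [res, under_ext, T.η_naturality_assoc, B.unit, comp_id]

/-- The morphism axiom trades `∇_B` for `μ`, and `T η ≫ μ = 𝟙` finishes. Hence a morphism out of a
free module is determined by its restriction to generators. -/
theorem under_eq {X : C} {B : T.EM} (f : T.toMonad.free.obj X ⟶ B) :
    under f = T.map (res f) ≫ B.a := by
  rw [res, Functor.map_comp, assoc, map_under]
  exact (T.toMonad.right_unit_assoc X _).symm

theorem ext_res {X : C} {B : T.EM} (f : T.toMonad.free.obj X ⟶ B) : ext (res f) = f :=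
  Monad.Algebra.Hom.ext (under_eq f).symm

theorem free_hom_ext {X : C} {B : T.EM} {f g : T.toMonad.free.obj X ⟶ B}
    (h : res f = res g) : f = g := by
  rw [← ext_res f, ← ext_res g, h]

theorem under_map_comp {X Y : C} {B : T.EM} (g : X ⟶ Y) (f : T.toMonad.free.obj Y ⟶ B) :
    under (T.toMonad.free.map g ≫ f) = T.map g ≫ under f := rfl

@[simp]
theorem res_map_comp {X Y : C} {B : T.EM} (g : X ⟶ Y) (f : T.toMonad.free.obj Y ⟶ B) :
    res (T.toMonad.free.map g ≫ f) = g ≫ res f := by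
  rw [res, under_map_comp, T.η_naturality_assoc, res]

/-- Naturality brings `η` next to `μ`, where they cancel. On generators the second Linton arrow is
thus the bare strength. -/
theorem res_lintonMap_comp {V : C} {A B : T.EM} (f : T.toMonad.free.obj (V ⊗ A.A) ⟶ B) :
    res (T.lintonMap V A ≫ f) = T.str V A.A ≫ under f := by
  change T.η.app _ ≫ (T.map (T.str V A.A) ≫ T.μ.app (V ⊗ A.A)) ≫ under f = _
  rw [assoc]
  exact (T.η_naturality_assoc _ _).trans (congrArg _ (T.toMonad.left_unit_assoc _ _))

/-- A morphism `V ⊗ A ⟶ B` between `T`-modules `A` and `B` which is `T`-linear in `A`. -/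
def IsLinear (V : C) (A B : T.EM) (f : V ⊗ A.A ⟶ B.A) : Prop :=
  V ◁ A.a ≫ f = T.str V A.A ≫ T.map f ≫ B.a

namespace IsLinear

variable {V W : C} {A A' B B' : T.EM}

theorem comp_hom {f : V ⊗ A.A ⟶ B.A} (hf : IsLinear V A B f) (h : B ⟶ B') :
    IsLinear V A B' (f ≫ h.f) := by
  unfold IsLinear at hf ⊢
  rw [reassoc_of% hf, Functor.map_comp, assoc, h.h]

theorem whiskerLeft_comp {f : V ⊗ A.A ⟶ B.A} (hf : IsLinear V A B f) (g : A' ⟶ A) :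
    IsLinear V A' B (V ◁ g.f ≫ f) := by
  unfold IsLinear at hf ⊢
  rw [← MonoidalCategory.whiskerLeft_comp_assoc, ← g.h, MonoidalCategory.whiskerLeft_comp_assoc,
    hf, Functor.map_comp, assoc, reassoc_of% T.str_naturality_right]

theorem whiskerRight_comp {f : V ⊗ A.A ⟶ B.A} (hf : IsLinear V A B f) (g : W ⟶ V) :
    IsLinear W A B (g ▷ A.A ≫ f) := by
  unfold IsLinear at hf ⊢
  rw [whisker_exchange_assoc, hf, Functor.map_comp, assoc, reassoc_of% T.str_naturality_left]

theorem leftUnitor (A : T.EM) : IsLinear (𝟙_ C) A A (λ_ A.A).hom := by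
  unfold IsLinear
  rw [reassoc_of% T.str_unitality]
  exact leftUnitor_naturality A.a

/-- The associativity axiom of the lax structure enters here: the strengths of `W` and then `V`
combine to that of `V ⊗ W`. -/
theorem comp {f : V ⊗ B.A ⟶ B'.A} (hf : IsLinear V B B' f) {g : W ⊗ A.A ⟶ B.A}
    (hg : IsLinear W A B g) :
    IsLinear (V ⊗ W) A B' ((α_ V W A.A).hom ≫ V ◁ g ≫ f) := by
  unfold IsLinear at hf hg ⊢
  rw [Functor.map_comp, Functor.map_comp, assoc, assoc, reassoc_of% T.str_associativity,
    ← reassoc_of% T.str_naturality_right, ← hf, associator_naturality_right_assoc,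
    ← MonoidalCategory.whiskerLeft_comp_assoc, hg]
  simp only [MonoidalCategory.whiskerLeft_comp, assoc]

/-- For free modules linearity unfolds to the axiom that `μ` is a module transformation. -/
theorem str (V W : C) :
    IsLinear V (T.toMonad.free.obj W) (T.toMonad.free.obj (V ⊗ W)) (T.str V W) :=
  T.str_μ V W

end IsLinear

/-- Morphisms out of a free module may be compared on generators, where the two Linton composites
become the two sides of linearity. -/
theorem isLinear_iff {V : C} {A B : T.EM} (g : T.toMonad.free.obj (V ⊗ A.A) ⟶ B) :
    IsLinear V A B (res g) ↔
      T.toMonad.free.map (V ◁ A.a) ≫ g = T.lintonMap V A ≫ g := by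
  unfold IsLinear
  rw [← under_eq, ← res_lintonMap_comp, ← res_map_comp]
  exact ⟨free_hom_ext, congrArg res⟩

theorem IsLinear.map_comp_ext {V : C} {A B : T.EM} {f : V ⊗ A.A ⟶ B.A} (hf : IsLinear V A B f) :
    T.toMonad.free.map (V ◁ A.a) ≫ ext f = T.lintonMap V A ≫ ext f :=
  (isLinear_iff _).1 (by rwa [res_ext])

/-- A `T`-linear morphism `V ⊗ A ⟶ E` through which every `T`-linear morphism factors uniquely. -/
structure IsUniversal (V : C) (A E : T.EM) (u : V ⊗ A.A ⟶ E.A) : Prop where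
  isLinear : IsLinear V A E u
  exists_fac {B : T.EM} (f : V ⊗ A.A ⟶ B.A) (hf : IsLinear V A B f) :
    ∃ h : E ⟶ B, u ≫ h.f = f
  hom_ext {B : T.EM} {g h : E ⟶ B} (e : u ≫ g.f = u ≫ h.f) : g = h

namespace IsUniversal

variable {V : C} {A E : T.EM} {u : V ⊗ A.A ⟶ E.A} (hu : IsUniversal V A E u)

/-- The morphism of `T`-modules induced by a `T`-linear morphism. -/
def desc {B : T.EM} (f : V ⊗ A.A ⟶ B.A) (hf : IsLinear V A B f) : E ⟶ B :=
  (hu.exists_fac f hf).choose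

theorem fac {B : T.EM} (f : V ⊗ A.A ⟶ B.A) (hf : IsLinear V A B f) :
    u ≫ (hu.desc f hf).f = f :=
  (hu.exists_fac f hf).choose_spec

theorem fac_assoc {B : T.EM} (f : V ⊗ A.A ⟶ B.A) (hf : IsLinear V A B f) {Z : C} (g : B.A ⟶ Z) :
    u ≫ (hu.desc f hf).f ≫ g = f ≫ g := by
  rw [← assoc, hu.fac]

include hu in
theorem condition : T.toMonad.free.map (V ◁ A.a) ≫ ext u = T.lintonMap V A ≫ ext u :=
  hu.isLinear.map_comp_ext

/-- The coequalizer cofork of a universal linear morphism. -/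
def isColimit : IsColimit (Cofork.ofπ (ext u) hu.condition) :=
  Cofork.IsColimit.mk' _ fun s => by
    refine ⟨hu.desc _ ((isLinear_iff s.π).2 s.condition), free_hom_ext ?_,
      fun {m} hm => hu.hom_ext ?_⟩
    · rw [Cofork.π_ofπ, res_comp, res_ext, hu.fac]
    · rw [hu.fac, ← hm, Cofork.π_ofπ, res_comp, res_ext]

include hu in
theorem map_epi : Epi (ext u) := Cofork.IsColimit.epi hu.isColimit

variable {E' : T.EM} {u' : V ⊗ A.A ⟶ E'.A} (hu' : IsUniversal V A E' u')

/-- Two universal linear morphisms have isomorphic targets. -/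
def iso : E ≅ E' where
  hom := hu.desc u' hu'.isLinear
  inv := hu'.desc u hu.isLinear
  hom_inv_id := hu.hom_ext (by
    refine (hu.fac_assoc u' hu'.isLinear _).trans ((hu'.fac u hu.isLinear).trans ?_)
    exact (comp_id u).symm)
  inv_hom_id := hu'.hom_ext (by
    refine (hu'.fac_assoc u hu.isLinear _).trans ((hu.fac u' hu'.isLinear).trans ?_)
    exact (comp_id u').symm)

include hu hu' in
theorem isIso_of_comp_eq {h : E ⟶ E'} (e : u ≫ h.f = u') : IsIso h := by
  have : h = (hu.iso hu').hom := hu.hom_ext (e.trans (hu.fac u' hu'.isLinear).symm)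
  rw [this]
  infer_instance

end IsUniversal

/-- A linear `f` out of `V ⊗ T W` is recovered from its restriction along `V ◁ η`: linearity
converts the strength followed by the extension into `V ◁ (T η ≫ μ) ≫ f = f`. -/
theorem isUniversal_str (V W : C) :
    IsUniversal V (T.toMonad.free.obj W) (T.toMonad.free.obj (V ⊗ W)) (T.str V W) where
  isLinear := IsLinear.str V W
  exists_fac {B} (f : V ⊗ T.obj W ⟶ B.A) (hf : V ◁ T.μ.app W ≫ f = _) :=
    ⟨ext (V ◁ T.η.app W ≫ f), by
      change T.str V W ≫ T.map (V ◁ T.η.app W ≫ f) ≫ B.a = f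
      rw [Functor.map_comp, assoc, ← reassoc_of% T.str_naturality_right]
      refine (congrArg _ (Eq.symm hf)).trans ?_
      rw [← MonoidalCategory.whiskerLeft_comp_assoc]
      refine (congrArg (fun t => V ◁ t ≫ f) (T.toMonad.right_unit W)).trans ?_
      rw [MonoidalCategory.whiskerLeft_id, id_comp]⟩
  -- The strength carries `V ◁ η` to `η`, so agreement after the strength implies agreement on
  -- generators.
  hom_ext {B g h} (e : T.str V W ≫ under g = T.str V W ≫ under h) := free_hom_ext (by
    rw [res, res, ← T.str_η, assoc, assoc, e])

theorem isUniversal_res {V : C} {A E : T.EM} (π : T.toMonad.free.obj (V ⊗ A.A) ⟶ E)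
    (condition : T.toMonad.free.map (V ◁ A.a) ≫ π = T.lintonMap V A ≫ π)
    (h : IsColimit (Cofork.ofπ π condition)) : IsUniversal V A E (res π) where
  isLinear := (isLinear_iff π).2 condition
  exists_fac f hf := ⟨Cofork.IsColimit.desc h (ext f) hf.map_comp_ext, by
    rw [← res_comp]
    exact (congrArg res (Cofork.IsColimit.π_desc' h (ext f) hf.map_comp_ext)).trans (res_ext f)⟩
  hom_ext e := Cofork.IsColimit.hom_ext h (free_hom_ext (by
    rwa [Cofork.π_ofπ, res_comp, res_comp]))

theorem exists_isUniversal (V : C) (A : T.EM) :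
    ∃ (E : T.EM) (u : V ⊗ A.A ⟶ E.A), IsUniversal V A E u :=
  ⟨_, _, isUniversal_res _ _
    (coequalizerIsCoequalizer (T.toMonad.free.map (V ◁ A.a)) (T.lintonMap V A))⟩

end RightExactLaxModuleMonad

end ModuleReconstruction
end
-- Composition of universal morphisms and construction of the Linton action.
noncomputable section
namespace ModuleReconstruction

variable {k : Type w} [Field k] {C : Type u} [Category.{v} C] [Abelian C] [Linear k C]
  [MonoidalCategory C]

namespace RightExactLaxModuleMonad

variable {T : RightExactLaxModuleMonad k C}

/-- The unit axiom of the strength turns linearity of `f` into the module morphism axiom for `λ⁻¹ ≫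
f`. -/
theorem isUniversal_leftUnitor (A : T.EM) : IsUniversal (𝟙_ C) A A (λ_ A.A).hom where
  isLinear := IsLinear.leftUnitor A
  exists_fac {B} f hf := ⟨⟨(λ_ A.A).inv ≫ f, by
    rw [leftUnitor_inv_naturality_assoc, hf, ← cancel_epi (λ_ _).hom, Iso.hom_inv_id_assoc,
      ← reassoc_of% T.str_unitality, ← Functor.map_comp_assoc, Iso.hom_inv_id_assoc]⟩,
      Iso.hom_inv_id_assoc _ _⟩
  hom_ext e := Monad.Algebra.Hom.ext ((cancel_epi _).1 e)

instance : PreservesFiniteColimits T.toMonad.forget := ⟨fun _ _ _ => inferInstance⟩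

section

variable {V W : C} [PreservesFiniteColimits (actionLeft C V)] {A E B : T.EM}
  {u : W ⊗ A.A ⟶ E.A}

/-- The epimorphism to cancel is the extension `T (W ⊗ A) ⟶ E` of `u`, which stays epi under `V ⊗
-`. Linearity of `g` expresses its composite with that epimorphism through `V ◁ u ≫ g`. -/
theorem IsUniversal.whiskerLeft_hom_ext (hu : IsUniversal W A E u) {g g' : V ⊗ E.A ⟶ B.A}
    (hg : IsLinear V E B g) (hg' : IsLinear V E B g') (e : V ◁ u ≫ g = V ◁ u ≫ g') : g = g' := by
  have := hu.map_epi
  have : Epi (V ◁ under (ext u)) :=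
    inferInstanceAs (Epi ((actionLeft C V).map (T.toMonad.forget.map (ext u))))
  rw [← cancel_epi (V ◁ under (ext u))]
  have key {g : V ⊗ E.A ⟶ B.A} (hg : IsLinear V E B g) :
      V ◁ under (ext u) ≫ g = T.str V _ ≫ T.map (V ◁ u ≫ g) ≫ B.a := by
    rw [under_ext, MonoidalCategory.whiskerLeft_comp, assoc, hg, reassoc_of% T.str_naturality_right,
      Functor.map_comp, assoc]
  rw [key hg, key hg', e]

/-- `V ⊗ -` preserves the coequalizer presenting `E`, so it is enough to extend `f` over `V ⊗ T (W ⊗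
A)` and check that the extension coequalizes the image of the Linton pair. -/
theorem IsUniversal.exists_whiskerLeft_fac (hu : IsUniversal W A E u)
    (f : V ⊗ W ⊗ A.A ⟶ B.A) (hf : IsLinear (V ⊗ W) A B ((α_ V W A.A).hom ≫ f)) :
    ∃ g : V ⊗ E.A ⟶ B.A, IsLinear V E B g ∧ V ◁ u ≫ g = f := by
  -- This is the linear morphism on the free module `T (W ⊗ A)` that restricts to `f` along `V ◁ η`.
  let fh : V ⊗ T.obj (W ⊗ A.A) ⟶ B.A := T.str V _ ≫ T.map f ≫ B.a
  have hfh : V ◁ T.μ.app (W ⊗ A.A) ≫ fh = T.str V _ ≫ T.map fh ≫ B.a :=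
    (IsLinear.str V (W ⊗ A.A)).comp_hom (ext f)
  -- Linearity of `f` in `A`, with the strength of `V ⊗ W` split into those of `W` and `V`.
  have h1 : V ◁ W ◁ A.a ≫ f = V ◁ T.str W A.A ≫ fh := by
    rw [← cancel_epi (α_ V W _).hom, ← associator_naturality_right_assoc]
    refine hf.trans ?_
    rw [Functor.map_comp, assoc, reassoc_of% T.str_associativity]
  have h2 : V ◁ T.map (W ◁ A.a) ≫ fh =
      V ◁ (T.map (T.str W A.A) ≫ T.μ.app (W ⊗ A.A)) ≫ fh := by
    rw [MonoidalCategory.whiskerLeft_comp, assoc, hfh]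
    dsimp only [fh]
    rw [reassoc_of% T.str_naturality_right, reassoc_of% T.str_naturality_right,
      ← Functor.map_comp_assoc,
      ← Functor.map_comp_assoc, h1]
  let F := T.toMonad.forget ⋙ actionLeft C V
  have hF := isColimitCoforkMapOfIsColimit F hu.condition hu.isColimit
  let g : V ⊗ E.A ⟶ B.A := Cofork.IsColimit.desc hF fh h2
  have hg : V ◁ under (ext u) ≫ g = fh := Cofork.IsColimit.π_desc' hF fh h2
  have := hu.map_epi
  have : Epi (V ◁ T.map (under (ext u))) :=
    inferInstanceAs (Epi ((actionLeft C V).map (T.map (T.toMonad.forget.map (ext u)))))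
  -- Linearity of `g` is checked after the epimorphism `V ◁ T (ext u)`, where it reduces to
  -- linearity of `fh`; `V ◁ u ≫ g = f` follows by restricting along `η`.
  refine ⟨g, ?_, ?_⟩
  · unfold IsLinear
    rw [← cancel_epi (V ◁ T.map (under (ext u))), ← MonoidalCategory.whiskerLeft_comp_assoc,
      map_under, MonoidalCategory.whiskerLeft_comp_assoc, hg, hfh,
      reassoc_of% T.str_naturality_right,
      ← Functor.map_comp_assoc, hg]
  · have hw : u = T.η.app _ ≫ under (ext u) := (res_ext u).symm
    rw [hw, MonoidalCategory.whiskerLeft_comp, assoc, hg]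
    dsimp only [fh]
    rw [reassoc_of% T.str_η]
    exact res_ext f

/-- Composites of universal linear morphisms are universal. -/
theorem IsUniversal.comp (hu : IsUniversal W A E u) {F : T.EM} {u' : V ⊗ E.A ⟶ F.A}
    (hu' : IsUniversal V E F u') :
    IsUniversal (V ⊗ W) A F ((α_ V W A.A).hom ≫ V ◁ u ≫ u') where
  isLinear := hu'.isLinear.comp hu.isLinear
  exists_fac f hf := by
    obtain ⟨g, hg, e⟩ := hu.exists_whiskerLeft_fac ((α_ V W A.A).inv ≫ f)
      (by rwa [Iso.hom_inv_id_assoc])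
    obtain ⟨h, rfl⟩ := hu'.exists_fac g hg
    exact ⟨h, by rw [assoc, assoc, e, Iso.hom_inv_id_assoc]⟩
  hom_ext {B g h} e := by
    simp only [assoc, cancel_epi] at e
    exact hu'.hom_ext (hu.whiskerLeft_hom_ext (hu'.isLinear.comp_hom g)
      (hu'.isLinear.comp_hom h) e)

end

theorem counit_f (A : T.EM) : (T.toMonad.adj.counit.app A).f = A.a := by
  simp only [Monad.adj, Adjunction.mkOfHomEquiv_counit_app]
  exact (congrArg (· ≫ A.a) (T.toFunctor.map_id A.A)).trans (id_comp _)

theorem res_counit (A : T.EM) : res (B := A) (T.toMonad.adj.counit.app A) = 𝟙 A.A :=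
  (congrArg (T.η.app A.A ≫ ·) (counit_f A)).trans A.unit

section Construction

/-- The action of an object on a module. -/
def actObj (V : C) (A : T.EM) : T.EM := (exists_isUniversal V A).choose

/-- The universal linear morphism to the action of an object on a module. -/
def actUniv (V : C) (A : T.EM) : V ⊗ A.A ⟶ (actObj V A).A :=
  (exists_isUniversal V A).choose_spec.choose

theorem isUniversal_actUniv (V : C) (A : T.EM) : IsUniversal V A (actObj V A) (actUniv V A) :=
  (exists_isUniversal V A).choose_spec.choose_spec

/-- The action of a morphism of `C` on a module. -/
def actHomLeft {V W : C} (f : V ⟶ W) (A : T.EM) : actObj V A ⟶ actObj W A :=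
  (isUniversal_actUniv V A).desc _ ((isUniversal_actUniv W A).isLinear.whiskerRight_comp f)

/-- The action of an object of `C` on a morphism of modules. -/
def actHomRight (V : C) {A B : T.EM} (g : A ⟶ B) : actObj V A ⟶ actObj V B :=
  (isUniversal_actUniv V A).desc _ ((isUniversal_actUniv V B).isLinear.whiskerLeft_comp g)

/-- The unit isomorphism of the action. -/
def actUnitor (A : T.EM) : actObj (𝟙_ C) A ≅ A :=
  (isUniversal_actUniv _ A).iso (isUniversal_leftUnitor A)

theorem actUniv_left {V W : C} (f : V ⟶ W) (A : T.EM) :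
    actUniv V A ≫ (actHomLeft f A).f = f ▷ A.A ≫ actUniv W A :=
  (isUniversal_actUniv V A).fac _ _

theorem actUniv_right (V : C) {A B : T.EM} (g : A ⟶ B) :
    actUniv V A ≫ (actHomRight V g).f = V ◁ g.f ≫ actUniv V B :=
  (isUniversal_actUniv V A).fac _ _

theorem actUniv_unitor (A : T.EM) : actUniv (𝟙_ C) A ≫ (actUnitor A).hom.f = (λ_ A.A).hom :=
  (isUniversal_actUniv _ A).fac _ (IsLinear.leftUnitor A)

theorem whiskerLeft_actUniv_left (U : C) {V W : C} (f : V ⟶ W) (A : T.EM) :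
    U ◁ actUniv V A ≫ U ◁ (actHomLeft f A).f = U ◁ f ▷ A.A ≫ U ◁ actUniv W A := by
  simp only [← MonoidalCategory.whiskerLeft_comp, actUniv_left]

theorem whiskerLeft_actUniv_right (U V : C) {A B : T.EM} (g : A ⟶ B) :
    U ◁ actUniv V A ≫ U ◁ (actHomRight V g).f = U ◁ V ◁ g.f ≫ U ◁ actUniv V B := by
  simp only [← MonoidalCategory.whiskerLeft_comp, actUniv_right]

theorem whiskerLeft_actUniv_unitor (U : C) (A : T.EM) :
    U ◁ actUniv (𝟙_ C) A ≫ U ◁ (actUnitor A).hom.f = U ◁ (λ_ A.A).hom := by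
  simp only [← MonoidalCategory.whiskerLeft_comp, actUniv_unitor]

variable [h : RightExactAction C C]

instance (V : C) : PreservesFiniteColimits (actionLeft C V) := h.actionLeft V

/-- The associativity isomorphism of the action. -/
def actAssociator (V W : C) (A : T.EM) : actObj (V ⊗ W) A ≅ actObj V (actObj W A) :=
  (isUniversal_actUniv _ A).iso ((isUniversal_actUniv W A).comp (isUniversal_actUniv V _))

theorem actUniv_associator (V W : C) (A : T.EM) :
    actUniv (V ⊗ W) A ≫ (actAssociator V W A).hom.f =
      (α_ V W A.A).hom ≫ V ◁ actUniv W A ≫ actUniv V (actObj W A) :=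
  (isUniversal_actUniv _ A).fac _ ((isUniversal_actUniv W A).comp
    (isUniversal_actUniv V _)).isLinear

theorem whiskerLeft_actUniv_associator (U V W : C) (A : T.EM) :
    U ◁ actUniv (V ⊗ W) A ≫ U ◁ (actAssociator V W A).hom.f =
      U ◁ (α_ V W A.A).hom ≫ U ◁ V ◁ actUniv W A ≫ U ◁ actUniv V (actObj W A) := by
  simp only [← MonoidalCategory.whiskerLeft_comp, actUniv_associator]

/-- The two whiskering axioms of an action involve the inverse associativity isomorphism, whose
source is tested by the composite universal morphism. -/
theorem actUniv_associator_inv (V W : C) (A : T.EM) :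
    V ◁ actUniv W A ≫ actUniv V (actObj W A) ≫ (actAssociator V W A).inv.f =
      (α_ V W A.A).inv ≫ actUniv (V ⊗ W) A := by
  rw [Iso.eq_inv_comp]
  refine .trans ?_ (((isUniversal_actUniv W A).comp (isUniversal_actUniv V _)).fac _
    (isUniversal_actUniv (V ⊗ W) A).isLinear)
  rw [assoc, assoc]
  rfl

variable (T) in
/-- The action of `C` on the modules over `T` given by universal linear morphisms. -/
abbrev univAction : MonoidalLeftAction C T.EM where
  actionObj := actObj
  actionHomLeft := actHomLeft
  actionHomRight := actHomRight
  actionAssocIso := actAssociator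
  actionUnitIso := actUnitor
  actionHom_def _ _ := rfl
  -- Each equational axiom below compares module morphisms out of some `V ▶ A`. Precomposed with the
  -- universal morphism, it becomes the corresponding coherence or naturality in `C`.
  actionHomRight_id V A := (isUniversal_actUniv V A).hom_ext (by simp [actUniv_right])
  id_actionHomLeft V A := (isUniversal_actUniv V A).hom_ext (by simp [actUniv_left])
  actionHom_comp {_ _ _ A _ _} _ _ _ _ := (isUniversal_actUniv _ A).hom_ext (by
    simp [actUniv_right, reassoc_of% actUniv_right, reassoc_of% actUniv_left,
      whisker_exchange_assoc])
  actionAssocIso_hom_naturality {_ _ _ _ A _} f g h := (isUniversal_actUniv _ A).hom_ext (by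
    simp [actUniv_right, reassoc_of% actUniv_right, reassoc_of% actUniv_left,
      actUniv_associator, reassoc_of% actUniv_associator, MonoidalCategory.tensorHom_def,
      whisker_exchange_assoc, reassoc_of% whiskerLeft_actUniv_left,
      reassoc_of% whiskerLeft_actUniv_right])
  actionUnitIso_hom_naturality {A _} f := (isUniversal_actUniv _ A).hom_ext (by
    simp [actUniv_unitor, reassoc_of% actUniv_unitor, reassoc_of% actUniv_right])
  whiskerLeft_actionHomLeft _ _ _ _ A := (isUniversal_actUniv _ A).hom_ext (by
    simp [actUniv_left, reassoc_of% actUniv_right, reassoc_of% actUniv_associator,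
      actUniv_associator_inv,
      reassoc_of% whiskerLeft_actUniv_left])
  whiskerRight_actionHomLeft _ _ A := (isUniversal_actUniv _ A).hom_ext (by
    simp [actUniv_left, reassoc_of% actUniv_left, reassoc_of% actUniv_associator,
      actUniv_associator_inv,
      whisker_exchange_assoc])
  associator_actionHom _ _ _ A := (isUniversal_actUniv _ A).hom_ext (by
    simp [reassoc_of% actUniv_left, actUniv_right, reassoc_of% actUniv_associator,
      actUniv_associator,
      reassoc_of% whiskerLeft_actUniv_associator])
  leftUnitor_actionHom _ A := (isUniversal_actUniv _ A).hom_ext (by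
    simp [actUniv_left, actUniv_unitor, reassoc_of% actUniv_associator])
  rightUnitor_actionHom _ A := (isUniversal_actUniv _ A).hom_ext (by
    simp [actUniv_left, actUniv_right, reassoc_of% actUniv_associator,
      reassoc_of% whiskerLeft_actUniv_unitor])

/-- The Linton module structure given by universal linear morphisms. -/
def univLintonAction : T.LintonAction :=
  letI := T.univAction
  { action := T.univAction
    proj V A := ext (actUniv V A)
    condition V A := (isUniversal_actUniv V A).condition
    isColimit V A := ⟨(isUniversal_actUniv V A).isColimit⟩
    naturality_left f A := free_hom_ext (by
      rw [res_map_comp, res_comp, res_ext, res_ext]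
      exact (actUniv_left f A).symm)
    naturality_right V _ _ g := free_hom_ext (by
      rw [res_map_comp, res_comp, res_ext, res_ext]
      exact (actUniv_right V g).symm)
    unitality A := free_hom_ext (by
      have e : res (B := A) (T.toMonad.adj.counit.app A) = 𝟙 A.A := res_counit A
      refine (res_comp _ _).trans ((congrArg (· ≫ _) (res_ext _)).trans
        ((actUniv_unitor A).trans ?_))
      refine .trans ?_ (res_map_comp (λ_ A.A).hom (T.toMonad.adj.counit.app A)).symm
      exact ((congrArg _ e).trans (comp_id _)).symm)
    associativity V W A := free_hom_ext (by
      refine (res_comp _ _).trans ((congrArg (· ≫ _) (res_ext _)).trans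
        ((actUniv_associator V W A).trans ?_))
      refine .trans ?_ (res_map_comp _ _).symm
      refine .trans ?_ (congrArg₂ (fun s t => (_ ≫ V ◁ s) ≫ t) (res_ext _) (res_ext _)).symm
      exact (assoc _ _ _).symm) }

end Construction

end RightExactLaxModuleMonad

end ModuleReconstruction
end
-- Strong functors from universal morphisms, exactness of the action, and the free module on the
-- unit.
noncomputable section
namespace ModuleReconstruction

section LeftLinear

variable {C : Type*} [Category* C] [MonoidalCategory C]
variable {M : Type*} [Category* M] [MonoidalLeftAction C M]
variable {N : Type*} [Category* N] [MonoidalLeftAction C N]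

/-- A lax module functor with invertible structure morphisms is strong. -/
abbrev leftLinearOfLax (F : M ⥤ N) [F.LaxLeftLinear C]
    (h : ∀ (V : C) (X : M), IsIso (μₗ F V X)) : F.LeftLinear C where
  δₗ V X := inv (μₗ F V X)
  δₗ_naturality_left f X := by
    rw [IsIso.comp_inv_eq, assoc, μₗ_naturality_left, IsIso.inv_hom_id_assoc]
  δₗ_naturality_right V _ _ f := by
    rw [IsIso.comp_inv_eq, assoc, μₗ_naturality_right, IsIso.inv_hom_id_assoc]
  δₗ_associativity V W X := by
    rw [IsIso.inv_comp_eq, ← assoc, μₗ_associativity]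
    simp
  δₗ_unitality_inv X := by
    rw [IsIso.eq_comp_inv, μₗ_unitality_inv]
  μₗ_comp_δₗ _ _ := IsIso.hom_inv_id _
  δₗ_comp_μₗ _ _ := IsIso.inv_hom_id _

end LeftLinear

variable {k : Type w} [Field k] {C : Type u} [Category.{v} C] [Abelian C] [Linear k C]
  [MonoidalCategory C]

namespace RightExactLaxModuleMonad

variable (T : RightExactLaxModuleMonad k C)

theorem str_rightUnitor_naturality {V W : C} (f : V ⟶ W) :
    f ▷ T.obj (𝟙_ C) ≫ T.str W (𝟙_ C) ≫ T.map (ρ_ W).hom =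
      (T.str V (𝟙_ C) ≫ T.map (ρ_ V).hom) ≫ T.map f := by
  rw [reassoc_of% T.str_naturality_left, assoc, ← Functor.map_comp, ← Functor.map_comp,
    rightUnitor_naturality]

-- For a colimit cocone `p`, the maps `V ◁ T (p j)` are jointly epi by exactness of `T` and `V ⊗ -`.
-- This makes linearity a property of the components when morphisms are glued.
variable {T} in
theorem IsLinear.of_jointly_epi {ι : Type*} {V : C} {A : ι → T.EM} {P B : T.EM}
    (p : ∀ j, A j ⟶ P)
    (hp : ∀ x y : V ⊗ T.obj P.A ⟶ B.A,
      (∀ j, V ◁ T.map (p j).f ≫ x = V ◁ T.map (p j).f ≫ y) → x = y)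
    {d : V ⊗ P.A ⟶ B.A} (hd : ∀ j, IsLinear V (A j) B (V ◁ (p j).f ≫ d)) :
    IsLinear V P B d := by
  refine hp _ _ fun j => ?_
  rw [← MonoidalCategory.whiskerLeft_comp_assoc, (p j).h, reassoc_of% T.str_naturality_right,
    MonoidalCategory.whiskerLeft_comp_assoc, ← Functor.map_comp_assoc]
  exact hd j

-- The analogue for a cocone in the acting variable, where only `- ⊗ T A` has to preserve the
-- colimit.
variable {T} in
theorem IsLinear.of_jointly_epi' {ι : Type*} {V : ι → C} {W : C} {A B : T.EM} (p : ∀ j, V j ⟶ W)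
    (hp : ∀ x y : W ⊗ T.obj A.A ⟶ B.A,
      (∀ j, p j ▷ T.obj A.A ≫ x = p j ▷ T.obj A.A ≫ y) → x = y)
    {d : W ⊗ A.A ⟶ B.A} (hd : ∀ j, IsLinear (V j) A B (p j ▷ A.A ≫ d)) :
    IsLinear W A B d := by
  refine hp _ _ fun j => ?_
  rw [← whisker_exchange_assoc, reassoc_of% T.str_naturality_left, ← Functor.map_comp_assoc]
  exact hd j

/-- An action of `C` on the modules over `T` together with universal linear morphisms
`V ⊗ A ⟶ V ▶ A` which are compatible with all the structure of the action. -/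
structure UniversalAction [MonoidalLeftAction C T.EM] where
  /-- The universal linear morphism. -/
  univ (V : C) (A : T.EM) : V ⊗ A.A ⟶ (V ⊙ₗ A).A
  isUniversal (V : C) (A : T.EM) : IsUniversal V A (V ⊙ₗ A) (univ V A)
  left {V W : C} (f : V ⟶ W) (A : T.EM) : univ V A ≫ (f ⊵ₗ A).f = f ▷ A.A ≫ univ W A
  right (V : C) {A B : T.EM} (g : A ⟶ B) : univ V A ≫ (V ⊴ₗ g).f = V ◁ g.f ≫ univ V B
  unitor (A : T.EM) : univ (𝟙_ C) A ≫ (λₗ A).hom.f = (λ_ A.A).hom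
  associator (V W : C) (A : T.EM) :
    univ (V ⊗ W) A ≫ (αₗ V W A).hom.f = (α_ V W A.A).hom ≫ V ◁ univ W A ≫ univ V (W ⊙ₗ A)

/-- The universal linear morphisms of a Linton module structure. -/
def LintonAction.universalAction {T : RightExactLaxModuleMonad k C} (L : T.LintonAction) :
    letI := L.action
    T.UniversalAction :=
  letI := L.action
  { univ V A := res (L.proj V A)
    isUniversal V A := isUniversal_res _ _ (L.isColimit V A).some
    left f A := by
      rw [← res_comp, ← res_map_comp, L.naturality_left]
    right V _ _ g := by
      rw [← res_comp, ← res_map_comp, L.naturality_right]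
    unitor A := by
      rw [← res_comp, L.unitality]
      refine (res_map_comp (λ_ A.A).hom (T.toMonad.adj.counit.app A)).trans ?_
      exact (congrArg _ (res_counit A)).trans (comp_id _)
    associator V W A := by
      rw [← res_comp, L.associativity, res_map_comp, assoc]
      rfl }

/-- A lax `C`-module structure on the composite of `K : N ⥤ EM(T)` with the forgetful functor whose
structure morphisms are universal linear morphisms. -/
structure UniversalFunctor {N : Type*} [Category* N] [MonoidalLeftAction C N] (K : N ⥤ T.EM) where
  /-- The universal linear morphism. -/
  univ (V : C) (X : N) : V ⊗ (K.obj X).A ⟶ (K.obj (V ⊙ₗ X)).A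
  isUniversal (V : C) (X : N) : IsUniversal V (K.obj X) (K.obj (V ⊙ₗ X)) (univ V X)
  left {V W : C} (f : V ⟶ W) (X : N) :
    univ V X ≫ (K.map (f ⊵ₗ X)).f = f ▷ (K.obj X).A ≫ univ W X
  right (V : C) {X Y : N} (g : X ⟶ Y) :
    univ V X ≫ (K.map (V ⊴ₗ g)).f = V ◁ (K.map g).f ≫ univ V Y
  unitor (X : N) : univ (𝟙_ C) X ≫ (K.map (λₗ X).hom).f = (λ_ (K.obj X).A).hom
  associator (V W : C) (X : N) :
    univ (V ⊗ W) X ≫ (K.map (αₗ V W X).hom).f =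
      (α_ V W (K.obj X).A).hom ≫ V ◁ univ W X ≫ univ V (W ⊙ₗ X)

variable {T} [MonoidalLeftAction C T.EM] (U : T.UniversalAction)

namespace UniversalAction

/-- The universal linear morphisms of an action, seen as a structure on the identity functor. -/
def idFunctor : T.UniversalFunctor (𝟭 T.EM) where
  univ := U.univ
  isUniversal := U.isUniversal
  left := U.left
  right := U.right
  unitor := U.unitor
  associator := U.associator

section

variable {N : Type*} [Category* N] [MonoidalLeftAction C N] {K : N ⥤ T.EM}
  (S : T.UniversalFunctor K)

/-- The comparison of universal linear morphisms. -/
def comparison (V : C) (X : N) : V ⊙ₗ K.obj X ⟶ K.obj (V ⊙ₗ X) :=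
  (U.isUniversal V (K.obj X)).desc (S.univ V X) (S.isUniversal V X).isLinear

theorem univ_comparison (V : C) (X : N) :
    U.univ V (K.obj X) ≫ (U.comparison S V X).f = S.univ V X :=
  (U.isUniversal V (K.obj X)).fac _ _

theorem isIso_comparison (V : C) (X : N) : IsIso (U.comparison S V X) :=
  (U.isUniversal V (K.obj X)).isIso_of_comp_eq (S.isUniversal V X) (U.univ_comparison S V X)

/-- A functor with a universal structure is a lax module functor. -/
abbrev laxLeftLinear : K.LaxLeftLinear C where
  μₗ := U.comparison S
  μₗ_naturality_left {V W} f X := (U.isUniversal V (K.obj X)).hom_ext (by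
    rw [Monad.Algebra.comp_f, Monad.Algebra.comp_f, reassoc_of% U.left, U.univ_comparison,
      reassoc_of% U.univ_comparison, S.left])
  μₗ_naturality_right V X _ f := (U.isUniversal V (K.obj X)).hom_ext (by
    rw [Monad.Algebra.comp_f, Monad.Algebra.comp_f, reassoc_of% U.right, U.univ_comparison,
      reassoc_of% U.univ_comparison, S.right])
  μₗ_associativity V W X := (U.isUniversal _ (K.obj X)).hom_ext (by
    simp only [Monad.Algebra.comp_f]
    rw [reassoc_of% U.univ_comparison, S.associator, reassoc_of% U.associator,
      reassoc_of% U.right, U.univ_comparison, ← MonoidalCategory.whiskerLeft_comp_assoc,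
      U.univ_comparison])
  μₗ_unitality X := (U.isUniversal _ (K.obj X)).hom_ext (by
    rw [Monad.Algebra.comp_f, reassoc_of% U.univ_comparison, U.unitor, S.unitor])

/-- A functor with a universal structure is a strong module functor. -/
abbrev leftLinear : K.LeftLinear C :=
  letI := U.laxLeftLinear S
  leftLinearOfLax K (U.isIso_comparison S)

end

theorem right_comp (V : C) {A B D : T.EM} (g : A ⟶ B) (h : V ⊙ₗ B ⟶ D) :
    V ◁ g.f ≫ U.univ V B ≫ h.f = U.univ V A ≫ (V ⊴ₗ g ≫ h).f := by
  rw [Monad.Algebra.comp_f, reassoc_of% U.right]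

theorem left_comp {V W : C} (g : V ⟶ W) {A D : T.EM} (h : W ⊙ₗ A ⟶ D) :
    g ▷ A.A ≫ U.univ W A ≫ h.f = U.univ V A ≫ (g ⊵ₗ A ≫ h).f := by
  rw [Monad.Algebra.comp_f, reassoc_of% U.left]

-- A cocone under `V ▶ A_j` is a compatible family of linear morphisms `V ⊗ A_j ⟶ B`. It glues over
-- `V ⊗ colim A_j` since the forgetful functor and `V ⊗ -` preserve the colimit; the same for `V ⊗ T
-- -` makes the glued morphism linear.
include U in
theorem preservesFiniteColimits_actionLeft (V : C) [PreservesFiniteColimits (actionLeft C V)] :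
    PreservesFiniteColimits (actionLeft T.EM V) := ⟨fun J _ _ => ⟨fun {K} => ⟨fun {c} hc => by
  have h1 := isColimitOfPreserves (T.toMonad.forget ⋙ actionLeft C V) hc
  have h2 := isColimitOfPreserves (T.toMonad.forget ⋙ T.toFunctor ⋙ actionLeft C V) hc
  have exists_desc (s : Cocone (K ⋙ actionLeft T.EM V)) : ∃ f : V ⊗ c.pt.A ⟶ s.pt.A,
      IsLinear V c.pt s.pt f ∧
        ∀ j, V ◁ (c.ι.app j).f ≫ f = U.univ V (K.obj j) ≫ (s.ι.app j).f := by
    let t : Cocone (K ⋙ T.toMonad.forget ⋙ actionLeft C V) :=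
      { pt := s.pt.A
        ι :=
          { app j := U.univ V (K.obj j) ≫ (s.ι.app j).f
            naturality i j a := ((U.right_comp V (K.map a) (s.ι.app j)).trans
              (congrArg (fun f => U.univ V (K.obj i) ≫ Monad.Algebra.Hom.f f) (s.w a))).trans
                (comp_id _).symm } }
    refine ⟨h1.desc t, ?_, h1.fac t⟩
    refine IsLinear.of_jointly_epi (fun j => c.ι.app j) (fun _ _ h => h2.hom_ext h) fun j => ?_
    have e : V ◁ (c.ι.app j).f ≫ h1.desc t = U.univ V (K.obj j) ≫ (s.ι.app j).f := h1.fac t j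
    rw [e]
    exact (U.isUniversal V (K.obj j)).isLinear.comp_hom (s.ι.app j)
  exact ⟨{
    desc s := (U.isUniversal V c.pt).desc _ (exists_desc s).choose_spec.1
    fac s j := (U.isUniversal V (K.obj j)).hom_ext ((U.right_comp V (c.ι.app j) _).symm.trans
      ((congrArg _ (IsUniversal.fac _ _ _)).trans ((exists_desc s).choose_spec.2 j)))
    uniq s m hm := (U.isUniversal V c.pt).hom_ext ((h1.hom_ext fun j =>
      (U.right_comp V (c.ι.app j) m).trans
        ((congrArg (fun f => U.univ V (K.obj j) ≫ Monad.Algebra.Hom.f f) (hm j)).trans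
          ((exists_desc s).choose_spec.2 j).symm)).trans (IsUniversal.fac _ _ _).symm) }⟩⟩⟩⟩

-- The same gluing in the other variable, using that `- ⊗ A` and `- ⊗ T A` preserve the colimit.
include U in
theorem preservesFiniteColimits_actionRight (A : T.EM)
    (hA : ∀ X : C, PreservesFiniteColimits (actionRight C X)) :
    PreservesFiniteColimits (actionRight C A) := ⟨fun J _ _ => ⟨fun {K} => ⟨fun {c} hc => by
  have h1 := isColimitOfPreserves (actionRight C A.A) hc
  have h2 := isColimitOfPreserves (actionRight C (T.obj A.A)) hc
  have exists_desc (s : Cocone (K ⋙ actionRight C A)) : ∃ f : c.pt ⊗ A.A ⟶ s.pt.A,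
      IsLinear c.pt A s.pt f ∧
        ∀ j, c.ι.app j ▷ A.A ≫ f = U.univ (K.obj j) A ≫ (s.ι.app j).f := by
    let t : Cocone (K ⋙ actionRight C A.A) :=
      { pt := s.pt.A
        ι :=
          { app j := U.univ (K.obj j) A ≫ (s.ι.app j).f
            naturality i j a := ((U.left_comp (K.map a) (s.ι.app j)).trans
              (congrArg (fun f => U.univ (K.obj i) A ≫ Monad.Algebra.Hom.f f) (s.w a))).trans
                (comp_id _).symm } }
    refine ⟨h1.desc t, ?_, h1.fac t⟩
    refine IsLinear.of_jointly_epi' (fun j => c.ι.app j) (fun _ _ h => h2.hom_ext h) fun j => ?_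
    have e : c.ι.app j ▷ A.A ≫ h1.desc t = U.univ (K.obj j) A ≫ (s.ι.app j).f := h1.fac t j
    rw [e]
    exact (U.isUniversal (K.obj j) A).isLinear.comp_hom (s.ι.app j)
  exact ⟨{
    desc s := (U.isUniversal c.pt A).desc _ (exists_desc s).choose_spec.1
    fac s j := (U.isUniversal (K.obj j) A).hom_ext ((U.left_comp (c.ι.app j) _).symm.trans
      ((congrArg _ (IsUniversal.fac _ _ _)).trans ((exists_desc s).choose_spec.2 j)))
    uniq s m hm := (U.isUniversal c.pt A).hom_ext ((h1.hom_ext fun j =>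
      (U.left_comp (c.ι.app j) m).trans
        ((congrArg (fun f => U.univ (K.obj j) A ≫ Monad.Algebra.Hom.f f) (hm j)).trans
          ((exists_desc s).choose_spec.2 j).symm)).trans (IsUniversal.fac _ _ _).symm) }⟩⟩⟩⟩

include U in
theorem rightExactAction [h : RightExactAction C C] : RightExactAction C T.EM where
  actionLeft V := U.preservesFiniteColimits_actionLeft V
  actionRight A := U.preservesFiniteColimits_actionRight A h.actionRight

/-- The action on a free module. -/
def freeIso (V W : C) : V ⊙ₗ T.toMonad.free.obj W ≅ T.toMonad.free.obj (V ⊗ W) :=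
  (U.isUniversal _ _).iso (isUniversal_str V W)

/-- The functor `- ▶ T(𝟙)` is the free module functor. -/
def actionRightFreeIso : actionRight C (T.toMonad.free.obj (𝟙_ C)) ≅ T.toMonad.free :=
  NatIso.ofComponents (fun V => U.freeIso V (𝟙_ C) ≪≫ T.toMonad.free.mapIso (ρ_ V))
    (fun {V W} f => (U.isUniversal V _).hom_ext (by
      -- On the universal morphism the component at `V` is the strength at the unit followed by `T
      -- ρ`, which is natural in `V`.
      have e (V : C) : U.univ V (T.toMonad.free.obj (𝟙_ C)) ≫
          ((U.freeIso V (𝟙_ C)).hom ≫ T.toMonad.free.map (ρ_ V).hom).f =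
            T.str V (𝟙_ C) ≫ T.map (ρ_ V).hom :=
        (U.isUniversal _ _).fac_assoc _ (IsLinear.str V (𝟙_ C)) _
      refine (U.left_comp f _).symm.trans ((congrArg _ (e W)).trans ?_)
      refine .trans ?_ ((congrArg (· ≫ T.map f) (e V)).symm.trans (assoc _ _ _))
      exact T.str_rightUnitor_naturality f))

end UniversalAction

section

variable {T : RightExactLaxModuleMonad k C}

/-- Extend a projective cover-like epimorphism `P ⟶ A` of `C`. The underlying map is `T` of an
epimorphism, epi by right exactness, followed by `∇_A`, which is split by `η`. -/
theorem exists_epi_free [EnoughProjectives C] (A : T.EM) :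
    ∃ (P : C) (_ : Projective P) (f : T.toMonad.free.obj P ⟶ A), Epi f := by
  refine ⟨Projective.over A.A, inferInstance, ext (Projective.π A.A), ?_⟩
  have : Epi (T.toMonad.forget.map (ext (Projective.π A.A))) := ?_
  · exact T.toMonad.forget.epi_of_epi_map this
  change Epi (T.map (Projective.π A.A) ≫ A.a)
  have : Epi A.a := (SplitEpi.mk _ A.unit).epi
  infer_instance

theorem projective_free (P : C) (hP : Projective P) : Projective (T.toMonad.free.obj P) :=
  T.toMonad.adj.map_projective P hP

theorem exists_retract_free [EnoughProjectives C] (Q : T.EM) (hQ : Projective Q) :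
    ∃ (P : C) (_ : Projective P), Nonempty (Retract Q (T.toMonad.free.obj P)) := by
  obtain ⟨P, hP, f, hf⟩ := exists_epi_free Q
  exact ⟨P, hP, ⟨⟨Projective.factorThru (𝟙 Q) f, f, Projective.factorThru_comp _ _⟩⟩⟩

theorem enoughProjectives_EM [EnoughProjectives C] : EnoughProjectives T.EM where
  presentation A := by
    obtain ⟨P, hP, f, hf⟩ := exists_epi_free A
    exact ⟨{ p := _, projective := projective_free P hP, f := f, epi := hf }⟩

end

variable {T : RightExactLaxModuleMonad k C} [MonoidalPreadditive C] [MonoidalLinear k C]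
  [EnoughProjectives C] [RightExactAction C C]

/-- Everything about `T(𝟙)` is read off from `- ▶ T(𝟙) ≅ free`: the forgetful functor is the right
adjoint, free modules on projectives are projective, and every projective module is a retract of one
of these. -/
theorem isProjectiveReconstruction (L : T.LintonAction) :
    L.toModuleCategory.IsProjectiveReconstruction L.freeUnit :=
  letI := L.action
  let U := L.universalAction
  have e (P : C) : P ⊙ₗ T.toMonad.free.obj (𝟙_ C) ≅ T.toMonad.free.obj P :=
    U.actionRightFreeIso.app P
  { rightExact := U.rightExactAction
    enoughProjectives := enoughProjectives_EM
    closed := (T.toMonad.adj.ofNatIsoLeft U.actionRightFreeIso.symm).isLeftAdjoint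
    projective P hP := (projective_free P hP).of_iso (e P).symm
    generator Q hQ := by
      obtain ⟨P, hP, ⟨r⟩⟩ := exists_retract_free (T := T) Q hQ
      exact ⟨P, hP, ⟨r.trans (.ofIso (e P).symm)⟩⟩ }

end RightExactLaxModuleMonad

end ModuleReconstruction
end
-- Equivalence of module categories, mates as universal morphisms, and monadicity.
noncomputable section
namespace ModuleReconstruction

section ModuleFunctors

variable {C : Type*} [Category* C] [MonoidalCategory C]
variable {M : Type*} [Category* M] [MonoidalLeftAction C M]
variable {N : Type*} [Category* N] [MonoidalLeftAction C N]
variable {L : Type*} [Category* L] [MonoidalLeftAction C L]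

/-- The identity functor is a strong module functor. -/
abbrev idLeftLinear : (𝟭 M).LeftLinear C where
  μₗ _ _ := 𝟙 _
  δₗ _ _ := 𝟙 _
  μₗ_naturality_left _ _ := (comp_id _).trans (id_comp _).symm
  μₗ_naturality_right _ _ _ _ := (comp_id _).trans (id_comp _).symm
  μₗ_associativity V W X := by simp
  μₗ_unitality _ := (id_comp _).symm
  δₗ_naturality_left _ _ := (comp_id _).trans (id_comp _).symm
  δₗ_naturality_right _ _ _ _ := (comp_id _).trans (id_comp _).symm
  δₗ_associativity V W X := by simp
  δₗ_unitality_inv _ := (comp_id _).symm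
  μₗ_comp_δₗ _ _ := comp_id _
  δₗ_comp_μₗ _ _ := comp_id _

/-- Composites of strong module functors are strong. -/
abbrev compLeftLinear (F : M ⥤ N) (G : N ⥤ L) [F.LeftLinear C] [G.LeftLinear C] :
    (F ⋙ G).LeftLinear C :=
  letI := compLax (C := C) F G
  leftLinearOfLax (F ⋙ G) fun V X =>
    inferInstanceAs (IsIso (μₗ G V (F.obj X) ≫ G.map (μₗ F V X)))

/-- Quasi-inverses of strong module functors are strong. -/
abbrev invLeftLinear (F : M ⥤ N) [F.IsEquivalence] [F.LeftLinear C] : F.inv.LeftLinear C :=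
  letI adj : F ⊣ F.inv := F.asEquivalence.toAdjunction
  letI := rightAdjointLax (C := C) adj
  leftLinearOfLax F.inv fun V X => by
    change IsIso (laxMate adj V X)
    -- For an equivalence the mate is a composite of the unit, the counit and the strong structure,
    -- all invertible.
    rw [laxMate, adj.homEquiv_unit]
    have : IsIso (adj.unit.app (V ⊙ₗ F.inv.obj X)) :=
      inferInstanceAs (IsIso (F.asEquivalence.unit.app _))
    have : IsIso (adj.counit.app X) := inferInstanceAs (IsIso (F.asEquivalence.counit.app _))
    infer_instance

end ModuleFunctors

section Equivalences

variable {k : Type w} [Field k] {C : Type u} [Category.{v} C] [Preadditive C] [Linear k C]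
  [MonoidalCategory C]

theorem linear_inv {M N : Type*} [Category* M] [Category* N] [Preadditive M] [Preadditive N]
    [Linear k M] [Linear k N] (F : M ⥤ N) [F.IsEquivalence] [F.Additive] [F.Linear k] :
    F.inv.Linear k where
  map_smul f r := F.map_injective (by simp; rfl)

theorem additive_inv {M N : Type*} [Category* M] [Category* N] [Preadditive M] [Preadditive N]
    (F : M ⥤ N) [F.IsEquivalence] [F.Additive] : F.inv.Additive where
  map_add := F.map_injective (by simp; rfl)

theorem AbelianModuleCategory.equivalence :
    _root_.Equivalence
      (AbelianModuleCategory.Equivalent : AbelianModuleCategory.{v', u'} k C → _ → Prop) where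
  refl _ := ⟨𝟭 _, inferInstance, inferInstance, inferInstance, ⟨idLeftLinear⟩⟩
  symm := fun ⟨F, _, _, _, ⟨_⟩⟩ => ⟨F.inv, inferInstance,
    additive_inv F, linear_inv F, ⟨invLeftLinear F⟩⟩
  trans := fun ⟨F, _, _, _, ⟨_⟩⟩ ⟨G, _, _, _, ⟨_⟩⟩ =>
    ⟨F ⋙ G, inferInstance, inferInstance, inferInstance, ⟨compLeftLinear F G⟩⟩

end Equivalences

section Mates

variable {C : Type*} [Category* C] [MonoidalCategory C]
variable {M : Type*} [Category.{v} M] [MonoidalLeftAction C M]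
variable {N : Type*} [Category.{v} N] [MonoidalLeftAction C N]
variable {F : N ⥤ M} {H : M ⥤ N} [F.LeftLinear C] (adj : F ⊣ H)

/-- A morphism `V ▷ H Y ⟶ H Z` is linear over the monad of an adjunction `F ⊣ H` if and only if its
transpose is compatible with the canonical presentation of `Y`. -/
theorem linear_iff_symm {V : C} {Y Z : M} (f : V ⊙ₗ H.obj Y ⟶ H.obj Z) :
    V ⊴ₗ H.map (adj.counit.app Y) ≫ f =
        (laxMate adj V (F.obj (H.obj Y)) ≫ H.map (μₗ F V (H.obj Y))) ≫
          H.map (F.map f) ≫ H.map (adj.counit.app Z) ↔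
      V ⊴ₗ F.map (H.map (adj.counit.app Y)) ≫ μₗ F V (H.obj Y) ≫ (adj.homEquiv _ _).symm f =
        V ⊴ₗ adj.counit.app (F.obj (H.obj Y)) ≫ μₗ F V (H.obj Y) ≫ (adj.homEquiv _ _).symm f := by
  have h1 : (adj.homEquiv _ _).symm (V ⊴ₗ H.map (adj.counit.app Y) ≫ f) =
      δₗ F V _ ≫ V ⊴ₗ F.map (H.map (adj.counit.app Y)) ≫ μₗ F V (H.obj Y) ≫
        (adj.homEquiv _ _).symm f := by
    rw [adj.homEquiv_naturality_left_symm]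
    simp
  have h2 : (adj.homEquiv _ _).symm
      ((laxMate adj V (F.obj (H.obj Y)) ≫ H.map (μₗ F V (H.obj Y))) ≫
          H.map (F.map f) ≫ H.map (adj.counit.app Z)) =
      δₗ F V _ ≫ V ⊴ₗ adj.counit.app (F.obj (H.obj Y)) ≫ μₗ F V (H.obj Y) ≫
        (adj.homEquiv _ _).symm f := by
    rw [← Functor.map_comp, map_comp_counit]
    refine (adj.homEquiv_naturality_right_symm _ _).trans ?_
    rw [adj.homEquiv_naturality_right_symm, symm_laxMate]
    simp only [assoc]
  -- Both transposes begin with the same invertible `δₗ`, which cancels.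
  refine (adj.homEquiv _ _).symm.injective.eq_iff.symm.trans ((Eq.congr h1 h2).trans ?_)
  exact cancel_epi _

/-- The transpose of the mate is `δₗ` followed by `V ▷` counit, and naturality of the counit makes
it compatible with the canonical presentation. -/
theorem laxMate_linear (V : C) (Y : M) :
    V ⊴ₗ H.map (adj.counit.app Y) ≫ laxMate adj V Y =
      (laxMate adj V (F.obj (H.obj Y)) ≫ H.map (μₗ F V (H.obj Y))) ≫
        H.map (F.map (laxMate adj V Y)) ≫ H.map (adj.counit.app (V ⊙ₗ Y)) := by
  refine (linear_iff_symm adj _).2 ?_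
  rw [symm_laxMate]
  simp only [Functor.LeftLinear.μₗ_comp_δₗ_assoc, ← actionHomRight_comp]
  exact congrArg (V ⊴ₗ ·) (adj.counit_naturality _)

theorem laxMate_comp_map (V : C) {Y Z : M} (f : V ⊙ₗ Y ⟶ Z) :
    (adj.homEquiv _ _).symm (laxMate adj V Y ≫ H.map f) =
      δₗ F V (H.obj Y) ≫ V ⊴ₗ adj.counit.app Y ≫ f := by
  rw [adj.homEquiv_naturality_right_symm, symm_laxMate, assoc]

/-- The mate is universal among the linear morphisms `V ▷ H Y ⟶ H Z`. -/
theorem exists_laxMate_fac {V : C} {Y Z : M}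
    (h : IsColimit (Monad.MonadicityInternal.counitCofork adj Y))
    [PreservesFiniteColimits (actionLeft M V)] (f : V ⊙ₗ H.obj Y ⟶ H.obj Z)
    (hf : V ⊴ₗ H.map (adj.counit.app Y) ≫ f =
        (laxMate adj V (F.obj (H.obj Y)) ≫ H.map (μₗ F V (H.obj Y))) ≫
          H.map (F.map f) ≫ H.map (adj.counit.app Z)) :
    ∃ g : V ⊙ₗ Y ⟶ Z, laxMate adj V Y ≫ H.map g = f := by
  -- Right exactness of `V ▷ -` keeps the canonical presentation of `Y` a coequalizer; the transpose
  -- of `f` descends along it.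
  have hV := isColimitCoforkMapOfIsColimit (actionLeft M V) _ h
  obtain ⟨g, hg⟩ : ∃ g : V ⊙ₗ Y ⟶ Z, V ⊴ₗ adj.counit.app Y ≫ g =
      μₗ F V (H.obj Y) ≫ (adj.homEquiv _ _).symm f :=
    ⟨Cofork.IsColimit.desc hV (μₗ F V (H.obj Y) ≫ (adj.homEquiv _ _).symm f)
      ((linear_iff_symm adj f).1 hf), Cofork.IsColimit.π_desc' hV _ _⟩
  refine ⟨g, (adj.homEquiv _ _).symm.injective ?_⟩
  rw [laxMate_comp_map, hg, Functor.LeftLinear.δₗ_comp_μₗ_assoc]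

theorem laxMate_hom_ext {V : C} {Y Z : M}
    (h : IsColimit (Monad.MonadicityInternal.counitCofork adj Y))
    [PreservesFiniteColimits (actionLeft M V)] {g g' : V ⊙ₗ Y ⟶ Z}
    (e : laxMate adj V Y ≫ H.map g = laxMate adj V Y ≫ H.map g') : g = g' := by
  have e' := congrArg (adj.homEquiv _ _).symm e
  rw [laxMate_comp_map, laxMate_comp_map, cancel_epi] at e'
  exact Cofork.IsColimit.hom_ext (isColimitCoforkMapOfIsColimit (actionLeft M V) _ h) e'

end Mates

section Comparison

variable {k : Type w} [Field k] {C : Type u} [Category.{v} C] [Abelian C] [Linear k C]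
  [MonoidalCategory C]

/-- Universality may be tested on the objects in the image of an equivalence. -/
theorem RightExactLaxModuleMonad.IsUniversal.of_isEquivalence {T : RightExactLaxModuleMonad k C}
    {N : Type*} [Category* N] (K : N ⥤ T.EM) [K.IsEquivalence] {V : C} {A E : T.EM}
    {u : V ⊗ A.A ⟶ E.A} (hu : IsLinear V A E u)
    (fac : ∀ (Z : N) (f : V ⊗ A.A ⟶ (K.obj Z).A), IsLinear V A (K.obj Z) f →
      ∃ h : E ⟶ K.obj Z, u ≫ h.f = f)
    (ext : ∀ (Z : N) (g h : E ⟶ K.obj Z), u ≫ g.f = u ≫ h.f → g = h) :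
    IsUniversal V A E u where
  isLinear := hu
  exists_fac {B} f hf := by
    let e := K.objObjPreimageIso B
    obtain ⟨h, hh⟩ := fac _ (f ≫ e.inv.f) (hf.comp_hom e.inv)
    refine ⟨h ≫ e.hom, ?_⟩
    rw [Monad.Algebra.comp_f, reassoc_of% hh]
    exact (congrArg (f ≫ Monad.Algebra.Hom.f ·) e.inv_hom_id).trans (comp_id _)
  hom_ext {B g h} eq := by
    let e := K.objObjPreimageIso B
    rw [← cancel_mono e.inv]
    exact ext _ _ _ (by rw [Monad.Algebra.comp_f, Monad.Algebra.comp_f, reassoc_of% eq])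

/-- Enough projectives and the generator property give an epimorphism `P ▷ X ⟶ Y`, and
precomposition with it transposes to a morphism `P ⟶ H Y`, on which `H f` and `H g` agree. -/
theorem faithful_rightAdjoint {M : AbelianModuleCategory.{v', u'} k C} {X : M} {H : M ⥤ C}
    (adj : actionRight C X ⊣ H) (hM : EnoughProjectives M) (hX : M.IsCGenerator X) :
    H.Faithful where
  map_injective {Y Z f g} e := by
    obtain ⟨P, -, ⟨r⟩⟩ := hX (Projective.over Y) inferInstance
    have : Epi r.r := (SplitEpi.mk r.i r.retract).epi
    rw [← cancel_epi (Projective.π Y), ← cancel_epi r.r, ← assoc, ← assoc]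
    refine (adj.homEquiv P Z).injective ?_
    exact (adj.homEquiv_naturality_right _ f).trans
      ((congrArg _ e).trans (adj.homEquiv_naturality_right _ g).symm)

namespace ProjectivePair

variable (p : ProjectivePair.{v, u'} k C) (H : p.M ⥤ C) (adj : actionRight C p.X ⊣ H)

-- A faithful functor reflects monomorphisms and epimorphisms, and an abelian category is balanced.
include adj in
theorem reflectsIsomorphisms : H.ReflectsIsomorphisms :=
  have := faithful_rightAdjoint adj p.prop.enoughProjectives p.prop.generator
  reflectsIsomorphisms_of_reflectsMonomorphisms_of_reflectsEpimorphisms H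

variable [EnoughProjectives C]

/-- The comparison functor to the Eilenberg-Moore category of the monad `[X, - ▷ X]`. -/
def comparison : p.M ⥤ (p.internalHomMonad H adj).EM := Monad.comparison adj

include adj in
theorem preservesFiniteColimits : PreservesFiniteColimits H :=
  rightExact_rightAdjoint adj p.prop.projective

/-- Crude monadicity: `H` preserves reflexive coequalizers because it is right exact, and it
reflects isomorphisms. -/
instance : (p.comparison H adj).IsEquivalence :=
  have := p.reflectsIsomorphisms H adj
  have := p.preservesFiniteColimits H adj
  have : Monad.PreservesColimitOfIsReflexivePair H := ⟨fun _ _ _ _ _ => inferInstance⟩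
  (Monad.monadicOfHasPreservesReflexiveCoequalizersOfReflectsIsomorphisms adj).eqv

instance : (p.comparison H adj).Additive :=
  have := adj.right_adjoint_additive
  ⟨fun {_ _ _ _} => Monad.Algebra.Hom.ext H.map_add⟩

instance : (p.comparison H adj).Linear k :=
  have := adj.right_adjoint_additive
  have := linear_rightAdjoint adj
  ⟨fun _ _ => Monad.Algebra.Hom.ext (H.map_smul _ _)⟩

/-- The canonical presentation of an object of `M` is a coequalizer. -/
def counitIsColimit (Y : p.M) : IsColimit (Monad.MonadicityInternal.counitCofork adj Y) :=
  have := p.reflectsIsomorphisms H adj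
  have := p.preservesFiniteColimits H adj
  have := reflectsColimit_of_reflectsIsomorphisms (parallelPair
    ((actionRight C p.X).map (H.map (adj.counit.app Y)))
      (adj.counit.app ((actionRight C p.X).obj (H.obj Y)))) H
  Monad.MonadicityInternal.counitCoequalizerOfReflectsCoequalizer adj Y

-- The comparison functor is an equivalence, so only targets `H Z` have to be tested; there the
-- claim is the descent along the canonical presentation.
open RightExactLaxModuleMonad in
theorem isUniversal_laxMate (V : C) (Y : p.M) :
    IsUniversal (T := p.internalHomMonad H adj) V ((p.comparison H adj).obj Y)
      ((p.comparison H adj).obj (V ⊙ₗ Y)) (laxMate adj V Y) :=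
    have := p.prop.rightExact.actionLeft V
    .of_isEquivalence (p.comparison H adj) (laxMate_linear adj V Y)
      (fun Z f hf => by
        obtain ⟨g, hg⟩ := exists_laxMate_fac (V := V) (Y := Y) (Z := Z) adj
          (p.counitIsColimit H adj Y) f hf
        exact ⟨(p.comparison H adj).map g, hg⟩)
      (fun Z g h e => by
        obtain ⟨g, rfl⟩ := (p.comparison H adj).map_surjective g
        obtain ⟨h, rfl⟩ := (p.comparison H adj).map_surjective h
        exact congrArg _ (laxMate_hom_ext adj (p.counitIsColimit H adj Y) e))

/-- The mates are universal linear morphisms. -/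
def universalFunctor :
    (p.internalHomMonad H adj).UniversalFunctor (p.comparison H adj) :=
  letI := rightAdjointLax (C := C) adj
  { univ V Y := laxMate adj V Y
    isUniversal := p.isUniversal_laxMate H adj
    left f Y := (μₗ_naturality_left H f Y).symm
    right V _ _ g := (μₗ_naturality_right H V g).symm
    unitor Y := (μₗ_unitality (C := C) H Y).symm
    associator V W Y := μₗ_associativity H V W Y }

end ProjectivePair

end Comparison

section

variable {k : Type w} [Field k] {C : Type u} [Category.{v} C] [Abelian C] [Linear k C]
  [MonoidalCategory C] [MonoidalPreadditive C] [MonoidalLinear k C]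

theorem ProjectivePair.equivalent_internalHomMonad [EnoughProjectives C]
    (p : ProjectivePair.{v, max u v} k C) (H : p.M ⥤ C) (adj : actionRight C p.X ⊣ H)
    (L : (p.internalHomMonad H adj).LintonAction) : p.M.Equivalent L.toModuleCategory :=
  letI := L.action
  ⟨p.comparison H adj, inferInstanceAs (p.comparison H adj).IsEquivalence,
    inferInstanceAs (p.comparison H adj).Additive,
    inferInstanceAs ((p.comparison H adj).Linear k),
    ⟨L.universalAction.leftLinear (p.universalFunctor H adj)⟩⟩

/-- Both structures carry universal morphisms for the same linear morphisms, so their comparison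
makes the identity functor strong. -/
theorem RightExactLaxModuleMonad.LintonAction.equivalent {T : RightExactLaxModuleMonad k C}
    (L L' : T.LintonAction) : L.toModuleCategory.Equivalent L'.toModuleCategory :=
  letI := L.action
  let S := L.universalAction.idFunctor
  let hF := @UniversalAction.leftLinear _ _ _ _ _ _ _ T L'.action L'.universalAction T.EM _ L.action
    (𝟭 T.EM) S
  ⟨𝟭 T.EM, inferInstanceAs (𝟭 T.EM).IsEquivalence, inferInstanceAs (𝟭 T.EM).Additive,
    inferInstanceAs ((𝟭 T.EM).Linear k), ⟨hF⟩⟩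

end

end ModuleReconstruction
end
-- The bijection between pairs and monads.
noncomputable section
namespace ModuleReconstruction

variable {k : Type w} [Field k] {C : Type u} [Category.{v} C] [Abelian C] [Linear k C]
  [MonoidalCategory C]

theorem ProjectivePair.equivalence :
    _root_.Equivalence (ProjectivePair.Equivalent : ProjectivePair.{v', u'} k C → _ → Prop) :=
  AbelianModuleCategory.equivalence.comap ProjectivePair.M

variable [MonoidalPreadditive C] [MonoidalLinear k C]

section

variable [RightExactAction C C]

/-- The relation asserts that Linton structures exist, so reflexivity uses the construction.
Transitivity uses uniqueness to pass between the two structures on the middle monad. -/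
theorem RightExactLaxModuleMonad.equivalence :
    _root_.Equivalence
      (RightExactLaxModuleMonad.Equivalent : RightExactLaxModuleMonad k C → _ → Prop) where
  refl _ := ⟨univLintonAction, univLintonAction, AbelianModuleCategory.equivalence.refl _⟩
  symm := fun ⟨L, L', h⟩ => ⟨L', L, AbelianModuleCategory.equivalence.symm h⟩
  trans := fun ⟨L, L', h⟩ ⟨K, K', h'⟩ => ⟨L, K', AbelianModuleCategory.equivalence.trans
    (AbelianModuleCategory.equivalence.trans h (L'.equivalent K)) h'⟩

variable [EnoughProjectives C]

theorem ProjectivePair.internalHomMonad_equivalent {p q : ProjectivePair.{v, max u v} k C}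
    (h : p.Equivalent q) (H : p.M ⥤ C) (adj : actionRight C p.X ⊣ H) (H' : q.M ⥤ C)
    (adj' : actionRight C q.X ⊣ H') :
    (p.internalHomMonad H adj).Equivalent (q.internalHomMonad H' adj') :=
  ⟨RightExactLaxModuleMonad.univLintonAction, RightExactLaxModuleMonad.univLintonAction,
    AbelianModuleCategory.equivalence.trans
      (AbelianModuleCategory.equivalence.symm (p.equivalent_internalHomMonad H adj _))
      (AbelianModuleCategory.equivalence.trans h (q.equivalent_internalHomMonad H' adj' _))⟩

/-- The monad `[X, - ▷ X]` of a pair, for a chosen right adjoint `[X, -]`. -/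
def ProjectivePair.monad (p : ProjectivePair.{v, max u v} k C) : RightExactLaxModuleMonad k C :=
  have : (actionRight C p.X).IsLeftAdjoint := p.prop.closed
  p.internalHomMonad _ (Adjunction.ofIsLeftAdjoint (actionRight C p.X))

/-- The pair `(EM(T), T(𝟙))` of a monad. -/
def RightExactLaxModuleMonad.LintonAction.pair {T : RightExactLaxModuleMonad k C}
    (L : T.LintonAction) : ProjectivePair.{v, max u v} k C :=
  ⟨L.toModuleCategory, L.freeUnit, isProjectiveReconstruction L⟩

theorem RightExactLaxModuleMonad.LintonAction.pair_equivalent {T S : RightExactLaxModuleMonad k C}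
    (h : T.Equivalent S) (L : T.LintonAction) (L' : S.LintonAction) :
    L.pair.Equivalent L'.pair :=
  let ⟨_, _, h⟩ := h
  AbelianModuleCategory.equivalence.trans (L.equivalent _)
    (AbelianModuleCategory.equivalence.trans h (LintonAction.equivalent _ L'))

/-- The bijection between pairs and monads up to equivalence. -/
def pairEquivMonad :
    Quot (ProjectivePair.Equivalent : ProjectivePair.{v, max u v} k C → _ → Prop) ≃
      Quot (RightExactLaxModuleMonad.Equivalent : RightExactLaxModuleMonad k C → _ → Prop) where
  toFun := Quot.map ProjectivePair.monad fun _ _ h =>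
    ProjectivePair.internalHomMonad_equivalent h _ _ _ _
  invFun := Quot.map
    (fun T => (RightExactLaxModuleMonad.univLintonAction : T.LintonAction).pair)
    fun _ _ h => RightExactLaxModuleMonad.LintonAction.pair_equivalent h _ _
  left_inv := by
    rintro ⟨p⟩
    exact Quot.sound
      (AbelianModuleCategory.equivalence.symm (p.equivalent_internalHomMonad _ _ _))
  -- The equivalence of a pair with the Eilenberg-Moore category of its monad, applied to `(EM(T),
  -- T(𝟙))`, already relates the two monads.
  right_inv := by
    rintro ⟨T⟩
    let L : T.LintonAction := RightExactLaxModuleMonad.univLintonAction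
    exact Quot.sound ⟨RightExactLaxModuleMonad.univLintonAction, L,
      AbelianModuleCategory.equivalence.symm (L.pair.equivalent_internalHomMonad _ _ _)⟩

end

theorem projective_reconstruction [EnoughProjectives C] (_ : RightExactAction C C) :
    (∀ T : RightExactLaxModuleMonad k C,
      Nonempty T.LintonAction ∧
      (∀ L : T.LintonAction, L.toModuleCategory.IsProjectiveReconstruction L.freeUnit) ∧
      (∀ L L' : T.LintonAction, L.toModuleCategory.Equivalent L'.toModuleCategory)) ∧
    _root_.Equivalence
      (ProjectivePair.Equivalent : ProjectivePair.{v, max u v} k C → _ → Prop) ∧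
    _root_.Equivalence
      (RightExactLaxModuleMonad.Equivalent : RightExactLaxModuleMonad k C → _ → Prop) ∧
    ∃ e : Quot (ProjectivePair.Equivalent : ProjectivePair.{v, max u v} k C → _ → Prop) ≃
        Quot (RightExactLaxModuleMonad.Equivalent : RightExactLaxModuleMonad k C → _ → Prop),
      (∀ (p : ProjectivePair.{v, max u v} k C) (H : p.M ⥤ C) (adj : actionRight C p.X ⊣ H),
        e (Quot.mk _ p) = Quot.mk _ (p.internalHomMonad H adj)) ∧
      (∀ (T : RightExactLaxModuleMonad k C) (L : T.LintonAction),
        ∃ h : L.toModuleCategory.IsProjectiveReconstruction L.freeUnit,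
          e.symm (Quot.mk _ T) = Quot.mk _ ⟨L.toModuleCategory, L.freeUnit, h⟩) :=
  ⟨fun _ => ⟨⟨RightExactLaxModuleMonad.univLintonAction⟩,
      RightExactLaxModuleMonad.isProjectiveReconstruction, fun L L' => L.equivalent L'⟩,
    ProjectivePair.equivalence, RightExactLaxModuleMonad.equivalence, pairEquivMonad,
    -- The class does not depend on the chosen right adjoint: both monads have Eilenberg-Moore
    -- category equivalent to `p.M`.
    fun p _ _ => Quot.sound (ProjectivePair.internalHomMonad_equivalent
      (ProjectivePair.equivalence.refl p) _ _ _ _),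
    fun T L => ⟨RightExactLaxModuleMonad.isProjectiveReconstruction L,
      Quot.sound (RightExactLaxModuleMonad.LintonAction.pair_equivalent
        (RightExactLaxModuleMonad.equivalence.refl T) _ L)⟩⟩

end ModuleReconstruction
end
-- Colinear morphisms over an oplax module comonad and their universal property.
noncomputable section
namespace ModuleReconstruction

variable {k : Type w} [Field k] {C : Type u} [Category.{v} C] [Abelian C] [Linear k C]
  [MonoidalCategory C]

namespace LeftExactOplaxModuleComonad

variable (G : LeftExactOplaxModuleComonad k C)

/-- The costrength `G (V ⊗ X) ⟶ V ⊗ G X` of an oplax module comonad. -/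
def costr (V X : C) : G.obj (V ⊗ X) ⟶ V ⊗ G.obj X := G.oplax.δₗ V X

theorem costr_naturality_left {V W : C} (f : V ⟶ W) (X : C) :
    G.map (f ▷ X) ≫ G.costr W X = G.costr V X ≫ f ▷ G.obj X :=
  G.oplax.δₗ_naturality_left f X

theorem costr_naturality_right (V : C) {X Y : C} (f : X ⟶ Y) :
    G.map (V ◁ f) ≫ G.costr V Y = G.costr V X ≫ V ◁ G.map f :=
  G.oplax.δₗ_naturality_right V f

theorem costr_associativity (V W X : C) :
    G.costr (V ⊗ W) X ≫ (α_ V W (G.obj X)).hom =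
      G.map (α_ V W X).hom ≫ G.costr V (W ⊗ X) ≫ V ◁ G.costr W X :=
  G.oplax.δₗ_associativity V W X

/-- Universal colinear morphisms go out of `V ▶ A`, so their composites end in the inverse
associator. -/
theorem costr_associativity_inv (V W X : C) :
    G.map (α_ V W X).inv ≫ G.costr (V ⊗ W) X =
      G.costr V (W ⊗ X) ≫ V ◁ G.costr W X ≫ (α_ V W (G.obj X)).inv := by
  rw [← cancel_mono (α_ V W (G.obj X)).hom, assoc, G.costr_associativity,
    ← Functor.map_comp_assoc]
  simp

theorem costr_unitality (X : C) :
    G.map (λ_ X).inv ≫ G.costr (𝟙_ C) X = (λ_ (G.obj X)).inv :=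
  (G.oplax.δₗ_unitality_inv X).symm

theorem costr_ε (V X : C) : G.costr V X ≫ V ◁ G.ε.app X = G.ε.app (V ⊗ X) :=
  G.oplax_ε V X

theorem costr_δ (V X : C) : G.costr V X ≫ V ◁ G.δ.app X =
    G.δ.app (V ⊗ X) ≫ G.map (G.costr V X) ≫ G.costr V (G.obj X) :=
  G.oplax_δ V X

theorem ε_naturality {X Y : C} (f : X ⟶ Y) :
    G.map f ≫ G.ε.app Y = G.ε.app X ≫ f :=
  G.ε.naturality f

theorem δ_naturality {X Y : C} (f : X ⟶ Y) :
    G.map f ≫ G.δ.app Y = G.δ.app X ≫ G.map (G.map f) :=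
  G.δ.naturality f

variable {G}

/-- The underlying morphism of a morphism into a cofree comodule. -/
def under {X : C} {B : G.EM} (f : B ⟶ G.toComonad.cofree.obj X) : B.A ⟶ G.obj X := f.f

/-- The corestriction of a morphism into a cofree comodule along the counit. -/
def res {X : C} {B : G.EM} (f : B ⟶ G.toComonad.cofree.obj X) : B.A ⟶ X := under f ≫ G.ε.app X

/-- The morphism of comodules `B ⟶ G X` extending `f : B ⟶ X`. -/
def ext {X : C} {B : G.EM} (f : B.A ⟶ X) : B ⟶ G.toComonad.cofree.obj X where
  f := B.a ≫ G.map f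
  h := by
    change B.a ≫ G.map (B.a ≫ G.map f) = (B.a ≫ G.map f) ≫ G.δ.app X
    rw [Functor.map_comp, assoc, G.δ_naturality, ← B.coassoc_assoc]

theorem under_map {X : C} {B : G.EM} (f : B ⟶ G.toComonad.cofree.obj X) :
    B.a ≫ G.map (under f) = under f ≫ G.δ.app X := f.h

theorem under_ext {X : C} {B : G.EM} (f : B.A ⟶ X) : under (ext f) = B.a ≫ G.map f := rfl

@[simp]
theorem res_comp {X : C} {B B' : G.EM} (f : B' ⟶ G.toComonad.cofree.obj X) (g : B ⟶ B') :
    res (g ≫ f) = g.f ≫ res f :=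
  assoc _ _ _

@[simp]
theorem res_ext {X : C} {B : G.EM} (f : B.A ⟶ X) : res (ext f) = f := by
  rw [res, under_ext, assoc, G.ε_naturality, B.counit_assoc]

theorem under_eq {X : C} {B : G.EM} (f : B ⟶ G.toComonad.cofree.obj X) :
    under f = B.a ≫ G.map (res f) := by
  rw [res, Functor.map_comp, ← assoc, under_map, assoc]
  exact ((congrArg (under f ≫ ·) (G.toComonad.right_counit X)).trans (comp_id _)).symm

theorem ext_res {X : C} {B : G.EM} (f : B ⟶ G.toComonad.cofree.obj X) : ext (res f) = f :=
  Comonad.Coalgebra.Hom.ext (under_eq f).symm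

theorem cofree_hom_ext {X : C} {B : G.EM} {f g : B ⟶ G.toComonad.cofree.obj X}
    (h : res f = res g) : f = g := by
  rw [← ext_res f, ← ext_res g, h]

theorem under_comp_map {X Y : C} {B : G.EM} (g : X ⟶ Y) (f : B ⟶ G.toComonad.cofree.obj X) :
    under (f ≫ G.toComonad.cofree.map g) = under f ≫ G.map g := rfl

@[simp]
theorem res_comp_map {X Y : C} {B : G.EM} (g : X ⟶ Y) (f : B ⟶ G.toComonad.cofree.obj X) :
    res (f ≫ G.toComonad.cofree.map g) = res f ≫ g := by
  rw [res, under_comp_map, assoc, G.ε_naturality, res, assoc]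

theorem res_comp_lintonMap {V : C} {A B : G.EM} (f : B ⟶ G.toComonad.cofree.obj (V ⊗ A.A)) :
    res (f ≫ G.lintonMap V A) = under f ≫ G.costr V A.A := by
  change (under f ≫ G.δ.app (V ⊗ A.A) ≫ G.map (G.costr V A.A)) ≫ G.ε.app _ = _
  rw [assoc, assoc]
  refine congrArg _ ((congrArg _ (G.ε_naturality _)).trans ?_)
  exact (assoc _ _ _).symm.trans
    ((congrArg (· ≫ _) (G.toComonad.left_counit _)).trans (id_comp _))

/-- A morphism `B ⟶ V ⊗ A` between `G`-comodules `A` and `B` which is `G`-colinear in `A`. -/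
def IsColinear (V : C) (A B : G.EM) (f : B.A ⟶ V ⊗ A.A) : Prop :=
  f ≫ V ◁ A.a = B.a ≫ G.map f ≫ G.costr V A.A

namespace IsColinear

variable {V W : C} {A A' B B' : G.EM}

theorem hom_comp {f : B.A ⟶ V ⊗ A.A} (hf : IsColinear V A B f) (h : B' ⟶ B) :
    IsColinear V A B' (h.f ≫ f) := by
  unfold IsColinear at hf ⊢
  rw [assoc, hf, Functor.map_comp, assoc, h.h_assoc]

theorem comp_whiskerLeft {f : B.A ⟶ V ⊗ A.A} (hf : IsColinear V A B f) (g : A ⟶ A') :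
    IsColinear V A' B (f ≫ V ◁ g.f) := by
  unfold IsColinear at hf ⊢
  rw [assoc, ← MonoidalCategory.whiskerLeft_comp, ← g.h, MonoidalCategory.whiskerLeft_comp,
    reassoc_of% hf, Functor.map_comp, assoc, G.costr_naturality_right]

theorem comp_whiskerRight {f : B.A ⟶ V ⊗ A.A} (hf : IsColinear V A B f) (g : V ⟶ W) :
    IsColinear W A B (f ≫ g ▷ A.A) := by
  unfold IsColinear at hf ⊢
  rw [assoc, ← whisker_exchange, reassoc_of% hf, Functor.map_comp, assoc, G.costr_naturality_left]

theorem leftUnitor (A : G.EM) : IsColinear (𝟙_ C) A A (λ_ A.A).inv := by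
  unfold IsColinear
  rw [G.costr_unitality]
  exact (leftUnitor_inv_naturality A.a).symm

theorem comp {f : B'.A ⟶ V ⊗ B.A} (hf : IsColinear V B B' f) {g : B.A ⟶ W ⊗ A.A}
    (hg : IsColinear W A B g) :
    IsColinear (V ⊗ W) A B' (f ≫ V ◁ g ≫ (α_ V W A.A).inv) := by
  unfold IsColinear at hf hg ⊢
  rw [Functor.map_comp, Functor.map_comp, assoc, assoc, assoc, assoc, G.costr_associativity_inv,
    reassoc_of% G.costr_naturality_right, ← reassoc_of% hf, ← associator_inv_naturality_right,
    ← MonoidalCategory.whiskerLeft_comp_assoc, hg]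
  simp only [MonoidalCategory.whiskerLeft_comp, assoc]

theorem costr (V W : C) :
    IsColinear V (G.toComonad.cofree.obj W) (G.toComonad.cofree.obj (V ⊗ W)) (G.costr V W) :=
  G.costr_δ V W

end IsColinear

/-- Morphisms into a cofree comodule are determined by their corestriction along `ε`, which turns
the Linton pair into the two sides of colinearity. -/
theorem isColinear_iff {V : C} {A B : G.EM} (g : B ⟶ G.toComonad.cofree.obj (V ⊗ A.A)) :
    IsColinear V A B (res g) ↔
      g ≫ G.toComonad.cofree.map (V ◁ A.a) = g ≫ G.lintonMap V A := by
  unfold IsColinear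
  rw [← assoc, ← under_eq, ← res_comp_lintonMap, ← res_comp_map]
  exact ⟨cofree_hom_ext, congrArg res⟩

theorem IsColinear.ext_comp_map {V : C} {A B : G.EM} {f : B.A ⟶ V ⊗ A.A}
    (hf : IsColinear V A B f) :
    ext f ≫ G.toComonad.cofree.map (V ◁ A.a) = ext f ≫ G.lintonMap V A :=
  (isColinear_iff _).1 (by rwa [res_ext])

/-- A `G`-colinear morphism `E ⟶ V ⊗ A` through which every colinear morphism factors uniquely. -/
structure IsUniversal (V : C) (A E : G.EM) (u : E.A ⟶ V ⊗ A.A) : Prop where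
  isColinear : IsColinear V A E u
  exists_fac {B : G.EM} (f : B.A ⟶ V ⊗ A.A) (hf : IsColinear V A B f) :
    ∃ h : B ⟶ E, h.f ≫ u = f
  hom_ext {B : G.EM} {g h : B ⟶ E} (e : g.f ≫ u = h.f ≫ u) : g = h

namespace IsUniversal

variable {V : C} {A E : G.EM} {u : E.A ⟶ V ⊗ A.A} (hu : IsUniversal V A E u)

/-- The morphism of comodules induced by a colinear morphism. -/
def lift {B : G.EM} (f : B.A ⟶ V ⊗ A.A) (hf : IsColinear V A B f) : B ⟶ E :=
  (hu.exists_fac f hf).choose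

theorem fac {B : G.EM} (f : B.A ⟶ V ⊗ A.A) (hf : IsColinear V A B f) :
    (hu.lift f hf).f ≫ u = f :=
  (hu.exists_fac f hf).choose_spec

include hu in
theorem condition : ext u ≫ G.toComonad.cofree.map (V ◁ A.a) = ext u ≫ G.lintonMap V A :=
  hu.isColinear.ext_comp_map

/-- The equalizer fork of a universal colinear morphism. -/
def isLimit : IsLimit (Fork.ofι (ext u) hu.condition) :=
  Fork.IsLimit.mk' _ fun s => by
    refine ⟨hu.lift _ ((isColinear_iff s.ι).2 s.condition), cofree_hom_ext ?_,
      fun {m} hm => hu.hom_ext ?_⟩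
    · rw [Fork.ι_ofι, res_comp, res_ext, hu.fac]
    · rw [hu.fac, ← hm, Fork.ι_ofι, res_comp, res_ext]

include hu in
theorem mono_ext : Mono (ext u) := Fork.IsLimit.mono hu.isLimit

variable {E' : G.EM} {u' : E'.A ⟶ V ⊗ A.A} (hu' : IsUniversal V A E' u')

/-- Two universal colinear morphisms have isomorphic sources. -/
def iso : E ≅ E' where
  hom := hu'.lift u hu.isColinear
  inv := hu.lift u' hu'.isColinear
  hom_inv_id := hu.hom_ext (by
    refine (assoc _ _ _).trans ((congrArg _ (hu.fac u' hu'.isColinear)).trans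
      ((hu'.fac u hu.isColinear).trans ?_))
    exact (id_comp u).symm)
  inv_hom_id := hu'.hom_ext (by
    refine (assoc _ _ _).trans ((congrArg _ (hu'.fac u hu.isColinear)).trans
      ((hu.fac u' hu'.isColinear).trans ?_))
    exact (id_comp u').symm)

include hu hu' in
theorem isIso_of_comp_eq {h : E' ⟶ E} (e : h.f ≫ u = u') : IsIso h := by
  have : h = (hu.iso hu').inv := hu.hom_ext (e.trans (hu.fac u' hu'.isColinear).symm)
  rw [this]
  infer_instance

end IsUniversal

/-- A colinear `f` into `V ⊗ G W` is rebuilt from `f ≫ V ◁ ε`, by colinearity and `δ ≫ G ε = 𝟙`. -/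
theorem isUniversal_costr (V W : C) :
    IsUniversal V (G.toComonad.cofree.obj W) (G.toComonad.cofree.obj (V ⊗ W)) (G.costr V W) where
  isColinear := IsColinear.costr V W
  exists_fac {B} (f : B.A ⟶ V ⊗ G.obj W) (hf : f ≫ V ◁ G.δ.app W = _) :=
    ⟨ext (f ≫ V ◁ G.ε.app W), by
      change (B.a ≫ G.map (f ≫ V ◁ G.ε.app W)) ≫ G.costr V W = f
      rw [Functor.map_comp, assoc, assoc]
      refine (congrArg (B.a ≫ G.map f ≫ ·) (G.costr_naturality_right V (G.ε.app W))).trans ?_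
      refine ((assoc _ _ _).symm.trans (assoc _ _ _).symm).trans ?_
      refine (congrArg (· ≫ V ◁ G.map (G.ε.app W)) ((assoc _ _ _).trans (Eq.symm hf))).trans ?_
      rw [assoc, ← MonoidalCategory.whiskerLeft_comp]
      refine (congrArg (fun t => f ≫ V ◁ t) (G.toComonad.right_counit W)).trans ?_
      rw [MonoidalCategory.whiskerLeft_id, comp_id]⟩
  hom_ext {B g h} (e : under g ≫ G.costr V W = under h ≫ G.costr V W) := cofree_hom_ext (by
    rw [res, res, ← G.costr_ε, ← assoc, ← assoc, e])

theorem isUniversal_res {V : C} {A E : G.EM} (ι : E ⟶ G.toComonad.cofree.obj (V ⊗ A.A))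
    (condition : ι ≫ G.toComonad.cofree.map (V ◁ A.a) = ι ≫ G.lintonMap V A)
    (h : IsLimit (Fork.ofι ι condition)) : IsUniversal V A E (res ι) where
  isColinear := (isColinear_iff ι).2 condition
  exists_fac f hf := ⟨Fork.IsLimit.lift h (ext f) hf.ext_comp_map, by
    rw [← res_comp]
    exact (congrArg res (Fork.IsLimit.lift_ι' h (ext f) hf.ext_comp_map)).trans (res_ext f)⟩
  hom_ext e := Fork.IsLimit.hom_ext h (cofree_hom_ext (by
    rwa [Fork.ι_ofι, res_comp, res_comp]))

theorem exists_isUniversal (V : C) (A : G.EM) :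
    ∃ (E : G.EM) (u : E.A ⟶ V ⊗ A.A), IsUniversal V A E u :=
  ⟨_, _, isUniversal_res _ _
    (equalizerIsEqualizer (G.toComonad.cofree.map (V ◁ A.a)) (G.lintonMap V A))⟩

end LeftExactOplaxModuleComonad

end ModuleReconstruction
end
-- Composition of universal colinear morphisms and the Linton action on comodules.
noncomputable section
namespace ModuleReconstruction

variable {k : Type w} [Field k] {C : Type u} [Category.{v} C] [Abelian C] [Linear k C]
  [MonoidalCategory C]

namespace LeftExactOplaxModuleComonad

variable {G : LeftExactOplaxModuleComonad k C}

theorem isUniversal_leftUnitor (A : G.EM) : IsUniversal (𝟙_ C) A A (λ_ A.A).inv where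
  isColinear := IsColinear.leftUnitor A
  exists_fac {B} f hf := ⟨⟨f ≫ (λ_ A.A).hom, by
    rw [assoc, ← leftUnitor_naturality, reassoc_of% hf, Functor.map_comp,
      ← cancel_mono (λ_ _).inv]
    simp only [assoc, Iso.hom_inv_id, comp_id]
    rw [← G.costr_unitality, ← Functor.map_comp_assoc G.toFunctor (λ_ A.A).hom, Iso.hom_inv_id,
      CategoryTheory.Functor.map_id, id_comp]⟩, by
    rw [assoc, Iso.hom_inv_id, comp_id]⟩
  hom_ext e := Comonad.Coalgebra.Hom.ext ((cancel_mono _).1 e)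

instance : PreservesFiniteLimits G.toComonad.forget := ⟨fun _ _ _ => inferInstance⟩

section

variable {V W : C} [PreservesFiniteLimits (actionLeft C V)] {A E B : G.EM}
  {u : E.A ⟶ W ⊗ A.A}

theorem IsUniversal.whiskerLeft_hom_ext (hu : IsUniversal W A E u) {g g' : B.A ⟶ V ⊗ E.A}
    (hg : IsColinear V E B g) (hg' : IsColinear V E B g') (e : g ≫ V ◁ u = g' ≫ V ◁ u) :
    g = g' := by
  have := hu.mono_ext
  have : Mono (V ◁ under (ext u)) :=
    inferInstanceAs (Mono ((actionLeft C V).map (G.toComonad.forget.map (ext u))))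
  rw [← cancel_mono (V ◁ under (ext u))]
  have key {g : B.A ⟶ V ⊗ E.A} (hg : IsColinear V E B g) :
      g ≫ V ◁ under (ext u) = B.a ≫ G.map (g ≫ V ◁ u) ≫ G.costr V _ := by
    rw [under_ext, MonoidalCategory.whiskerLeft_comp, reassoc_of% hg, Functor.map_comp, assoc,
      G.costr_naturality_right]
  rw [key hg, key hg', e]

/-- `V ⊗ -` preserves the equalizer defining `E`, so `f` is first lifted to a colinear morphism into
`V ⊗ G (W ⊗ A)`, which is shown to equalize the image of the Linton pair. -/
theorem IsUniversal.exists_whiskerLeft_fac (hu : IsUniversal W A E u)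
    (f : B.A ⟶ V ⊗ W ⊗ A.A) (hf : IsColinear (V ⊗ W) A B (f ≫ (α_ V W A.A).inv)) :
    ∃ g : B.A ⟶ V ⊗ E.A, IsColinear V E B g ∧ g ≫ V ◁ u = f := by
  let fh : B.A ⟶ V ⊗ G.obj (W ⊗ A.A) := B.a ≫ G.map f ≫ G.costr V _
  have hfh : fh ≫ V ◁ G.δ.app (W ⊗ A.A) = B.a ≫ G.map fh ≫ G.costr V _ := by
    have h := (IsColinear.costr V (W ⊗ A.A)).hom_comp (ext f)
    have e : (ext f).f ≫ G.costr V (W ⊗ A.A) = fh := assoc _ _ _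
    have h' : ((ext f).f ≫ G.costr V (W ⊗ A.A)) ≫ V ◁ G.δ.app (W ⊗ A.A) =
      B.a ≫ G.map ((ext f).f ≫ G.costr V (W ⊗ A.A)) ≫ G.costr V _ := h
    rwa [e] at h'
  have h1 : f ≫ V ◁ W ◁ A.a = fh ≫ V ◁ G.costr W A.A := by
    rw [← cancel_mono (α_ V W _).inv, assoc, associator_inv_naturality_right, ← assoc]
    refine hf.trans ?_
    rw [Functor.map_comp, assoc, G.costr_associativity_inv]
    simp only [fh, assoc]
  have h2 : fh ≫ V ◁ G.map (W ◁ A.a) =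
      fh ≫ V ◁ (G.δ.app (W ⊗ A.A) ≫ G.map (G.costr W A.A)) := by
    rw [MonoidalCategory.whiskerLeft_comp, reassoc_of% hfh, ← G.costr_naturality_right,
      ← Functor.map_comp_assoc, ← h1]
    dsimp only [fh]
    rw [assoc, assoc, ← G.costr_naturality_right, ← Functor.map_comp_assoc]
  let F := G.toComonad.forget ⋙ actionLeft C V
  have hF := isLimitForkMapOfIsLimit F hu.condition hu.isLimit
  let g : B.A ⟶ V ⊗ E.A := Fork.IsLimit.lift hF fh h2
  have hg : g ≫ V ◁ under (ext u) = fh := Fork.IsLimit.lift_ι' hF fh h2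
  have := hu.mono_ext
  have : Mono (V ◁ G.map (under (ext u))) :=
    inferInstanceAs (Mono ((actionLeft C V).map (G.map (G.toComonad.forget.map (ext u)))))
  refine ⟨g, ?_, ?_⟩
  · unfold IsColinear
    rw [← cancel_mono (V ◁ G.map (under (ext u))), assoc, ← MonoidalCategory.whiskerLeft_comp,
      under_map, MonoidalCategory.whiskerLeft_comp, reassoc_of% hg, hfh, assoc, assoc,
      ← G.costr_naturality_right, ← Functor.map_comp_assoc, hg]
  · have hw : u = under (ext u) ≫ G.ε.app _ := (res_ext u).symm
    rw [hw, MonoidalCategory.whiskerLeft_comp, reassoc_of% hg]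
    dsimp only [fh]
    rw [assoc, assoc, G.costr_ε, ← assoc]
    exact res_ext f

/-- Composites of universal colinear morphisms are universal. -/
theorem IsUniversal.comp (hu : IsUniversal W A E u) {F : G.EM} {u' : F.A ⟶ V ⊗ E.A}
    (hu' : IsUniversal V E F u') :
    IsUniversal (V ⊗ W) A F (u' ≫ V ◁ u ≫ (α_ V W A.A).inv) where
  isColinear := hu'.isColinear.comp hu.isColinear
  exists_fac f hf := by
    obtain ⟨g, hg, e⟩ := hu.exists_whiskerLeft_fac (f ≫ (α_ V W A.A).hom)
      (by rwa [assoc, Iso.hom_inv_id, comp_id])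
    obtain ⟨h, rfl⟩ := hu'.exists_fac g hg
    exact ⟨h, by rw [← assoc, ← assoc, e, assoc, Iso.hom_inv_id, comp_id]⟩
  hom_ext {B g h} e := by
    simp only [← assoc, cancel_mono] at e
    exact hu'.hom_ext (hu.whiskerLeft_hom_ext (hu'.isColinear.hom_comp g)
      (hu'.isColinear.hom_comp h) e)

end

theorem unit_f (A : G.EM) : (G.toComonad.adj.unit.app A).f = A.a := by
  simp only [Comonad.adj, Adjunction.mkOfHomEquiv_unit_app]
  exact (congrArg (A.a ≫ ·) (G.toFunctor.map_id A.A)).trans (comp_id _)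

theorem res_unit (A : G.EM) : res (B := A) (G.toComonad.adj.unit.app A) = 𝟙 A.A :=
  (congrArg (· ≫ G.ε.app A.A) (unit_f A)).trans A.counit

section Construction

/-- The action of an object on a comodule. -/
def actObj (V : C) (A : G.EM) : G.EM := (exists_isUniversal V A).choose

/-- The universal colinear morphism from the action of an object on a comodule. -/
def actUniv (V : C) (A : G.EM) : (actObj V A).A ⟶ V ⊗ A.A :=
  (exists_isUniversal V A).choose_spec.choose

theorem isUniversal_actUniv (V : C) (A : G.EM) : IsUniversal V A (actObj V A) (actUniv V A) :=
  (exists_isUniversal V A).choose_spec.choose_spec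

/-- The action of a morphism of `C` on a comodule. -/
def actHomLeft {V W : C} (f : V ⟶ W) (A : G.EM) : actObj V A ⟶ actObj W A :=
  (isUniversal_actUniv W A).lift _ ((isUniversal_actUniv V A).isColinear.comp_whiskerRight f)

/-- The action of an object of `C` on a morphism of comodules. -/
def actHomRight (V : C) {A B : G.EM} (g : A ⟶ B) : actObj V A ⟶ actObj V B :=
  (isUniversal_actUniv V B).lift _ ((isUniversal_actUniv V A).isColinear.comp_whiskerLeft g)

/-- The unit isomorphism of the action. -/
def actUnitor (A : G.EM) : actObj (𝟙_ C) A ≅ A :=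
  (isUniversal_actUniv _ A).iso (isUniversal_leftUnitor A)

theorem left_actUniv {V W : C} (f : V ⟶ W) (A : G.EM) :
    (actHomLeft f A).f ≫ actUniv W A = actUniv V A ≫ f ▷ A.A :=
  (isUniversal_actUniv W A).fac _ _

theorem right_actUniv (V : C) {A B : G.EM} (g : A ⟶ B) :
    (actHomRight V g).f ≫ actUniv V B = actUniv V A ≫ V ◁ g.f :=
  (isUniversal_actUniv V B).fac _ _

theorem unitor_inv_actUniv (A : G.EM) :
    (actUnitor A).inv.f ≫ actUniv (𝟙_ C) A = (λ_ A.A).inv :=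
  (isUniversal_actUniv _ A).fac _ (IsColinear.leftUnitor A)

/-- The action axioms use the forward unitor, which is a lift along the universal morphism `λ⁻¹`
rather than along `actUniv`. -/
theorem unitor_hom_actUniv (A : G.EM) : (actUnitor A).hom.f = actUniv (𝟙_ C) A ≫ (λ_ A.A).hom := by
  rw [← cancel_mono (λ_ A.A).inv, assoc, Iso.hom_inv_id, comp_id]
  exact (isUniversal_leftUnitor A).fac _ (isUniversal_actUniv (𝟙_ C) A).isColinear

theorem whiskerLeft_left_actUniv (U : C) {V W : C} (f : V ⟶ W) (A : G.EM) :
    U ◁ (actHomLeft f A).f ≫ U ◁ actUniv W A = U ◁ actUniv V A ≫ U ◁ f ▷ A.A := by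
  simp only [← MonoidalCategory.whiskerLeft_comp, left_actUniv]

theorem whiskerLeft_right_actUniv (U V : C) {A B : G.EM} (g : A ⟶ B) :
    U ◁ (actHomRight V g).f ≫ U ◁ actUniv V B = U ◁ actUniv V A ≫ U ◁ V ◁ g.f := by
  simp only [← MonoidalCategory.whiskerLeft_comp, right_actUniv]

variable [h : LeftExactAction C C]

instance (V : C) : PreservesFiniteLimits (actionLeft C V) := h.actionLeft V

/-- The associativity isomorphism of the action. -/
def actAssociator (V W : C) (A : G.EM) : actObj (V ⊗ W) A ≅ actObj V (actObj W A) :=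
  (isUniversal_actUniv _ A).iso ((isUniversal_actUniv W A).comp (isUniversal_actUniv V _))

theorem associator_inv_actUniv (V W : C) (A : G.EM) :
    (actAssociator V W A).inv.f ≫ actUniv (V ⊗ W) A =
      actUniv V (actObj W A) ≫ V ◁ actUniv W A ≫ (α_ V W A.A).inv :=
  (isUniversal_actUniv _ A).fac _
    ((isUniversal_actUniv W A).comp (isUniversal_actUniv V _)).isColinear

theorem associator_hom_actUniv (V W : C) (A : G.EM) :
    (actAssociator V W A).hom.f ≫ actUniv V (actObj W A) ≫ V ◁ actUniv W A =
      actUniv (V ⊗ W) A ≫ (α_ V W A.A).hom := by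
  rw [← cancel_mono (α_ V W A.A).inv, assoc, assoc, assoc, Iso.hom_inv_id, comp_id]
  exact ((isUniversal_actUniv W A).comp (isUniversal_actUniv V _)).fac _
    (isUniversal_actUniv (V ⊗ W) A).isColinear

theorem whiskerLeft_associator_hom_actUniv (U V W : C) (A : G.EM) :
    U ◁ (actAssociator V W A).hom.f ≫ U ◁ actUniv V (actObj W A) ≫ U ◁ V ◁ actUniv W A =
      U ◁ actUniv (V ⊗ W) A ≫ U ◁ (α_ V W A.A).hom := by
  simp only [← MonoidalCategory.whiskerLeft_comp, associator_hom_actUniv]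

variable (G) in
/-- The action of `C` on the comodules over `G` given by universal colinear morphisms. -/
abbrev univAction : MonoidalLeftAction C G.EM where
  actionObj := actObj
  actionHomLeft := actHomLeft
  actionHomRight := actHomRight
  actionAssocIso := actAssociator
  actionUnitIso := actUnitor
  actionHom_def _ _ := rfl
  actionHomRight_id V A := (isUniversal_actUniv V A).hom_ext (by simp [right_actUniv])
  id_actionHomLeft V A := (isUniversal_actUniv V A).hom_ext (by simp [left_actUniv])
  actionHom_comp {_ _ _ _ _ B} _ _ _ _ := (isUniversal_actUniv _ B).hom_ext (by
    simp [right_actUniv, reassoc_of% right_actUniv, reassoc_of% left_actUniv,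
      whisker_exchange_assoc])
  -- The target is an iterated action, so equality is tested against the composite universal
  -- morphism.
  actionAssocIso_hom_naturality {_ _ _ _ _ B} f g h :=
    ((isUniversal_actUniv _ B).comp (isUniversal_actUniv _ _)).hom_ext (by
      simp only [Comonad.Coalgebra.comp_f, assoc, reassoc_of% associator_hom_actUniv,
        reassoc_of% right_actUniv, reassoc_of% left_actUniv, MonoidalCategory.whiskerLeft_comp,
        reassoc_of% whiskerLeft_right_actUniv, reassoc_of% whiskerLeft_left_actUniv,
        Iso.hom_inv_id, comp_id, ← whisker_exchange_assoc f (actUniv _ _)]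
      simp [right_actUniv, reassoc_of% left_actUniv, MonoidalCategory.tensorHom_def])
  actionUnitIso_hom_naturality {_ B} f := Comonad.Coalgebra.Hom.ext (by
    simp [unitor_hom_actUniv, reassoc_of% right_actUniv])
  whiskerLeft_actionHomLeft _ _ _ _ A := (isUniversal_actUniv _ A).hom_ext (by
    simp [left_actUniv, reassoc_of% right_actUniv, associator_inv_actUniv,
      reassoc_of% whiskerLeft_left_actUniv, reassoc_of% associator_hom_actUniv])
  whiskerRight_actionHomLeft _ f A := (isUniversal_actUniv _ A).hom_ext (by
    simp only [Comonad.Coalgebra.comp_f, assoc, left_actUniv, associator_inv_actUniv,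
      reassoc_of% left_actUniv, ← whisker_exchange_assoc f, reassoc_of% associator_hom_actUniv]
    simp)
  associator_actionHom U V W A :=
    (((isUniversal_actUniv W A).comp (isUniversal_actUniv V _)).comp
      (isUniversal_actUniv U _)).hom_ext (by
      -- Here whiskering by `U ⊗ V` is expanded into successive whiskerings, to match the threefold
      -- universal morphism; the remaining identity is the pentagon.
      have h := associator_hom_actUniv (U ⊗ V) W A
      rw [← cancel_mono (α_ _ _ _).hom, assoc, assoc, MonoidalCategory.tensor_whiskerLeft] at h
      simp only [assoc, Iso.inv_hom_id, comp_id] at h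
      simp only [Comonad.Coalgebra.comp_f, assoc, reassoc_of% associator_hom_actUniv,
        reassoc_of% right_actUniv, reassoc_of% left_actUniv, MonoidalCategory.whiskerLeft_comp,
        reassoc_of% whiskerLeft_associator_hom_actUniv, reassoc_of% h]
      simp)
  leftUnitor_actionHom V A := (isUniversal_actUniv _ A).hom_ext (by
    rw [Comonad.Coalgebra.comp_f, assoc, left_actUniv, unitor_hom_actUniv, assoc,
      ← leftUnitor_naturality, reassoc_of% associator_hom_actUniv, leftUnitor_tensor_hom,
      Iso.hom_inv_id_assoc])
  rightUnitor_actionHom V A := (isUniversal_actUniv _ A).hom_ext (by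
    rw [Comonad.Coalgebra.comp_f, assoc, left_actUniv, right_actUniv, unitor_hom_actUniv,
      MonoidalCategory.whiskerLeft_comp, reassoc_of% associator_hom_actUniv, triangle])

/-- The Linton module structure given by universal colinear morphisms. -/
def univLintonAction : G.LintonAction :=
  letI := G.univAction
  { action := G.univAction
    incl V A := ext (actUniv V A)
    condition V A := (isUniversal_actUniv V A).condition
    isLimit V A := ⟨(isUniversal_actUniv V A).isLimit⟩
    naturality_left f A := cofree_hom_ext (by
      rw [res_comp_map, res_comp, res_ext, res_ext]
      exact left_actUniv f A)
    naturality_right V _ _ g := cofree_hom_ext (by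
      rw [res_comp_map, res_comp, res_ext, res_ext]
      exact right_actUniv V g)
    unitality A := cofree_hom_ext (by
      refine (res_comp _ _).trans ((congrArg (_ ≫ ·) (res_ext _)).trans
        ((unitor_inv_actUniv A).trans ?_))
      refine .trans ?_ (res_comp_map (λ_ A.A).inv (G.toComonad.adj.unit.app A)).symm
      exact ((congrArg (· ≫ _) (res_unit A)).trans (id_comp _)).symm)
    associativity V W A := cofree_hom_ext (by
      refine (res_comp _ _).trans ((congrArg (_ ≫ ·) (res_ext _)).trans
        ((associator_inv_actUniv V W A).trans ?_))
      refine .trans ?_ (res_comp_map _ _).symm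
      exact (congrArg₂ (fun s t => t ≫ V ◁ s ≫ _) (res_ext _) (res_ext _)).symm) }

end Construction

end LeftExactOplaxModuleComonad

end ModuleReconstruction
end
-- Strong functors from universal colinear morphisms, left exactness, and the cofree comodule on the
-- unit.
noncomputable section
namespace ModuleReconstruction

section LeftLinear

variable {C : Type*} [Category* C] [MonoidalCategory C]
variable {M : Type*} [Category* M] [MonoidalLeftAction C M]
variable {N : Type*} [Category* N] [MonoidalLeftAction C N]

/-- An oplax module functor with invertible structure morphisms is strong. -/
abbrev leftLinearOfOplax (F : M ⥤ N) [F.OplaxLeftLinear C]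
    (h : ∀ (V : C) (X : M), IsIso (δₗ F V X)) : F.LeftLinear C where
  μₗ V X := inv (δₗ F V X)
  μₗ_naturality_left f X := by
    rw [IsIso.comp_inv_eq, assoc, δₗ_naturality_left, IsIso.inv_hom_id_assoc]
  μₗ_naturality_right V _ _ f := by
    rw [IsIso.comp_inv_eq, assoc, δₗ_naturality_right, IsIso.inv_hom_id_assoc]
  μₗ_associativity V W X := by
    rw [IsIso.inv_comp_eq, ← assoc, δₗ_associativity]
    simp
  μₗ_unitality X := by
    rw [IsIso.eq_inv_comp, δₗ_unitality_hom]
  μₗ_comp_δₗ _ _ := IsIso.inv_hom_id _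
  δₗ_comp_μₗ _ _ := IsIso.hom_inv_id _

end LeftLinear

variable {k : Type w} [Field k] {C : Type u} [Category.{v} C] [Abelian C] [Linear k C]
  [MonoidalCategory C]

namespace LeftExactOplaxModuleComonad

variable (G : LeftExactOplaxModuleComonad k C)

theorem costr_rightUnitor_naturality {V W : C} (f : V ⟶ W) :
    G.map f ≫ G.map (ρ_ W).inv ≫ G.costr W (𝟙_ C) =
      (G.map (ρ_ V).inv ≫ G.costr V (𝟙_ C)) ≫ f ▷ G.obj (𝟙_ C) := by
  rw [← Functor.map_comp_assoc, rightUnitor_inv_naturality, Functor.map_comp_assoc,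
    G.costr_naturality_left, assoc]

-- For a limit cone `p`, the maps `V ◁ G (p j)` are jointly mono by left exactness, so colinearity
-- may be checked on components.
variable {G} in
theorem IsColinear.of_jointly_mono {ι : Type*} {V : C} {A : ι → G.EM} {P B : G.EM}
    (p : ∀ j, P ⟶ A j)
    (hp : ∀ x y : B.A ⟶ V ⊗ G.obj P.A,
      (∀ j, x ≫ V ◁ G.map (p j).f = y ≫ V ◁ G.map (p j).f) → x = y)
    {d : B.A ⟶ V ⊗ P.A} (hd : ∀ j, IsColinear V (A j) B (d ≫ V ◁ (p j).f)) :
    IsColinear V P B d := by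
  refine hp _ _ fun j => ?_
  have e : (d ≫ V ◁ (p j).f) ≫ V ◁ (A j).a =
    B.a ≫ G.map (d ≫ V ◁ (p j).f) ≫ G.costr V (A j).A := hd j
  rw [assoc, ← MonoidalCategory.whiskerLeft_comp, (p j).h, assoc, assoc,
    ← G.costr_naturality_right, ← Functor.map_comp_assoc, MonoidalCategory.whiskerLeft_comp,
    ← e, assoc, ← MonoidalCategory.whiskerLeft_comp]

variable {G} in
theorem IsColinear.of_jointly_mono' {ι : Type*} {V : ι → C} {W : C} {A B : G.EM}
    (p : ∀ j, W ⟶ V j)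
    (hp : ∀ x y : B.A ⟶ W ⊗ G.obj A.A,
      (∀ j, x ≫ p j ▷ G.obj A.A = y ≫ p j ▷ G.obj A.A) → x = y)
    {d : B.A ⟶ W ⊗ A.A} (hd : ∀ j, IsColinear (V j) A B (d ≫ p j ▷ A.A)) :
    IsColinear W A B d := by
  refine hp _ _ fun j => ?_
  rw [assoc, whisker_exchange, assoc, assoc, ← G.costr_naturality_left, ← Functor.map_comp_assoc,
    ← assoc]
  exact hd j

/-- An action of `C` on the comodules over `G` together with universal colinear morphisms
`V ▶ A ⟶ V ⊗ A` which are compatible with all the structure of the action. -/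
structure UniversalAction [MonoidalLeftAction C G.EM] where
  /-- The universal colinear morphism. -/
  univ (V : C) (A : G.EM) : (V ⊙ₗ A).A ⟶ V ⊗ A.A
  isUniversal (V : C) (A : G.EM) : IsUniversal V A (V ⊙ₗ A) (univ V A)
  left {V W : C} (f : V ⟶ W) (A : G.EM) : (f ⊵ₗ A).f ≫ univ W A = univ V A ≫ f ▷ A.A
  right (V : C) {A B : G.EM} (g : A ⟶ B) : (V ⊴ₗ g).f ≫ univ V B = univ V A ≫ V ◁ g.f
  unitor (A : G.EM) : (λₗ A).inv.f ≫ univ (𝟙_ C) A = (λ_ A.A).inv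
  associator (V W : C) (A : G.EM) :
    (αₗ V W A).inv.f ≫ univ (V ⊗ W) A = univ V (W ⊙ₗ A) ≫ V ◁ univ W A ≫ (α_ V W A.A).inv

/-- The universal colinear morphisms of a Linton module structure. -/
def LintonAction.universalAction {G : LeftExactOplaxModuleComonad k C} (L : G.LintonAction) :
    letI := L.action
    G.UniversalAction :=
  letI := L.action
  { univ V A := res (L.incl V A)
    isUniversal V A := isUniversal_res _ _ (L.isLimit V A).some
    left f A := by
      rw [← res_comp, ← res_comp_map, L.naturality_left]
    right V _ _ g := by
      rw [← res_comp, ← res_comp_map, L.naturality_right]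
    unitor A := by
      rw [← res_comp, L.unitality]
      refine (res_comp_map (λ_ A.A).inv (G.toComonad.adj.unit.app A)).trans ?_
      exact (congrArg (· ≫ _) (res_unit A)).trans (id_comp _)
    associator V W A := by
      rw [← res_comp, L.associativity, res_comp_map]
      rfl }

/-- An oplax `C`-module structure on the composite of `K : N ⥤ EM(G)` with the forgetful functor
whose structure morphisms are universal colinear morphisms. -/
structure UniversalFunctor {N : Type*} [Category* N] [MonoidalLeftAction C N] (K : N ⥤ G.EM) where
  /-- The universal colinear morphism. -/
  univ (V : C) (X : N) : (K.obj (V ⊙ₗ X)).A ⟶ V ⊗ (K.obj X).A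
  isUniversal (V : C) (X : N) : IsUniversal V (K.obj X) (K.obj (V ⊙ₗ X)) (univ V X)
  left {V W : C} (f : V ⟶ W) (X : N) :
    (K.map (f ⊵ₗ X)).f ≫ univ W X = univ V X ≫ f ▷ (K.obj X).A
  right (V : C) {X Y : N} (g : X ⟶ Y) :
    (K.map (V ⊴ₗ g)).f ≫ univ V Y = univ V X ≫ V ◁ (K.map g).f
  unitor (X : N) : (K.map (λₗ X).inv).f ≫ univ (𝟙_ C) X = (λ_ (K.obj X).A).inv
  associator (V W : C) (X : N) :
    (K.map (αₗ V W X).inv).f ≫ univ (V ⊗ W) X =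
      univ V (W ⊙ₗ X) ≫ V ◁ univ W X ≫ (α_ V W (K.obj X).A).inv

variable {G} [MonoidalLeftAction C G.EM] (U : G.UniversalAction)

namespace UniversalAction

/-- The universal colinear morphisms of an action, seen as a structure on the identity functor. -/
def idFunctor : G.UniversalFunctor (𝟭 G.EM) where
  univ := U.univ
  isUniversal := U.isUniversal
  left := U.left
  right := U.right
  unitor := U.unitor
  associator := U.associator

section

variable {N : Type*} [Category* N] [MonoidalLeftAction C N] {K : N ⥤ G.EM}
  (S : G.UniversalFunctor K)

/-- The comparison of universal colinear morphisms. -/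
def comparison (V : C) (X : N) : K.obj (V ⊙ₗ X) ⟶ V ⊙ₗ K.obj X :=
  (U.isUniversal V (K.obj X)).lift (S.univ V X) (S.isUniversal V X).isColinear

theorem comparison_univ (V : C) (X : N) :
    (U.comparison S V X).f ≫ U.univ V (K.obj X) = S.univ V X :=
  (U.isUniversal V (K.obj X)).fac _ _

theorem isIso_comparison (V : C) (X : N) : IsIso (U.comparison S V X) :=
  (U.isUniversal V (K.obj X)).isIso_of_comp_eq (S.isUniversal V X) (U.comparison_univ S V X)

/-- Both sides end in `(V ⊗ W) ▶ K X`, where the universal morphism detects equality. The oplax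
axiom follows by inverting the associators. -/
theorem comparison_associator_inv (V W : C) (X : N) :
    U.comparison S V (W ⊙ₗ X) ≫ V ⊴ₗ U.comparison S W X ≫ (αₗ V W (K.obj X)).inv =
      K.map (αₗ V W X).inv ≫ U.comparison S (V ⊗ W) X :=
  (U.isUniversal _ (K.obj X)).hom_ext (by
    simp only [Comonad.Coalgebra.comp_f, assoc]
    rw [U.comparison_univ, S.associator, U.associator, reassoc_of% U.right,
      reassoc_of% U.comparison_univ, ← MonoidalCategory.whiskerLeft_comp_assoc,
      U.comparison_univ])

/-- A functor with a universal structure is an oplax module functor. -/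
abbrev oplaxLeftLinear : K.OplaxLeftLinear C where
  δₗ := U.comparison S
  δₗ_naturality_left {_ W} f X := (U.isUniversal W (K.obj X)).hom_ext (by
    rw [Comonad.Coalgebra.comp_f, Comonad.Coalgebra.comp_f, assoc, assoc, U.left,
      U.comparison_univ, reassoc_of% U.comparison_univ, S.left])
  δₗ_naturality_right V _ Y f := (U.isUniversal V (K.obj Y)).hom_ext (by
    rw [Comonad.Coalgebra.comp_f, Comonad.Coalgebra.comp_f, assoc, assoc, U.right,
      U.comparison_univ, reassoc_of% U.comparison_univ, S.right])
  δₗ_associativity V W X := by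
    rw [← cancel_mono (αₗ V W (K.obj X)).inv, assoc, assoc, assoc, Iso.hom_inv_id, comp_id,
      U.comparison_associator_inv, ← Functor.map_comp_assoc, Iso.hom_inv_id,
      CategoryTheory.Functor.map_id, id_comp]
  δₗ_unitality_inv X := (U.isUniversal _ (K.obj X)).hom_ext (by
    rw [Comonad.Coalgebra.comp_f, assoc, U.comparison_univ, U.unitor, S.unitor])

/-- A functor with a universal structure is a strong module functor. -/
abbrev leftLinear : K.LeftLinear C :=
  letI := U.oplaxLeftLinear S
  leftLinearOfOplax K (U.isIso_comparison S)

end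

theorem right_comp (V : C) {A B D : G.EM} (g : A ⟶ B) (h : D ⟶ V ⊙ₗ A) :
    (h.f ≫ U.univ V A) ≫ V ◁ g.f = (h ≫ V ⊴ₗ g).f ≫ U.univ V B := by
  rw [Comonad.Coalgebra.comp_f, assoc, assoc, U.right]

theorem left_comp {V W : C} (g : V ⟶ W) {A D : G.EM} (h : D ⟶ V ⊙ₗ A) :
    (h.f ≫ U.univ V A) ≫ g ▷ A.A = (h ≫ g ⊵ₗ A).f ≫ U.univ W A := by
  rw [Comonad.Coalgebra.comp_f, assoc, assoc, U.left]

-- A cone over `V ▶ A_j` is a compatible family of colinear morphisms into `V ⊗ A_j`; it lifts to `V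
-- ⊗ lim A_j`, and preservation of the limit by `V ⊗ G -` makes the lift colinear.
include U in
theorem preservesFiniteLimits_actionLeft (V : C) [PreservesFiniteLimits (actionLeft C V)] :
    PreservesFiniteLimits (actionLeft G.EM V) := ⟨fun J _ _ => ⟨fun {K} => ⟨fun {c} hc => by
  have h1 := isLimitOfPreserves (G.toComonad.forget ⋙ actionLeft C V) hc
  have h2 := isLimitOfPreserves (G.toComonad.forget ⋙ G.toFunctor ⋙ actionLeft C V) hc
  have exists_lift (s : Cone (K ⋙ actionLeft G.EM V)) : ∃ f : s.pt.A ⟶ V ⊗ c.pt.A,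
      IsColinear V c.pt s.pt f ∧
        ∀ j, f ≫ V ◁ (c.π.app j).f = (s.π.app j).f ≫ U.univ V (K.obj j) := by
    let t : Cone (K ⋙ G.toComonad.forget ⋙ actionLeft C V) :=
      { pt := s.pt.A
        π :=
          { app j := (s.π.app j).f ≫ U.univ V (K.obj j)
            naturality i j a := (id_comp _).trans
              ((U.right_comp V (K.map a) (s.π.app i)).trans
                (congrArg (fun f => Comonad.Coalgebra.Hom.f f ≫ U.univ V (K.obj j))
                  (s.w a))).symm } }
    refine ⟨h1.lift t, ?_, h1.fac t⟩
    refine IsColinear.of_jointly_mono (fun j => c.π.app j) (fun _ _ h => h2.hom_ext h) fun j => ?_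
    have e : h1.lift t ≫ V ◁ (c.π.app j).f = (s.π.app j).f ≫ U.univ V (K.obj j) := h1.fac t j
    exact (congrArg (IsColinear V (K.obj j) s.pt) e).mpr
      ((U.isUniversal V (K.obj j)).isColinear.hom_comp (s.π.app j))
  exact ⟨{
    lift s := (U.isUniversal V c.pt).lift _ (exists_lift s).choose_spec.1
    fac s j := (U.isUniversal V (K.obj j)).hom_ext ((U.right_comp V (c.π.app j) _).symm.trans
      ((congrArg (· ≫ _) (IsUniversal.fac _ _ _)).trans ((exists_lift s).choose_spec.2 j)))
    uniq s m hm := (U.isUniversal V c.pt).hom_ext ((h1.hom_ext fun j =>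
      (U.right_comp V (c.π.app j) m).trans
        ((congrArg (fun f => Comonad.Coalgebra.Hom.f f ≫ U.univ V (K.obj j)) (hm j)).trans
          ((exists_lift s).choose_spec.2 j).symm)).trans (IsUniversal.fac _ _ _).symm) }⟩⟩⟩⟩

include U in
theorem preservesFiniteLimits_actionRight (A : G.EM)
    (hA : ∀ X : C, PreservesFiniteLimits (actionRight C X)) :
    PreservesFiniteLimits (actionRight C A) := ⟨fun J _ _ => ⟨fun {K} => ⟨fun {c} hc => by
  have h1 := isLimitOfPreserves (actionRight C A.A) hc
  have h2 := isLimitOfPreserves (actionRight C (G.obj A.A)) hc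
  have exists_lift (s : Cone (K ⋙ actionRight C A)) : ∃ f : s.pt.A ⟶ c.pt ⊗ A.A,
      IsColinear c.pt A s.pt f ∧
        ∀ j, f ≫ c.π.app j ▷ A.A = (s.π.app j).f ≫ U.univ (K.obj j) A := by
    let t : Cone (K ⋙ actionRight C A.A) :=
      { pt := s.pt.A
        π :=
          { app j := (s.π.app j).f ≫ U.univ (K.obj j) A
            naturality i j a := (id_comp _).trans
              ((U.left_comp (K.map a) (s.π.app i)).trans
                (congrArg (fun f => Comonad.Coalgebra.Hom.f f ≫ U.univ (K.obj j) A)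
                  (s.w a))).symm } }
    refine ⟨h1.lift t, ?_, h1.fac t⟩
    refine IsColinear.of_jointly_mono' (fun j => c.π.app j) (fun _ _ h => h2.hom_ext h) fun j => ?_
    have e : h1.lift t ≫ c.π.app j ▷ A.A = (s.π.app j).f ≫ U.univ (K.obj j) A := h1.fac t j
    exact (congrArg (IsColinear (K.obj j) A s.pt) e).mpr
      ((U.isUniversal (K.obj j) A).isColinear.hom_comp (s.π.app j))
  exact ⟨{
    lift s := (U.isUniversal c.pt A).lift _ (exists_lift s).choose_spec.1
    fac s j := (U.isUniversal (K.obj j) A).hom_ext ((U.left_comp (c.π.app j) _).symm.trans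
      ((congrArg (· ≫ _) (IsUniversal.fac _ _ _)).trans ((exists_lift s).choose_spec.2 j)))
    uniq s m hm := (U.isUniversal c.pt A).hom_ext ((h1.hom_ext fun j =>
      (U.left_comp (c.π.app j) m).trans
        ((congrArg (fun f => Comonad.Coalgebra.Hom.f f ≫ U.univ (K.obj j) A) (hm j)).trans
          ((exists_lift s).choose_spec.2 j).symm)).trans (IsUniversal.fac _ _ _).symm) }⟩⟩⟩⟩

include U in
theorem leftExactAction [h : LeftExactAction C C] : LeftExactAction C G.EM where
  actionLeft V := U.preservesFiniteLimits_actionLeft V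
  actionRight A := U.preservesFiniteLimits_actionRight A h.actionRight

/-- The action on a cofree comodule. -/
def cofreeIso (V W : C) : G.toComonad.cofree.obj (V ⊗ W) ≅ V ⊙ₗ G.toComonad.cofree.obj W :=
  (isUniversal_costr V W).iso (U.isUniversal _ _)

/-- The functor `- ▶ G(𝟙)` is the cofree comodule functor. -/
def cofreeActionRightIso : G.toComonad.cofree ≅ actionRight C (G.toComonad.cofree.obj (𝟙_ C)) :=
  NatIso.ofComponents (fun V => G.toComonad.cofree.mapIso (ρ_ V).symm ≪≫ U.cofreeIso V (𝟙_ C))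
    (fun {V W} f => (U.isUniversal W _).hom_ext (by
      have e (V : C) : (G.toComonad.cofree.map (ρ_ V).inv ≫ (U.cofreeIso V (𝟙_ C)).hom).f ≫
          U.univ V (G.toComonad.cofree.obj (𝟙_ C)) =
            G.map (ρ_ V).inv ≫ G.costr V (𝟙_ C) :=
        (assoc _ _ _).trans (congrArg (_ ≫ ·)
          ((U.isUniversal _ _).fac _ (IsColinear.costr V (𝟙_ C))))
      refine .trans ?_ (U.left_comp f _)
      refine (assoc _ _ _).trans ((congrArg (G.map f ≫ ·) (e W)).trans ?_)
      exact (G.costr_rightUnitor_naturality f).trans (congrArg (· ≫ _) (e V)).symm))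

end UniversalAction

section

variable {G : LeftExactOplaxModuleComonad k C}

/-- The coaction is split by `ε`, and left exactness of `G` keeps an embedding into an injective
object mono. -/
theorem exists_mono_cofree [EnoughInjectives C] (A : G.EM) :
    ∃ (I : C) (_ : Injective I) (f : A ⟶ G.toComonad.cofree.obj I), Mono f := by
  refine ⟨Injective.under A.A, inferInstance, ext (Injective.ι A.A), ?_⟩
  have : Mono (G.toComonad.forget.map (ext (Injective.ι A.A))) := ?_
  · exact G.toComonad.forget.mono_of_mono_map this
  change Mono (A.a ≫ G.map (Injective.ι A.A))
  have : Mono A.a := (SplitMono.mk _ A.counit).mono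
  infer_instance

theorem injective_cofree (I : C) (hI : Injective I) : Injective (G.toComonad.cofree.obj I) :=
  G.toComonad.adj.map_injective I hI

theorem exists_retract_cofree [EnoughInjectives C] (Q : G.EM) (hQ : Injective Q) :
    ∃ (I : C) (_ : Injective I), Nonempty (Retract Q (G.toComonad.cofree.obj I)) := by
  obtain ⟨I, hI, f, hf⟩ := exists_mono_cofree Q
  exact ⟨I, hI, ⟨⟨f, Injective.factorThru (𝟙 Q) f, Injective.comp_factorThru _ _⟩⟩⟩

theorem enoughInjectives_EM [EnoughInjectives C] : EnoughInjectives G.EM where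
  presentation A := by
    obtain ⟨I, hI, f, hf⟩ := exists_mono_cofree A
    exact ⟨{ J := _, injective := injective_cofree I hI, f := f, mono := hf }⟩

end

variable {G : LeftExactOplaxModuleComonad k C} [MonoidalPreadditive C] [MonoidalLinear k C]
  [EnoughInjectives C] [LeftExactAction C C]

/-- All properties of `G(𝟙)` come from `- ▶ G(𝟙) ≅ cofree`, whose left adjoint is the forgetful
functor. -/
theorem isInjectiveReconstruction (L : G.LintonAction) :
    L.toModuleCategory.IsInjectiveReconstruction L.cofreeUnit :=
  letI := L.action
  let U := L.universalAction
  have e (P : C) : G.toComonad.cofree.obj P ≅ P ⊙ₗ G.toComonad.cofree.obj (𝟙_ C) :=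
    U.cofreeActionRightIso.app P
  { leftExact := U.leftExactAction
    enoughInjectives := enoughInjectives_EM
    coclosed := (G.toComonad.adj.ofNatIsoRight U.cofreeActionRightIso).isRightAdjoint
    injective I hI := Injective.of_iso (e I) (injective_cofree I hI)
    cogenerator Q hQ := by
      obtain ⟨I, hI, ⟨r⟩⟩ := exists_retract_cofree (G := G) Q hQ
      exact ⟨I, hI, ⟨r.trans (.ofIso (e I))⟩⟩ }

end LeftExactOplaxModuleComonad

end ModuleReconstruction
end
-- Mates as universal colinear morphisms, and comonadicity.
noncomputable section
namespace ModuleReconstruction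

section Mates

variable {C : Type*} [Category* C] [MonoidalCategory C]
variable {M : Type*} [Category.{v} M] [MonoidalLeftAction C M]
variable {N : Type*} [Category.{v} N] [MonoidalLeftAction C N]
variable {F : N ⥤ M} {H : M ⥤ N} [F.LeftLinear C] (adj : H ⊣ F)

/-- A morphism `H Z ⟶ V ▷ H Y` is colinear over the comonad of an adjunction `H ⊣ F` if and only if
its transpose is compatible with the canonical copresentation of `Y`. -/
theorem colinear_iff_homEquiv {V : C} {Y Z : M} (f : H.obj Z ⟶ V ⊙ₗ H.obj Y) :
    f ≫ V ⊴ₗ H.map (adj.unit.app Y) =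
        H.map (adj.unit.app Z) ≫ H.map (F.map f) ≫
          H.map (δₗ F V (H.obj Y)) ≫ oplaxMate adj V (F.obj (H.obj Y)) ↔
      (adj.homEquiv _ _ f ≫ δₗ F V (H.obj Y)) ≫ V ⊴ₗ F.map (H.map (adj.unit.app Y)) =
        (adj.homEquiv _ _ f ≫ δₗ F V (H.obj Y)) ≫ V ⊴ₗ adj.unit.app (F.obj (H.obj Y)) := by
  have h1 : adj.homEquiv _ _ (f ≫ V ⊴ₗ H.map (adj.unit.app Y)) =
      ((adj.homEquiv _ _ f ≫ δₗ F V (H.obj Y)) ≫ V ⊴ₗ F.map (H.map (adj.unit.app Y))) ≫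
        μₗ F V _ := by
    rw [adj.homEquiv_naturality_right]
    simp
  have h2 : adj.homEquiv _ _ (H.map (adj.unit.app Z) ≫ H.map (F.map f) ≫
      H.map (δₗ F V (H.obj Y)) ≫ oplaxMate adj V (F.obj (H.obj Y))) =
      ((adj.homEquiv _ _ f ≫ δₗ F V (H.obj Y)) ≫ V ⊴ₗ adj.unit.app (F.obj (H.obj Y))) ≫
        μₗ F V _ := by
    rw [adj.homEquiv_naturality_left, adj.homEquiv_naturality_left,
      adj.homEquiv_naturality_left, homEquiv_oplaxMate, ← unit_comp_map]
    simp only [assoc]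
  refine (adj.homEquiv _ _).injective.eq_iff.symm.trans ((Eq.congr h1 h2).trans ?_)
  exact cancel_mono _

theorem oplaxMate_colinear (V : C) (Y : M) :
    oplaxMate adj V Y ≫ V ⊴ₗ H.map (adj.unit.app Y) =
      H.map (adj.unit.app (V ⊙ₗ Y)) ≫ H.map (F.map (oplaxMate adj V Y)) ≫
        H.map (δₗ F V (H.obj Y)) ≫ oplaxMate adj V (F.obj (H.obj Y)) := by
  refine (colinear_iff_homEquiv adj _).2 ?_
  rw [homEquiv_oplaxMate]
  simp only [assoc, Functor.LeftLinear.μₗ_comp_δₗ_assoc, ← actionHomRight_comp]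
  exact congrArg (V ⊴ₗ ·) (adj.unit_naturality _)

theorem map_comp_oplaxMate (V : C) {Y Z : M} (g : Z ⟶ V ⊙ₗ Y) :
    adj.homEquiv _ _ (H.map g ≫ oplaxMate adj V Y) =
      g ≫ V ⊴ₗ adj.unit.app Y ≫ μₗ F V (H.obj Y) := by
  rw [adj.homEquiv_naturality_left, homEquiv_oplaxMate]

/-- The mate is universal among the colinear morphisms `H Z ⟶ V ▷ H Y`. -/
theorem exists_oplaxMate_fac {V : C} {Y Z : M}
    (h : IsLimit (Comonad.ComonadicityInternal.unitFork adj Y))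
    [PreservesFiniteLimits (actionLeft M V)] (f : H.obj Z ⟶ V ⊙ₗ H.obj Y)
    (hf : f ≫ V ⊴ₗ H.map (adj.unit.app Y) =
        H.map (adj.unit.app Z) ≫ H.map (F.map f) ≫
          H.map (δₗ F V (H.obj Y)) ≫ oplaxMate adj V (F.obj (H.obj Y))) :
    ∃ g : Z ⟶ V ⊙ₗ Y, H.map g ≫ oplaxMate adj V Y = f := by
  -- Left exactness of `V ▷ -` keeps the canonical copresentation of `Y` an equalizer, through which
  -- the transpose of `f` factors.
  have hV := isLimitForkMapOfIsLimit (actionLeft M V) _ h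
  obtain ⟨g, hg⟩ : ∃ g : Z ⟶ V ⊙ₗ Y, g ≫ V ⊴ₗ adj.unit.app Y =
      adj.homEquiv _ _ f ≫ δₗ F V (H.obj Y) :=
    ⟨Fork.IsLimit.lift hV (adj.homEquiv _ _ f ≫ δₗ F V (H.obj Y))
      ((colinear_iff_homEquiv adj f).1 hf), Fork.IsLimit.lift_ι' hV _ _⟩
  refine ⟨g, (adj.homEquiv _ _).injective ?_⟩
  rw [map_comp_oplaxMate, reassoc_of% hg, Functor.LeftLinear.δₗ_comp_μₗ, comp_id]

theorem oplaxMate_hom_ext {V : C} {Y Z : M}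
    (h : IsLimit (Comonad.ComonadicityInternal.unitFork adj Y))
    [PreservesFiniteLimits (actionLeft M V)] {g g' : Z ⟶ V ⊙ₗ Y}
    (e : H.map g ≫ oplaxMate adj V Y = H.map g' ≫ oplaxMate adj V Y) : g = g' := by
  have e' := congrArg (adj.homEquiv _ _) e
  rw [map_comp_oplaxMate, map_comp_oplaxMate, ← assoc, ← assoc, cancel_mono] at e'
  exact Fork.IsLimit.hom_ext (isLimitForkMapOfIsLimit (actionLeft M V) _ h) e'

end Mates

section Comparison

variable {k : Type w} [Field k] {C : Type u} [Category.{v} C] [Abelian C] [Linear k C]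
  [MonoidalCategory C]

/-- Universality may be tested on the objects in the image of an equivalence. -/
theorem LeftExactOplaxModuleComonad.IsUniversal.of_isEquivalence
    {G : LeftExactOplaxModuleComonad k C}
    {N : Type*} [Category* N] (K : N ⥤ G.EM) [K.IsEquivalence] {V : C} {A E : G.EM}
    {u : E.A ⟶ V ⊗ A.A} (hu : IsColinear V A E u)
    (fac : ∀ (Z : N) (f : (K.obj Z).A ⟶ V ⊗ A.A), IsColinear V A (K.obj Z) f →
      ∃ h : K.obj Z ⟶ E, h.f ≫ u = f)
    (ext : ∀ (Z : N) (g h : K.obj Z ⟶ E), g.f ≫ u = h.f ≫ u → g = h) :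
    IsUniversal V A E u where
  isColinear := hu
  exists_fac {B} f hf := by
    let e := K.objObjPreimageIso B
    obtain ⟨h, hh⟩ := fac _ (e.hom.f ≫ f) (hf.hom_comp e.hom)
    refine ⟨e.inv ≫ h, ?_⟩
    rw [Comonad.Coalgebra.comp_f, assoc, hh, ← assoc]
    exact (congrArg (Comonad.Coalgebra.Hom.f · ≫ f) e.inv_hom_id).trans (id_comp _)
  hom_ext {B g h} eq := by
    let e := K.objObjPreimageIso B
    rw [← cancel_epi e.hom]
    exact ext _ _ _ (by rw [Comonad.Coalgebra.comp_f, Comonad.Coalgebra.comp_f, assoc, eq, assoc])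

/-- The target embeds into some `P ▷ X`, and morphisms into `P ▷ X` transpose to morphisms out of
the image of `H`. -/
theorem faithful_leftAdjoint {M : AbelianModuleCategory.{v', u'} k C} {X : M} {H : M ⥤ C}
    (adj : H ⊣ actionRight C X) (hM : EnoughInjectives M) (hX : M.IsCCogenerator X) :
    H.Faithful where
  map_injective {Y Z f g} e := by
    obtain ⟨P, -, ⟨r⟩⟩ := hX (Injective.under Z) inferInstance
    have : Mono r.i := (SplitMono.mk r.r r.retract).mono
    rw [← cancel_mono (Injective.ι Z), ← cancel_mono r.i, assoc, assoc]
    refine (adj.homEquiv Y P).symm.injective ?_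
    exact (adj.homEquiv_naturality_left_symm f _).trans
      ((congrArg (· ≫ _) e).trans (adj.homEquiv_naturality_left_symm g _).symm)

namespace InjectivePair

variable (p : InjectivePair.{v, u'} k C) (H : p.M ⥤ C) (adj : H ⊣ actionRight C p.X)

include adj in
theorem reflectsIsomorphisms : H.ReflectsIsomorphisms :=
  have := faithful_leftAdjoint adj p.prop.enoughInjectives p.prop.cogenerator
  reflectsIsomorphisms_of_reflectsMonomorphisms_of_reflectsEpimorphisms H

variable [EnoughInjectives C]

/-- The comparison functor to the Eilenberg-Moore category of the comonad `[X, - ▷ X]`. -/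
def comparison : p.M ⥤ (p.internalCohomComonad H adj).EM := Comonad.comparison adj

include adj in
theorem preservesFiniteLimits : PreservesFiniteLimits H :=
  leftExact_leftAdjoint adj p.prop.injective

/-- Crude comonadicity: `H` is left exact and reflects isomorphisms. -/
instance : (p.comparison H adj).IsEquivalence :=
  have := p.reflectsIsomorphisms H adj
  have := p.preservesFiniteLimits H adj
  have : Comonad.PreservesLimitOfIsCoreflexivePair H := ⟨fun _ _ _ _ _ => inferInstance⟩
  (Comonad.comonadicOfHasPreservesCoreflexiveEqualizersOfReflectsIsomorphisms adj).eqv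

instance : (p.comparison H adj).Additive :=
  have := adj.left_adjoint_additive
  ⟨fun {_ _ _ _} => Comonad.Coalgebra.Hom.ext H.map_add⟩

instance : (p.comparison H adj).Linear k :=
  have := adj.left_adjoint_additive
  have := linear_leftAdjoint adj
  ⟨fun _ _ => Comonad.Coalgebra.Hom.ext (H.map_smul _ _)⟩

/-- The canonical copresentation of an object of `M` is an equalizer. -/
def unitIsLimit (Y : p.M) : IsLimit (Comonad.ComonadicityInternal.unitFork adj Y) :=
  have := p.reflectsIsomorphisms H adj
  have := p.preservesFiniteLimits H adj
  have := reflectsLimit_of_reflectsIsomorphisms (parallelPair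
    ((actionRight C p.X).map (H.map (adj.unit.app Y)))
      (adj.unit.app ((actionRight C p.X).obj (H.obj Y)))) H
  Comonad.ComonadicityInternal.unitEqualizerOfCoreflectsEqualizer adj Y

open LeftExactOplaxModuleComonad in
theorem isUniversal_oplaxMate (V : C) (Y : p.M) :
    IsUniversal (G := p.internalCohomComonad H adj) V ((p.comparison H adj).obj Y)
      ((p.comparison H adj).obj (V ⊙ₗ Y)) (oplaxMate adj V Y) :=
    have := p.prop.leftExact.actionLeft V
    .of_isEquivalence (p.comparison H adj) (oplaxMate_colinear adj V Y)
      (fun Z f hf => by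
        obtain ⟨g, hg⟩ := exists_oplaxMate_fac (V := V) (Y := Y) (Z := Z) adj
          (p.unitIsLimit H adj Y) f hf
        exact ⟨(p.comparison H adj).map g, hg⟩)
      (fun Z g h e => by
        obtain ⟨g, rfl⟩ := (p.comparison H adj).map_surjective g
        obtain ⟨h, rfl⟩ := (p.comparison H adj).map_surjective h
        exact congrArg _ (oplaxMate_hom_ext adj (p.unitIsLimit H adj Y) e))

/-- The mates are universal colinear morphisms. -/
def universalFunctor :
    (p.internalCohomComonad H adj).UniversalFunctor (p.comparison H adj) :=
  letI := leftAdjointOplax (C := C) adj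
  { univ V Y := oplaxMate adj V Y
    isUniversal := p.isUniversal_oplaxMate H adj
    left f Y := δₗ_naturality_left H f Y
    right V _ _ g := δₗ_naturality_right H V g
    unitor Y := (δₗ_unitality_inv (C := C) H Y).symm
    associator V W Y := (δₗ_associativity_inv H V W Y).symm }

end InjectivePair

end Comparison

section

variable {k : Type w} [Field k] {C : Type u} [Category.{v} C] [Abelian C] [Linear k C]
  [MonoidalCategory C] [MonoidalPreadditive C] [MonoidalLinear k C]

theorem InjectivePair.equivalent_internalCohomComonad [EnoughInjectives C]
    (p : InjectivePair.{v, max u v} k C) (H : p.M ⥤ C) (adj : H ⊣ actionRight C p.X)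
    (L : (p.internalCohomComonad H adj).LintonAction) : p.M.Equivalent L.toModuleCategory :=
  letI := L.action
  ⟨p.comparison H adj, inferInstanceAs (p.comparison H adj).IsEquivalence,
    inferInstanceAs (p.comparison H adj).Additive,
    inferInstanceAs ((p.comparison H adj).Linear k),
    ⟨L.universalAction.leftLinear (p.universalFunctor H adj)⟩⟩

theorem LeftExactOplaxModuleComonad.LintonAction.equivalent {G : LeftExactOplaxModuleComonad k C}
    (L L' : G.LintonAction) : L.toModuleCategory.Equivalent L'.toModuleCategory :=
  letI := L.action
  let S := L.universalAction.idFunctor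
  let hF := @UniversalAction.leftLinear _ _ _ _ _ _ _ G L'.action L'.universalAction G.EM _ L.action
    (𝟭 G.EM) S
  ⟨𝟭 G.EM, inferInstanceAs (𝟭 G.EM).IsEquivalence, inferInstanceAs (𝟭 G.EM).Additive,
    inferInstanceAs ((𝟭 G.EM).Linear k), ⟨hF⟩⟩

end

end ModuleReconstruction
end
-- The bijection between pairs and comonads.
noncomputable section
namespace ModuleReconstruction

variable {k : Type w} [Field k] {C : Type u} [Category.{v} C] [Abelian C] [Linear k C]
  [MonoidalCategory C]

theorem InjectivePair.equivalence :
    _root_.Equivalence (InjectivePair.Equivalent : InjectivePair.{v', u'} k C → _ → Prop) :=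
  AbelianModuleCategory.equivalence.comap InjectivePair.M

variable [MonoidalPreadditive C] [MonoidalLinear k C]

section

variable [LeftExactAction C C]

theorem LeftExactOplaxModuleComonad.equivalence :
    _root_.Equivalence
      (LeftExactOplaxModuleComonad.Equivalent : LeftExactOplaxModuleComonad k C → _ → Prop) where
  refl _ := ⟨univLintonAction, univLintonAction, AbelianModuleCategory.equivalence.refl _⟩
  symm := fun ⟨L, L', h⟩ => ⟨L', L, AbelianModuleCategory.equivalence.symm h⟩
  trans := fun ⟨L, L', h⟩ ⟨K, K', h'⟩ => ⟨L, K', AbelianModuleCategory.equivalence.trans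
    (AbelianModuleCategory.equivalence.trans h (L'.equivalent K)) h'⟩

variable [EnoughInjectives C]

theorem InjectivePair.internalCohomComonad_equivalent {p q : InjectivePair.{v, max u v} k C}
    (h : p.Equivalent q) (H : p.M ⥤ C) (adj : H ⊣ actionRight C p.X) (H' : q.M ⥤ C)
    (adj' : H' ⊣ actionRight C q.X) :
    (p.internalCohomComonad H adj).Equivalent (q.internalCohomComonad H' adj') :=
  ⟨LeftExactOplaxModuleComonad.univLintonAction, LeftExactOplaxModuleComonad.univLintonAction,
    AbelianModuleCategory.equivalence.trans
      (AbelianModuleCategory.equivalence.symm (p.equivalent_internalCohomComonad H adj _))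
      (AbelianModuleCategory.equivalence.trans h (q.equivalent_internalCohomComonad H' adj' _))⟩

/-- The comonad `[X, - ▷ X]` of a pair, for a chosen left adjoint `[X, -]`. -/
def InjectivePair.comonad (p : InjectivePair.{v, max u v} k C) : LeftExactOplaxModuleComonad k C :=
  have : (actionRight C p.X).IsRightAdjoint := p.prop.coclosed
  p.internalCohomComonad _ (Adjunction.ofIsRightAdjoint (actionRight C p.X))

/-- The pair `(EM(G), G(𝟙))` of a comonad. -/
def LeftExactOplaxModuleComonad.LintonAction.pair {G : LeftExactOplaxModuleComonad k C}
    (L : G.LintonAction) : InjectivePair.{v, max u v} k C :=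
  ⟨L.toModuleCategory, L.cofreeUnit, isInjectiveReconstruction L⟩

theorem LeftExactOplaxModuleComonad.LintonAction.pair_equivalent {G G' : LeftExactOplaxModuleComonad k C}
    (h : G.Equivalent G') (L : G.LintonAction) (L' : G'.LintonAction) :
    L.pair.Equivalent L'.pair :=
  let ⟨_, _, h⟩ := h
  AbelianModuleCategory.equivalence.trans (L.equivalent _)
    (AbelianModuleCategory.equivalence.trans h (LintonAction.equivalent _ L'))

/-- The bijection between pairs and comonads up to equivalence. -/
def pairEquivComonad :
    Quot (InjectivePair.Equivalent : InjectivePair.{v, max u v} k C → _ → Prop) ≃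
      Quot (LeftExactOplaxModuleComonad.Equivalent : LeftExactOplaxModuleComonad k C → _ → Prop) where
  toFun := Quot.map InjectivePair.comonad fun _ _ h =>
    InjectivePair.internalCohomComonad_equivalent h _ _ _ _
  invFun := Quot.map
    (fun G => (LeftExactOplaxModuleComonad.univLintonAction : G.LintonAction).pair)
    fun _ _ h => LeftExactOplaxModuleComonad.LintonAction.pair_equivalent h _ _
  left_inv := by
    rintro ⟨p⟩
    exact Quot.sound
      (AbelianModuleCategory.equivalence.symm (p.equivalent_internalCohomComonad _ _ _))
  -- The comonad of `(EM(G), G(𝟙))` is related to `G` through the equivalence of that pair with its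
  -- own Eilenberg-Moore category; no isomorphism of comonads is needed.
  right_inv := by
    rintro ⟨G⟩
    let L : G.LintonAction := LeftExactOplaxModuleComonad.univLintonAction
    exact Quot.sound ⟨LeftExactOplaxModuleComonad.univLintonAction, L,
      AbelianModuleCategory.equivalence.symm (L.pair.equivalent_internalCohomComonad _ _ _)⟩

end

theorem injective_reconstruction [EnoughInjectives C] (_ : LeftExactAction C C) :
    (∀ G : LeftExactOplaxModuleComonad k C,
      Nonempty G.LintonAction ∧
      (∀ L : G.LintonAction, L.toModuleCategory.IsInjectiveReconstruction L.cofreeUnit) ∧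
      (∀ L L' : G.LintonAction, L.toModuleCategory.Equivalent L'.toModuleCategory)) ∧
    _root_.Equivalence
      (InjectivePair.Equivalent : InjectivePair.{v, max u v} k C → _ → Prop) ∧
    _root_.Equivalence
      (LeftExactOplaxModuleComonad.Equivalent : LeftExactOplaxModuleComonad k C → _ → Prop) ∧
    ∃ e : Quot (InjectivePair.Equivalent : InjectivePair.{v, max u v} k C → _ → Prop) ≃
        Quot (LeftExactOplaxModuleComonad.Equivalent : LeftExactOplaxModuleComonad k C → _ → Prop),
      (∀ (p : InjectivePair.{v, max u v} k C) (H : p.M ⥤ C) (adj : H ⊣ actionRight C p.X),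
        e (Quot.mk _ p) = Quot.mk _ (p.internalCohomComonad H adj)) ∧
      (∀ (G : LeftExactOplaxModuleComonad k C) (L : G.LintonAction),
        ∃ h : L.toModuleCategory.IsInjectiveReconstruction L.cofreeUnit,
          e.symm (Quot.mk _ G) = Quot.mk _ ⟨L.toModuleCategory, L.cofreeUnit, h⟩) :=
  ⟨fun _ => ⟨⟨LeftExactOplaxModuleComonad.univLintonAction⟩,
      LeftExactOplaxModuleComonad.isInjectiveReconstruction, fun L L' => L.equivalent L'⟩,
    InjectivePair.equivalence, LeftExactOplaxModuleComonad.equivalence, pairEquivComonad,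
    fun p _ _ => Quot.sound (InjectivePair.internalCohomComonad_equivalent
      (InjectivePair.equivalence.refl p) _ _ _ _),
    fun G L => ⟨LeftExactOplaxModuleComonad.isInjectiveReconstruction L,
      Quot.sound (LeftExactOplaxModuleComonad.LintonAction.pair_equivalent
        (LeftExactOplaxModuleComonad.equivalence.refl G) _ L)⟩⟩

end ModuleReconstruction
end

theorem theorem5p2 {k : Type w} [Field k] {C : Type u} [Category.{v} C] [Abelian C] [Linear k C]
    [MonoidalCategory C] [MonoidalPreadditive C] [MonoidalLinear k C] :
    (∀ [EnoughProjectives C], RightExactAction C C →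
      (∀ T : RightExactLaxModuleMonad k C,
        Nonempty T.LintonAction ∧
        (∀ L : T.LintonAction, L.toModuleCategory.IsProjectiveReconstruction L.freeUnit) ∧
        (∀ L L' : T.LintonAction, L.toModuleCategory.Equivalent L'.toModuleCategory)) ∧
      Equivalence (ProjectivePair.Equivalent : ProjectivePair.{v, max u v} k C → _ → Prop) ∧
      Equivalence (RightExactLaxModuleMonad.Equivalent : RightExactLaxModuleMonad k C → _ → Prop) ∧
      ∃ e : Quot (ProjectivePair.Equivalent : ProjectivePair.{v, max u v} k C → _ → Prop) ≃
          Quot (RightExactLaxModuleMonad.Equivalent : RightExactLaxModuleMonad k C → _ → Prop),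
        (∀ (p : ProjectivePair.{v, max u v} k C) (H : p.M ⥤ C) (adj : actionRight C p.X ⊣ H),
          e (Quot.mk _ p) = Quot.mk _ (p.internalHomMonad H adj)) ∧
        (∀ (T : RightExactLaxModuleMonad k C) (L : T.LintonAction),
          ∃ h : L.toModuleCategory.IsProjectiveReconstruction L.freeUnit,
            e.symm (Quot.mk _ T) = Quot.mk _ ⟨L.toModuleCategory, L.freeUnit, h⟩)) ∧
    (∀ [EnoughInjectives C], LeftExactAction C C →
      (∀ G : LeftExactOplaxModuleComonad k C,
        Nonempty G.LintonAction ∧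
        (∀ L : G.LintonAction, L.toModuleCategory.IsInjectiveReconstruction L.cofreeUnit) ∧
        (∀ L L' : G.LintonAction, L.toModuleCategory.Equivalent L'.toModuleCategory)) ∧
      Equivalence (InjectivePair.Equivalent : InjectivePair.{v, max u v} k C → _ → Prop) ∧
      Equivalence
        (LeftExactOplaxModuleComonad.Equivalent : LeftExactOplaxModuleComonad k C → _ → Prop) ∧
      ∃ e : Quot (InjectivePair.Equivalent : InjectivePair.{v, max u v} k C → _ → Prop) ≃
          Quot
            (LeftExactOplaxModuleComonad.Equivalent : LeftExactOplaxModuleComonad k C → _ → Prop),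
        (∀ (p : InjectivePair.{v, max u v} k C) (H : p.M ⥤ C) (adj : H ⊣ actionRight C p.X),
          e (Quot.mk _ p) = Quot.mk _ (p.internalCohomComonad H adj)) ∧
        (∀ (G : LeftExactOplaxModuleComonad k C) (L : G.LintonAction),
          ∃ h : L.toModuleCategory.IsInjectiveReconstruction L.cofreeUnit,
            e.symm (Quot.mk _ G) = Quot.mk _ ⟨L.toModuleCategory, L.cofreeUnit, h⟩)) :=
  ⟨fun h => projective_reconstruction h, fun h => injective_reconstruction h⟩
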